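/- For $\mu>0$, $k\in\mathbb Z$, $\theta_{in}\in L^2(-1,1)$ and $g^1,g^2\in L^2L^2$ (all complex valued), consider on $(0,\infty)\times(-1,1)$ the $k$-th Fourier mode of the linearized temperature equation, $$\partial_t\theta-\mu(\partial_y^2-k^2)\theta+iky\,\theta=-ik\,g^1-\partial_y g^2,\qquad \theta|_{t=0}=\theta_{in},\qquad \theta|_{y=\pm1}=0,$$ where $\|f\|_{L^pL^q}=\big\|\,\|f(t,\cdot)\|_{L^q(-1,1)}\big\|_{L^p(0,\infty)}$. A solution is a weak solution: $\theta\in L^2(0,T;H^1_0(-1,1))$ for every finite $T$, and for every $v\in H^1_0(-1,1)$ and almost every $t>0$, $$\int_{-1}^1\theta(t)v\,dy=\int_{-1}^1\theta_{in}v\,dy+\int_0^t\!\int_{-1}^1\Big(-\mu\,\partial_y\theta\,\partial_yv-\mu k^2\theta v-iky\,\theta v-ik\,g^1v+g^2\,\partial_yv\Big)dy\,ds.$$ **Proposition.** There is a constant $C>0$, independent of $\mu,k,\theta_{in},g^1,g^2$ and $\theta$, such that for all $\mu>0$, $k\in\mathbb Z$, $\theta_{in}\in L^2(-1,1)$ and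 $g^1,g^2\in L^2L^2$, every solution $\theta$ satisfies $$\|\theta\|_{L^\infty L^2}^2+(\mu k^2)^{1/3}\|\theta\|_{L^2L^2}^2\le C\Big(\|\theta_{in}\|_{L^2}^2+\mu^{-1/3}|k|^{4/3}\|g^1\|_{L^2L^2}^2+\mu^{-1}\|g^2\|_{L^2L^2}^2\Big).$$ -/

import Mathlib

open MeasureTheory Set
open scoped ENNReal

noncomputable section

/-- Lebesgue measure on the cross-section `(-1,1)` of the channel. -/
def channelMeasure : Measure ℝ := volume.restrict (Ioo (-1 : ℝ) 1)

/-- Lebesgue measure on the half-line `(0,∞)` of times. -/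
def timeMeasure : Measure ℝ := volume.restrict (Ioi (0 : ℝ))

/-- The norm `‖f‖_{L²(-1,1)}`, with value `∞` if `f` is not square integrable. -/
def normL2 (f : ℝ → ℂ) : ℝ≥0∞ := eLpNorm f 2 channelMeasure

/-- The space-time norm `‖f‖_{L^p L^q} = ‖ ‖f(t)‖_{L^q(-1,1)} ‖_{L^p(0,∞)}` of `f(t,y)`. -/
def normLpLq (p q : ℝ≥0∞) (f : ℝ → ℝ → ℂ) : ℝ≥0∞ :=
  eLpNorm (fun t => eLpNorm (f t) q channelMeasure) p timeMeasure

/-- `f ∈ L²L²`: `f(t,y)` is (jointly) measurable and square integrable on `(0,∞) × (-1,1)`. -/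
def MemL2L2 (f : ℝ → ℝ → ℂ) : Prop :=
  MemLp (Function.uncurry f) 2 (timeMeasure.prod channelMeasure)

/-- `f ∈ L²(0,T; L²(-1,1))` for every finite `T`. -/
def MemL2LocL2 (f : ℝ → ℝ → ℂ) : Prop :=
  ∀ T : ℝ, 0 < T →
    MemLp (Function.uncurry f) 2 ((volume.restrict (Ioo (0 : ℝ) T)).prod channelMeasure)

/-- `f` belongs to the Sobolev space `H¹₀(-1,1)` and `f'` is its derivative: `f'` is square
integrable and `f` agrees almost everywhere with the absolutely continuous function
`y ↦ ∫_{-1}^y f'`, which vanishes at `y = -1` and at `y = 1`. -/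
structure IsH10 (f f' : ℝ → ℂ) : Prop where
  memLp_deriv : MemLp f' 2 channelMeasure
  ae_eq_primitive : ∀ᵐ y ∂channelMeasure, f y = ∫ s in (-1 : ℝ)..y, f' s
  integral_deriv_eq_zero : ∫ s in (-1 : ℝ)..1, f' s = 0

/-- `θ` is a weak solution on `(0,∞) × (-1,1)` of
`∂ₜθ - μ(∂_y² - k²)θ + i k y θ = -i k g¹ - ∂_y g²`, `θ|_{t=0} = θ_in`, `θ|_{y=±1} = 0`:
it lies in `L²(0,T; H¹₀(-1,1))` for every finite `T`, and satisfies the equation, integrated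
over `(0,t)`, in duality with every `v ∈ H¹₀(-1,1)`. -/
def IsTemperatureSolution (μ : ℝ) (k : ℤ) (θin : ℝ → ℂ) (g₁ g₂ θ : ℝ → ℝ → ℂ) : Prop :=
  MemL2LocL2 θ ∧
  ∃ θy : ℝ → ℝ → ℂ, MemL2LocL2 θy ∧
    (∀ᵐ t ∂timeMeasure, IsH10 (θ t) (θy t)) ∧
    ∀ v v' : ℝ → ℂ, IsH10 v v' → ∀ᵐ t ∂timeMeasure,
      ∫ y, θ t y * v y ∂channelMeasure =
        (∫ y, θin y * v y ∂channelMeasure) +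
          ∫ s in (0 : ℝ)..t, ∫ y,
            (-(μ : ℂ) * (θy s y * v' y + (k : ℂ) ^ 2 * (θ s y * v y))
              - Complex.I * (k : ℂ) * (y : ℂ) * (θ s y * v y)
              - Complex.I * (k : ℂ) * (g₁ s y * v y)
              + g₂ s y * v' y) ∂channelMeasure

end

noncomputable section

/-! The transport term `iky` is skew-adjoint, so testing the equation with `θ` itself only yields
the dissipation `μ‖∂_yθ‖² + μk²‖θ‖²`. The rate `(μk²)^{1/3}` comes from a bounded Hermitian
multiplier that does not commute with `y`. Put `δ = (μ/|k|)^{1/3}`, so that `μ = |k|δ³` and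
`(μk²)^{1/3} = |k|δ`. Let `P` have kernel `i χ(y) χ(z) K(y - z)`, with `K` odd at scale `δ` and `χ`
a cutoff vanishing at the walls, and let `γ = ±10⁻⁷` carry the sign of `k`. In the derivative of
`⟨θ, (1 + γP)θ⟩` the transport term contributes `2γk Im⟨Pθ, yθ⟩`, which is governed by the
nonnegative commutator kernel `(y - z)K(y - z)χ(y)χ(z)` and is at most `2|γk|(-(δ/512)‖θ‖² +
δ³‖∂_yθ‖²)` (`im_inner_kernel_mulY_le`). As `|k|δ³ = μ`, the gradient part is absorbed by viscosity.
The other errors are absorbed as well, since `‖P‖ ≤ 4` and `‖∂_yP‖ ≤ 36/δ`. Young's inequality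
against the damping `|k|δ‖θ‖²` puts the weight `k²/(|k|δ) = μ^{-1/3}|k|^{4/3}` on `g¹`. If `k = 0`,
or if `δ > 1/2`, the plain energy estimate suffices. `exists_multiplier` collects these cases with
uniform constants.

The energy identity for a weak solution is justified by a Galerkin argument. Testing with Dirichlet
sines makes each sine coefficient of `θ` almost everywhere a primitive, so quadratic forms in
finitely many coefficients obey the product rule (`quadratic_form_primitive`). Differentiation turns
sine projections into cosine projections, and completeness of the cosines with a Poincaré inequality
gives convergence of both for `H¹₀` functions. Since `P` maps into `H¹₀`, the projected test
functions converge, and dominated convergence gives `multiplier_energy_inequality`. -/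

/-- The Hilbert space `L²(-1,1)`. -/
abbrev ChannelL2 : Type := Lp ℂ 2 channelMeasure

/-! ### Integration on the channel and product rules for primitives -/

instance : IsFiniteMeasure channelMeasure := by
  unfold channelMeasure; infer_instance

lemma integral_channelMeasure {E : Type*} [NormedAddCommGroup E] [NormedSpace ℝ E] (f : ℝ → E) :
    ∫ y, f y ∂channelMeasure = ∫ y in (-1 : ℝ)..1, f y := by
  rw [channelMeasure, intervalIntegral.integral_of_le (by norm_num), integral_Ioc_eq_integral_Ioo]

lemma ae_channelMeasure {p : ℝ → Prop} :
    (∀ᵐ y ∂channelMeasure, p y) ↔ ∀ᵐ y, y ∈ Ioo (-1 : ℝ) 1 → p y :=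
  ae_restrict_iff' measurableSet_Ioo

lemma integrable_channelMeasure {E : Type*} [NormedAddCommGroup E] {f : ℝ → E} :
    Integrable f channelMeasure ↔ IntervalIntegrable f volume (-1) 1 := by
  rw [intervalIntegrable_iff_integrableOn_Ioo_of_le (by norm_num)]; rfl

lemma ChannelL2.inner_eq (f g : ChannelL2) :
    inner ℂ f g = ∫ y, (starRingEnd ℂ) (f y) * g y ∂channelMeasure := by
  rw [L2.inner_def]; simp [RCLike.inner_apply, mul_comm]

lemma ChannelL2.inner_toLp {f g : ℝ → ℂ} (hf : MemLp f 2 channelMeasure)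
    (hg : MemLp g 2 channelMeasure) :
    inner ℂ (hf.toLp f) (hg.toLp g) = ∫ y, (starRingEnd ℂ) (f y) * g y ∂channelMeasure := by
  rw [ChannelL2.inner_eq]
  refine integral_congr_ae ?_
  filter_upwards [hf.coeFn_toLp, hg.coeFn_toLp] with y h1 h2
  rw [h1, h2]

lemma ChannelL2.norm_sq_eq (f : ChannelL2) : ‖f‖ ^ 2 = ∫ y, ‖f y‖ ^ 2 ∂channelMeasure := by
  have h := inner_self_eq_norm_sq_to_K (𝕜 := ℂ) f
  rw [ChannelL2.inner_eq] at h
  have h2 : ∀ y, (starRingEnd ℂ) (f y) * f y = ((‖f y‖ ^ 2 : ℝ) : ℂ) := fun y => by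
    rw [mul_comm, Complex.mul_conj, Complex.normSq_eq_norm_sq]
  simp_rw [h2, integral_complex_ofReal] at h
  have := congrArg Complex.re h
  simpa [← Complex.ofReal_pow] using this.symm

lemma memLp_two_of_bounded {f : ℝ → ℂ} (hf : Continuous f) : MemLp f 2 channelMeasure := by
  obtain ⟨C, hC⟩ := isCompact_Icc.exists_bound_of_continuousOn (hf.continuousOn (s := Icc (-1 : ℝ) 1))
  refine MemLp.of_bound hf.aestronglyMeasurable C ?_
  rw [ae_channelMeasure]
  exact Filter.Eventually.of_forall fun y hy => hC y (Ioo_subset_Icc_self hy)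

/-- Product rule for real primitives. -/
lemma intervalIntegral_mul_primitive_real {f g : ℝ → ℝ} {a b : ℝ}
    (hf : IntervalIntegrable f volume a b) (hg : IntervalIntegrable g volume a b) (α β : ℝ) :
    (α + ∫ s in a..b, f s) * (β + ∫ s in a..b, g s) = α * β +
      ∫ t in a..b, (f t * (β + ∫ s in a..t, g s) + (α + ∫ s in a..t, f s) * g t) := by
  have ac : ∀ {f : ℝ → ℝ}, IntervalIntegrable f volume a b → ∀ α : ℝ,
      AbsolutelyContinuousOnInterval (fun t => α + ∫ s in a..t, f s) a b := by
    intro f hf α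
    refine AbsolutelyContinuousOnInterval.add (f := fun _ => α) ?_
      (hf.absolutelyContinuousOnInterval_intervalIntegral left_mem_uIcc)
    exact (LipschitzWith.const α).lipschitzOnWith.absolutelyContinuousOnInterval
  have dv : ∀ {f : ℝ → ℝ}, IntervalIntegrable f volume a b → ∀ α : ℝ,
      ∀ᵐ t, t ∈ uIoc a b → deriv (fun t => α + ∫ s in a..t, f s) t = f t := by
    intro f hf α
    filter_upwards [hf.ae_hasDerivAt_integral] with t ht hmem
    have := ht (uIoc_subset_uIcc hmem) a left_mem_uIcc
    exact (this.const_add α).deriv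
  have := (ac hf α).integral_deriv_mul_eq_sub (ac hg β)
  simp only [intervalIntegral.integral_same, add_zero] at this
  rw [← sub_eq_iff_eq_add', ← this]
  refine intervalIntegral.integral_congr_ae ?_
  filter_upwards [dv hf α, dv hg β] with t h1 h2 hmem
  rw [h1 hmem, h2 hmem]

/-- Product rule for complex primitives. -/
lemma intervalIntegral_mul_primitive {f g : ℝ → ℂ} {a b : ℝ}
    (hf : IntervalIntegrable f volume a b) (hg : IntervalIntegrable g volume a b) (α β : ℂ) :
    (α + ∫ s in a..b, f s) * (β + ∫ s in a..b, g s) = α * β +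
      ∫ t in a..b, (f t * (β + ∫ s in a..t, g s) + (α + ∫ s in a..t, f s) * g t) := by
  have re_i : ∀ {f : ℝ → ℂ}, IntervalIntegrable f volume a b →
      IntervalIntegrable (fun t => (f t).re) volume a b := fun h => ⟨h.1.re, h.2.re⟩
  have im_i : ∀ {f : ℝ → ℂ}, IntervalIntegrable f volume a b →
      IntervalIntegrable (fun t => (f t).im) volume a b := fun h => ⟨h.1.im, h.2.im⟩
  have reI : ∀ {f : ℝ → ℂ}, IntervalIntegrable f volume a b → ∀ t ∈ uIcc a b,
      (∫ s in a..t, f s).re = ∫ s in a..t, (f s).re := fun {f} h t ht => by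
    have h' := h.mono_set (uIcc_subset_uIcc_left ht)
    simpa using (Complex.reCLM.intervalIntegral_comp_comm h').symm
  have imI : ∀ {f : ℝ → ℂ}, IntervalIntegrable f volume a b → ∀ t ∈ uIcc a b,
      (∫ s in a..t, f s).im = ∫ s in a..t, (f s).im := fun {f} h t ht => by
    have h' := h.mono_set (uIcc_subset_uIcc_left ht)
    simpa using (Complex.imCLM.intervalIntegral_comp_comm h').symm
  have key : ∀ {f g : ℝ → ℂ}, IntervalIntegrable f volume a b → IntervalIntegrable g volume a b →
      ∀ β : ℂ, IntervalIntegrable (fun t => f t * (β + ∫ s in a..t, g s)) volume a b := by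
    intro f g hf hg β
    refine hf.mul_continuousOn (continuousOn_const.add ?_)
    exact intervalIntegral.continuousOn_primitive_interval' hg left_mem_uIcc
  have keyR : ∀ {f g : ℝ → ℝ}, IntervalIntegrable f volume a b → IntervalIntegrable g volume a b →
      ∀ β : ℝ, IntervalIntegrable (fun t => f t * (β + ∫ s in a..t, g s)) volume a b := by
    intro f g hf hg β
    refine hf.mul_continuousOn (continuousOn_const.add ?_)
    exact intervalIntegral.continuousOn_primitive_interval' hg left_mem_uIcc
  have hI : IntervalIntegrable (fun t => f t * (β + ∫ s in a..t, g s)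
      + (α + ∫ s in a..t, f s) * g t) volume a b := by
    refine (key hf hg β).add ?_
    simpa only [mul_comm] using key hg hf α
  have hR : ∀ {f g : ℝ → ℝ}, IntervalIntegrable f volume a b → IntervalIntegrable g volume a b →
      ∀ α β : ℝ, IntervalIntegrable (fun t => f t * (β + ∫ s in a..t, g s)
      + (α + ∫ s in a..t, f s) * g t) volume a b := by
    intro f g hf hg α β
    refine (keyR hf hg β).add ?_
    simpa only [mul_comm] using keyR hg hf α
  have rr := intervalIntegral_mul_primitive_real (re_i hf) (re_i hg) α.re β.re
  have ri := intervalIntegral_mul_primitive_real (re_i hf) (im_i hg) α.re β.im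
  have ir := intervalIntegral_mul_primitive_real (im_i hf) (re_i hg) α.im β.re
  have ii := intervalIntegral_mul_primitive_real (im_i hf) (im_i hg) α.im β.im
  have hb : b ∈ uIcc a b := right_mem_uIcc
  apply Complex.ext
  · rw [Complex.add_re, reI hI b hb]
    simp only [Complex.mul_re, Complex.add_re, Complex.add_im, reI hf b hb, reI hg b hb,
      imI hf b hb, imI hg b hb]
    rw [rr, ii]
    have : ∀ x y z w : ℝ, (x + y) - (z + w) = (x - z) + (y - w) := by intros; ring
    rw [this, ← intervalIntegral.integral_sub (hR (re_i hf) (re_i hg) _ _)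
      (hR (im_i hf) (im_i hg) _ _)]
    congr 1
    refine intervalIntegral.integral_congr fun t ht => ?_
    simp only [reI hf t ht, reI hg t ht, imI hf t ht, imI hg t ht]
    ring
  · rw [Complex.add_im, imI hI b hb]
    simp only [Complex.mul_im, Complex.add_re, Complex.add_im, reI hf b hb, reI hg b hb,
      imI hf b hb, imI hg b hb]
    rw [ri, ir]
    have : ∀ x y z w : ℝ, (x + y) + (z + w) = (x + z) + (y + w) := by intros; ring
    rw [this, ← intervalIntegral.integral_add (hR (re_i hf) (im_i hg) _ _)
      (hR (im_i hf) (re_i hg) _ _)]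
    congr 1
    refine intervalIntegral.integral_congr fun t ht => ?_
    simp only [reI hf t ht, reI hg t ht, imI hf t ht, imI hg t ht]
    ring

/-! ### The space `H¹₀(-1,1)` -/

namespace IsH10

variable {f f' g g' : ℝ → ℂ}

lemma congr_ae (h : IsH10 f f') (hf : f =ᵐ[channelMeasure] g) (hf' : f' =ᵐ[channelMeasure] g') :
    IsH10 g g' := by
  have key : ∀ y ∈ Icc (-1 : ℝ) 1, ∫ s in (-1 : ℝ)..y, f' s = ∫ s in (-1 : ℝ)..y, g' s := by
    intro y hy
    rw [intervalIntegral.integral_of_le hy.1, intervalIntegral.integral_of_le hy.1,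
      integral_Ioc_eq_integral_Ioo, integral_Ioc_eq_integral_Ioo]
    refine setIntegral_congr_ae measurableSet_Ioo ?_
    have := ae_channelMeasure.1 hf'
    filter_upwards [this] with s hs hmem
    exact hs ⟨hmem.1, hmem.2.trans_le hy.2⟩
  refine ⟨(memLp_congr_ae hf').1 h.memLp_deriv, ?_, ?_⟩
  · have h1 := ae_channelMeasure.1 h.ae_eq_primitive
    have h2 := ae_channelMeasure.1 hf
    rw [ae_channelMeasure]
    filter_upwards [h1, h2] with y h1 h2 hy
    rw [← h2 hy, h1 hy, key y (Ioo_subset_Icc_self hy)]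
  · rw [← key 1 (by simp)]; exact h.integral_deriv_eq_zero

lemma intervalIntegrable_deriv (h : IsH10 f f') : IntervalIntegrable f' volume (-1) 1 :=
  integrable_channelMeasure.1 (h.memLp_deriv.integrable (by norm_num))

lemma intervalIntegrable_deriv_left (h : IsH10 f f') {y : ℝ} (hy : y ∈ Icc (-1 : ℝ) 1) :
    IntervalIntegrable f' volume (-1) y :=
  h.intervalIntegrable_deriv.mono_set (by
    rw [uIcc_of_le hy.1, uIcc_of_le (by norm_num)]; exact Icc_subset_Icc_right hy.2)

lemma add (h : IsH10 f f') (hg : IsH10 g g') :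
    IsH10 (fun y => f y + g y) (fun y => f' y + g' y) := by
  refine ⟨h.memLp_deriv.add hg.memLp_deriv, ?_, ?_⟩
  · have h1 := ae_channelMeasure.1 h.ae_eq_primitive
    have h2 := ae_channelMeasure.1 hg.ae_eq_primitive
    rw [ae_channelMeasure]
    filter_upwards [h1, h2] with y h1 h2 hy
    have hy' := Ioo_subset_Icc_self hy
    rw [h1 hy, h2 hy, intervalIntegral.integral_add (h.intervalIntegrable_deriv_left hy')
      (hg.intervalIntegrable_deriv_left hy')]
  · rw [intervalIntegral.integral_add h.intervalIntegrable_deriv hg.intervalIntegrable_deriv,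
      h.integral_deriv_eq_zero, hg.integral_deriv_eq_zero, add_zero]

lemma const_mul (h : IsH10 f f') (c : ℂ) : IsH10 (fun y => c * f y) (fun y => c * f' y) := by
  refine ⟨h.memLp_deriv.const_mul c, ?_, ?_⟩
  · filter_upwards [h.ae_eq_primitive] with y h1
    rw [h1, intervalIntegral.integral_const_mul]
  · rw [intervalIntegral.integral_const_mul, h.integral_deriv_eq_zero, mul_zero]

lemma zero : IsH10 (fun _ => 0) (fun _ => 0) :=
  ⟨MemLp.zero' , by simp, by simp⟩

lemma memLp (h : IsH10 f f') : MemLp f 2 channelMeasure := by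
  have hc : ContinuousOn (fun y => ∫ s in (-1 : ℝ)..y, f' s) (Icc (-1) 1) := by
    have := intervalIntegral.continuousOn_primitive_interval' h.intervalIntegrable_deriv
      (left_mem_uIcc)
    rwa [uIcc_of_le (by norm_num)] at this
  obtain ⟨C, hC⟩ := isCompact_Icc.exists_bound_of_continuousOn hc
  refine (memLp_congr_ae h.ae_eq_primitive).2 (MemLp.of_bound ?_ C ?_)
  · exact (hc.mono Ioo_subset_Icc_self).aestronglyMeasurable measurableSet_Ioo
  · rw [ae_channelMeasure]
    exact Filter.Eventually.of_forall fun y hy => hC y (Ioo_subset_Icc_self hy)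

/-- Integration by parts against a smooth function. -/
lemma integral_deriv_mul (h : IsH10 f f') {b b' : ℝ → ℂ} (hb : ∀ y, HasDerivAt b (b' y) y)
    (hb' : Continuous b') :
    ∫ y, f' y * b y ∂channelMeasure = - ∫ y, f y * b' y ∂channelMeasure := by
  have hbi : ∀ x, b (-1) + ∫ s in (-1 : ℝ)..x, b' s = b x := fun x => by
    rw [intervalIntegral.integral_eq_sub_of_hasDerivAt (fun t _ => hb t)
      (hb'.intervalIntegrable _ _)]; ring
  have hbc : Continuous b := continuous_iff_continuousAt.2 fun y => (hb y).continuousAt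
  have := intervalIntegral_mul_primitive h.intervalIntegrable_deriv
    (hb'.intervalIntegrable (-1) 1) 0 (b (-1))
  simp only [hbi, h.integral_deriv_eq_zero, zero_add, zero_mul] at this
  have e : ∫ y, f y * b' y ∂channelMeasure
      = ∫ y, (∫ s in (-1 : ℝ)..y, f' s) * b' y ∂channelMeasure := by
    refine integral_congr_ae ?_
    filter_upwards [h.ae_eq_primitive] with y hy
    rw [← hy]
  rw [e, integral_channelMeasure, integral_channelMeasure]
  rw [intervalIntegral.integral_add] at this
  · linear_combination -this
  · exact h.intervalIntegrable_deriv.mul_continuousOn hbc.continuousOn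
  · refine IntervalIntegrable.mul_continuousOn ?_ hb'.continuousOn
    refine ContinuousOn.intervalIntegrable ?_
    exact intervalIntegral.continuousOn_primitive_interval' h.intervalIntegrable_deriv
      left_mem_uIcc

end IsH10

/-- Weighted Cauchy–Schwarz inequality. -/
lemma lintegral_mul_sq_le {α : Type*} [MeasurableSpace α] {ν : Measure α} {k f : α → ℝ≥0∞}
    (hk : AEMeasurable k ν) (hf : AEMeasurable f ν) :
    (∫⁻ x, k x * f x ∂ν) ^ 2 ≤ (∫⁻ x, k x ∂ν) * ∫⁻ x, k x * f x ^ 2 ∂ν := by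
  have hh : ∀ a : ℝ≥0∞, a ^ (1 / 2 : ℝ) * a ^ (1 / 2 : ℝ) = a := fun a => by
    rw [← ENNReal.rpow_add_of_nonneg _ _ (by norm_num) (by norm_num)]; norm_num
  have hs : ∀ a : ℝ≥0∞, (a ^ (1 / 2 : ℝ)) ^ 2 = a := fun a => by rw [sq, hh]
  have h := ENNReal.lintegral_mul_le_Lp_mul_Lq ν Real.HolderConjugate.two_two
    (f := fun x => k x ^ (1 / 2 : ℝ)) (g := fun x => k x ^ (1 / 2 : ℝ) * f x)
    (hk.pow_const _) ((hk.pow_const _).mul hf)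
  simp only [Pi.mul_apply, ← mul_assoc, hh, ENNReal.rpow_two, mul_pow, hs] at h
  calc _ ≤ _ := pow_le_pow_left' h 2
    _ = _ := by rw [mul_pow, hs, hs]

lemma enorm_intervalIntegral_sq_le {f : ℝ → ℂ} {a b : ℝ}
    (hf : AEStronglyMeasurable f (volume.restrict (uIoc a b))) :
    ‖∫ s in a..b, f s‖ₑ ^ 2 ≤ ENNReal.ofReal |b - a| * ∫⁻ s in uIoc a b, ‖f s‖ₑ ^ 2 := by
  have h1 : ‖∫ s in a..b, f s‖ₑ ≤ ∫⁻ s in uIoc a b, 1 * ‖f s‖ₑ := by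
    simp only [one_mul]
    have : ‖∫ s in a..b, f s‖ₑ = ‖∫ s in uIoc a b, f s‖ₑ := by
      rw [← ofReal_norm, ← ofReal_norm, intervalIntegral.norm_intervalIntegral_eq]
    rw [this]
    exact enorm_integral_le_lintegral_enorm _
  refine (pow_le_pow_left' h1 2).trans ((lintegral_mul_sq_le aemeasurable_const hf.enorm).trans ?_)
  simp [Real.volume_uIoc]

lemma lintegral_enorm_sq_eq {α : Type*} [MeasurableSpace α] {ν : Measure α} {f : α → ℂ}
    (hf : MemLp f 2 ν) : ∫⁻ x, ‖f x‖ₑ ^ 2 ∂ν = ENNReal.ofReal (∫ x, ‖f x‖ ^ 2 ∂ν) := by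
  rw [ofReal_integral_eq_lintegral_ofReal hf.norm.integrable_sq
    (Filter.Eventually.of_forall fun _ => sq_nonneg _)]
  refine lintegral_congr fun x => ?_
  rw [ENNReal.ofReal_pow (norm_nonneg _), ofReal_norm]

/-- Integrate `f'` from the nearer wall, at distance `1 - |y|`, and apply Cauchy–Schwarz. This
yields Poincaré's inequality and also controls the boundary layers, where the cutoff destroys
coercivity. -/
lemma IsH10.norm_apply_le {f f' : ℝ → ℂ} (h : IsH10 f f') :
    ∀ᵐ y ∂channelMeasure, ‖f y‖ ^ 2 ≤ (1 - |y|) * ∫ s, ‖f' s‖ ^ 2 ∂channelMeasure := by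
  have hmeas := h.memLp_deriv.1
  have hI : 0 ≤ ∫ s, ‖f' s‖ ^ 2 ∂channelMeasure := integral_nonneg fun _ => sq_nonneg _
  have bound : ∀ a b : ℝ, a ≤ b → -1 ≤ a → b ≤ 1 →
      ‖∫ s in a..b, f' s‖ ^ 2 ≤ (b - a) * ∫ s, ‖f' s‖ ^ 2 ∂channelMeasure := by
    intro a b hab ha hb
    have hsub : volume.restrict (uIoc a b) ≤ channelMeasure := by
      rw [uIoc_of_le hab, channelMeasure, restrict_Ioo_eq_restrict_Ioc]
      exact Measure.restrict_mono (Ioc_subset_Ioc ha hb) le_rfl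
    have h1 := enorm_intervalIntegral_sq_le (hmeas.mono_measure hsub)
    have h2 : ∫⁻ s in uIoc a b, ‖f' s‖ₑ ^ 2 ≤ ENNReal.ofReal (∫ s, ‖f' s‖ ^ 2 ∂channelMeasure) := by
      rw [← lintegral_enorm_sq_eq h.memLp_deriv]
      exact lintegral_mono' hsub le_rfl
    have h3 := h1.trans (mul_le_mul_right h2 _)
    rw [abs_of_nonneg (sub_nonneg.2 hab), ← ENNReal.ofReal_mul (sub_nonneg.2 hab), ← ofReal_norm,
      ← ENNReal.ofReal_pow (norm_nonneg _)] at h3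
    exact (ENNReal.ofReal_le_ofReal_iff (mul_nonneg (sub_nonneg.2 hab) hI)).1 h3
  have hp := ae_channelMeasure.1 h.ae_eq_primitive
  rw [ae_channelMeasure]
  filter_upwards [hp] with y hp hy
  rw [hp hy]
  rcases le_total 0 y with h0 | h0
  · rw [abs_of_nonneg h0]
    -- The vanishing total integral of `f'` allows integration from the wall `y = 1` instead.
    have e : ∫ s in (-1 : ℝ)..y, f' s = - ∫ s in y..1, f' s := by
      have := intervalIntegral.integral_add_adjacent_intervals
        (h.intervalIntegrable_deriv_left (Ioo_subset_Icc_self hy))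
        ((h.intervalIntegrable_deriv_left (Ioo_subset_Icc_self hy)).symm.trans
          h.intervalIntegrable_deriv)
      rw [h.integral_deriv_eq_zero] at this
      exact eq_neg_of_add_eq_zero_left this
    rw [e, norm_neg]
    exact bound y 1 hy.2.le hy.1.le le_rfl
  · rw [abs_of_nonpos h0]
    have := bound (-1) y hy.1.le le_rfl hy.2.le
    convert this using 2; ring

/-! ### Finite mode projections and completeness of the cosines -/

section ModeProjection

variable {E : Type*} [NormedAddCommGroup E] [InnerProductSpace ℂ E]

/-- The orthogonal projection onto the first `N` vectors of an orthonormal sequence. -/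
def modeProj (e : ℕ → E) (N : ℕ) : E →L[ℂ] E :=
  ∑ n ∈ Finset.range N, (innerSL ℂ (e n)).smulRight (e n)

lemma modeProj_apply (e : ℕ → E) (N : ℕ) (f : E) :
    modeProj e N f = ∑ n ∈ Finset.range N, inner ℂ (e n) f • e n := by
  simp [modeProj]

/-- Bessel's inequality. Uniformity in `N` serves both the domination and the convergence of
twice-projected test functions. -/
lemma norm_modeProj_le {e : ℕ → E} (he : Orthonormal ℂ e) (N : ℕ) (f : E) :
    ‖modeProj e N f‖ ≤ ‖f‖ := by
  have h1 : ‖modeProj e N f‖ ^ 2 = ∑ n ∈ Finset.range N, ‖inner ℂ (e n) f‖ ^ 2 := by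
    have h2 := he.inner_sum (fun n => inner ℂ (e n) f) (fun n => inner ℂ (e n) f) (Finset.range N)
    have h3 := inner_self_eq_norm_sq_to_K (𝕜 := ℂ) (modeProj e N f)
    rw [modeProj_apply, h2] at h3
    have h4 : ∀ z : ℂ, (starRingEnd ℂ) z * z = ((‖z‖ ^ 2 : ℝ) : ℂ) := fun z => by
      rw [mul_comm, Complex.mul_conj, Complex.normSq_eq_norm_sq]
    simp_rw [h4] at h3
    rw [modeProj_apply]
    have := congrArg Complex.re h3
    simpa [← Complex.ofReal_pow] using this.symm
  have h2 := he.sum_inner_products_le f (s := Finset.range N)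
  exact le_of_sq_le_sq (h1.le.trans h2) (norm_nonneg _)

end ModeProjection

/-- All orthogonality relations reduce to this by product-to-sum formulas. The interval has length
`2`, so sines and nonconstant cosines have norm exactly one. -/
lemma integral_cos_int_mul (n : ℤ) :
    ∫ y in (-1 : ℝ)..1, Real.cos (n * (Real.pi / 2 * (y + 1))) = if n = 0 then 2 else 0 := by
  split_ifs with h
  · subst h; norm_num
  · have hn : (n : ℝ) * (Real.pi / 2) ≠ 0 :=
      mul_ne_zero (Int.cast_ne_zero.2 h) (by positivity)
    have hd : ∀ y ∈ uIcc (-1 : ℝ) 1,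
        HasDerivAt (fun y => Real.sin (n * (Real.pi / 2 * (y + 1))) / (n * (Real.pi / 2)))
          (Real.cos (n * (Real.pi / 2 * (y + 1)))) y := by
      intro y _
      have h1 : HasDerivAt (fun y : ℝ => (n : ℝ) * (Real.pi / 2 * (y + 1)))
          (n * (Real.pi / 2 * 1)) y :=
        (((hasDerivAt_id y).add_const 1).const_mul _).const_mul _
      refine (h1.sin.div_const ((n : ℝ) * (Real.pi / 2))).congr_deriv ?_
      rw [mul_one, mul_div_assoc, div_self hn, mul_one]
    rw [intervalIntegral.integral_eq_sub_of_hasDerivAt hd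
      ((by fun_prop : Continuous _).intervalIntegrable _ _)]
    have : (n : ℝ) * (Real.pi / 2 * (1 + 1)) = n * Real.pi := by ring
    rw [this, Real.sin_int_mul_pi]; simp

/-- With `x = π(y + 1)/2 ∈ [0, π]`, orthogonality to all `cos(nx)` gives orthogonality to every
polynomial in `cos x`. Since `cos` is injective on `[0, π]`, Weierstrass approximation in the
variable `cos x` reaches every continuous function of `y`. -/
lemma ae_eq_zero_of_integral_mul_cos {g : ℝ → ℂ} (hg : Integrable g channelMeasure)
    (h : ∀ n : ℕ, ∫ y, g y * (Real.cos (n * (Real.pi / 2 * (y + 1))) : ℂ) ∂channelMeasure = 0) :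
    g =ᵐ[channelMeasure] 0 := by
  set x : ℝ → ℝ := fun y => Real.pi / 2 * (y + 1) with hx
  have hxc : Continuous x := by fun_prop
  have hint : ∀ φ : ℝ → ℝ, Continuous φ → (∃ C, ∀ y ∈ Ioo (-1 : ℝ) 1, |φ y| ≤ C) →
      Integrable (fun y => g y * (φ y : ℂ)) channelMeasure := by
    rintro φ hφ ⟨C, hC⟩
    refine hg.mul_bdd (c := C) (by fun_prop) ?_
    rw [ae_channelMeasure]
    exact Filter.Eventually.of_forall fun y hy => by simpa using hC y hy
  have hZ : ∀ n : ℤ, ∫ y, g y * (Real.cos (n * x y) : ℂ) ∂channelMeasure = 0 := by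
    intro n
    rcases Int.natAbs_eq n with hn | hn
    · rw [hn]; simpa [hx] using h n.natAbs
    · rw [hn]; simpa [hx] using h n.natAbs
  -- Each factor `cos x` shifts the frequency by `±1`, so the induction must carry all integer
  -- frequencies.
  have hpow : ∀ j : ℕ, ∀ n : ℤ,
      ∫ y, g y * ((Real.cos (x y) ^ j * Real.cos (n * x y) : ℝ) : ℂ) ∂channelMeasure = 0 := by
    intro j
    induction j with
    | zero => intro n; simpa using hZ n
    | succ j ih =>
      intro n
      have e : ∀ y, g y * ((Real.cos (x y) ^ (j + 1) * Real.cos (n * x y) : ℝ) : ℂ)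
          = (1 / 2 : ℂ) * (g y * ((Real.cos (x y) ^ j * Real.cos ((n + 1 : ℤ) * x y) : ℝ) : ℂ)
            + g y * ((Real.cos (x y) ^ j * Real.cos ((n - 1 : ℤ) * x y) : ℝ) : ℂ)) := by
        intro y
        have : Real.cos (x y) ^ (j + 1) * Real.cos (n * x y) = 1 / 2 *
            (Real.cos (x y) ^ j * Real.cos ((n + 1 : ℤ) * x y)
              + Real.cos (x y) ^ j * Real.cos ((n - 1 : ℤ) * x y)) := by
          push_cast
          rw [add_mul, sub_mul, one_mul, Real.cos_add, Real.cos_sub]; ring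
        rw [this]; push_cast; ring
      simp_rw [e]
      have hb : ∀ m : ℤ, ∃ C, ∀ y ∈ Ioo (-1 : ℝ) 1,
          |Real.cos (x y) ^ j * Real.cos (m * x y)| ≤ C := fun m => ⟨1, fun y _ => by
        rw [abs_mul, abs_pow]
        exact mul_le_one₀ (pow_le_one₀ (abs_nonneg _) (Real.abs_cos_le_one _)) (abs_nonneg _)
          (Real.abs_cos_le_one _)⟩
      rw [integral_const_mul, integral_add, ih, ih]
      · simp
      · exact hint _ (by fun_prop) (hb _)
      · exact hint _ (by fun_prop) (hb _)
  have hpoly : ∀ p : Polynomial ℝ,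
      ∫ y, g y * ((p.eval (Real.cos (x y)) : ℝ) : ℂ) ∂channelMeasure = 0 := by
    intro p
    have hb : ∀ q : Polynomial ℝ, ∃ C, ∀ y ∈ Ioo (-1 : ℝ) 1, |q.eval (Real.cos (x y))| ≤ C := by
      intro q
      have hc : Continuous fun y => q.eval (Real.cos (x y)) :=
        q.continuous.comp (by fun_prop)
      obtain ⟨C, hC⟩ := isCompact_Icc.exists_bound_of_continuousOn
        (hc.continuousOn (s := Icc (-1 : ℝ) 1))
      exact ⟨C, fun y hy => hC y (Ioo_subset_Icc_self hy)⟩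
    induction p using Polynomial.induction_on' with
    | add p q hp hq =>
      simp only [Polynomial.eval_add, Complex.ofReal_add, mul_add]
      rw [integral_add, hp, hq, add_zero]
      · exact hint _ (p.continuous.comp (by fun_prop)) (hb p)
      · exact hint _ (q.continuous.comp (by fun_prop)) (hb q)
    | monomial n a =>
      have := hpow n 0
      simp only [Int.cast_zero, zero_mul, Real.cos_zero, mul_one] at this
      have e : ∀ y, g y * (((Polynomial.monomial n a).eval (Real.cos (x y)) : ℝ) : ℂ)
          = a * (g y * ((Real.cos (x y) ^ n : ℝ) : ℂ)) := by
        intro y; rw [Polynomial.eval_monomial]; push_cast; ring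
      simp_rw [e]
      rw [integral_const_mul, this, mul_zero]
  have hcont : ∀ φ : ℝ → ℝ, Continuous φ → ∫ y, g y * (φ y : ℂ) ∂channelMeasure = 0 := by
    intro φ hφ
    have hbφ : ∃ C, ∀ y ∈ Ioo (-1 : ℝ) 1, |φ y| ≤ C := by
      obtain ⟨C, hC⟩ := isCompact_Icc.exists_bound_of_continuousOn
        (hφ.continuousOn (s := Icc (-1 : ℝ) 1))
      exact ⟨C, fun y hy => hC y (Ioo_subset_Icc_self hy)⟩
    set I := ∫ y, ‖g y‖ ∂channelMeasure with hI
    have hI0 : 0 ≤ I := integral_nonneg fun _ => norm_nonneg _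
    have key : ∀ ε > 0, ‖∫ y, g y * (φ y : ℂ) ∂channelMeasure‖ ≤ ε * I := by
      intro ε hε
      -- The approximated function is `φ` in the variable `c = cos x`, where `y = arccos c / (π/2) -
      -- 1`.
      obtain ⟨p, hp⟩ := exists_polynomial_near_of_continuousOn (-1) 1
        (fun c => φ (Real.arccos c / (Real.pi / 2) - 1)) (by fun_prop) ε hε
      have : ∫ y, g y * (φ y : ℂ) ∂channelMeasure = ∫ y, g y *
          ((φ y - p.eval (Real.cos (x y)) : ℝ) : ℂ) ∂channelMeasure := by
        push_cast
        simp_rw [mul_sub]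
        rw [integral_sub (hint _ hφ hbφ), hpoly p, sub_zero]
        refine hint _ (p.continuous.comp (by fun_prop)) ?_
        have hc : Continuous fun y => p.eval (Real.cos (x y)) :=
          p.continuous.comp (by fun_prop)
        obtain ⟨C, hC⟩ := isCompact_Icc.exists_bound_of_continuousOn
          (hc.continuousOn (s := Icc (-1 : ℝ) 1))
        exact ⟨C, fun y hy => hC y (Ioo_subset_Icc_self hy)⟩
      rw [this, hI, ← integral_const_mul]
      refine norm_integral_le_of_norm_le (hg.norm.const_mul _) ?_
      rw [ae_channelMeasure]
      refine Filter.Eventually.of_forall fun y hy => ?_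
      rw [norm_mul, Complex.norm_real, mul_comm]
      refine mul_le_mul_of_nonneg_right ?_ (norm_nonneg _)
      have h1 := hp (Real.cos (x y)) ⟨Real.neg_one_le_cos _, Real.cos_le_one _⟩
      have hpi := Real.pi_pos
      rw [Real.arccos_cos] at h1
      · have h2 : x y / (Real.pi / 2) - 1 = y := by simp only [hx]; field_simp; ring
        rw [h2, abs_sub_comm] at h1
        exact h1.le
      · simp only [hx]; have := hy.1; exact mul_nonneg (by positivity) (by linarith)
      · simp only [hx]; nlinarith [hy.2]
    refine norm_le_zero_iff.1 (le_of_forall_pos_le_add fun ε hε => ?_)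
    refine (key (ε / (I + 1)) (by positivity)).trans ?_
    rw [zero_add, div_mul_eq_mul_div, div_le_iff₀ (by positivity)]
    nlinarith
  have hloc : LocallyIntegrableOn g (Ioo (-1 : ℝ) 1) volume :=
    IntegrableOn.locallyIntegrableOn hg
  rw [Filter.EventuallyEq, ae_channelMeasure]
  refine isOpen_Ioo.ae_eq_zero_of_integral_contDiff_smul_eq_zero hloc fun φ hφ _ hs => ?_
  have := hcont φ hφ.continuous
  rw [channelMeasure, setIntegral_eq_integral_of_forall_compl_eq_zero] at this
  · rw [← this]; exact integral_congr_ae (Filter.Eventually.of_forall fun y => by simp [mul_comm])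
  · intro y hy
    rw [image_eq_zero_of_notMem_tsupport (fun hh => hy (hs hh))]; simp

/-! ### Sine and cosine modes -/

/-- The Dirichlet eigenfunctions of `-∂_y²` on `(-1,1)`. -/
def sinMode (n : ℕ) (y : ℝ) : ℂ := (Real.sin (((n + 1 : ℕ) : ℝ) * (Real.pi / 2 * (y + 1))) : ℂ)

/-- The nonconstant Neumann eigenfunctions of `-∂_y²` on `(-1,1)`. -/
def cosMode (n : ℕ) (y : ℝ) : ℂ := (Real.cos (((n + 1 : ℕ) : ℝ) * (Real.pi / 2 * (y + 1))) : ℂ)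

/-- The frequency of `sinMode n`. -/
def modeFreq (n : ℕ) : ℝ := ((n + 1 : ℕ) : ℝ) * (Real.pi / 2)

lemma continuous_sinMode (n : ℕ) : Continuous (sinMode n) := by unfold sinMode; fun_prop

lemma continuous_cosMode (n : ℕ) : Continuous (cosMode n) := by unfold cosMode; fun_prop

lemma hasDerivAt_sinMode (n : ℕ) (y : ℝ) :
    HasDerivAt (sinMode n) ((modeFreq n : ℂ) * cosMode n y) y := by
  have h1 : HasDerivAt (fun y : ℝ => ((n + 1 : ℕ) : ℝ) * (Real.pi / 2 * (y + 1)))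
      (((n + 1 : ℕ) : ℝ) * (Real.pi / 2 * 1)) y :=
    (((hasDerivAt_id y).add_const 1).const_mul _).const_mul _
  refine h1.sin.ofReal_comp.congr_deriv ?_
  unfold cosMode modeFreq; push_cast; ring

lemma hasDerivAt_cosMode (n : ℕ) (y : ℝ) :
    HasDerivAt (cosMode n) (-(modeFreq n : ℂ) * sinMode n y) y := by
  have h1 : HasDerivAt (fun y : ℝ => ((n + 1 : ℕ) : ℝ) * (Real.pi / 2 * (y + 1)))
      (((n + 1 : ℕ) : ℝ) * (Real.pi / 2 * 1)) y :=
    (((hasDerivAt_id y).add_const 1).const_mul _).const_mul _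
  refine h1.cos.ofReal_comp.congr_deriv ?_
  unfold sinMode modeFreq; push_cast; ring

lemma isH10_sinMode (n : ℕ) : IsH10 (sinMode n) (fun y => (modeFreq n : ℂ) * cosMode n y) := by
  have hc : Continuous fun y => (modeFreq n : ℂ) * cosMode n y :=
    continuous_const.mul (continuous_cosMode n)
  have h0 : sinMode n (-1) = 0 := by simp [sinMode]
  have h1 : sinMode n 1 = 0 := by
    have e : ((n + 1 : ℕ) : ℝ) * (Real.pi / 2 * (1 + 1)) = (n + 1 : ℕ) * Real.pi := by ring
    rw [sinMode, e, Real.sin_nat_mul_pi, Complex.ofReal_zero]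
  have hi : ∀ y, ∫ s in (-1 : ℝ)..y, (modeFreq n : ℂ) * cosMode n s = sinMode n y := fun y => by
    rw [intervalIntegral.integral_eq_sub_of_hasDerivAt (fun t _ => hasDerivAt_sinMode n t)
      (hc.intervalIntegrable _ _), h0, sub_zero]
  exact ⟨memLp_two_of_bounded hc, Filter.Eventually.of_forall fun y => (hi y).symm, by rw [hi, h1]⟩

lemma memLp_sinMode (n : ℕ) : MemLp (sinMode n) 2 channelMeasure :=
  memLp_two_of_bounded (continuous_sinMode n)

lemma memLp_cosMode (n : ℕ) : MemLp (cosMode n) 2 channelMeasure :=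
  memLp_two_of_bounded (continuous_cosMode n)

/-- `sinMode n` as an element of `L²(-1,1)`. -/
def sinL2 (n : ℕ) : ChannelL2 := (memLp_sinMode n).toLp _

/-- `cosMode n` as an element of `L²(-1,1)`. -/
def cosL2 (n : ℕ) : ChannelL2 := (memLp_cosMode n).toLp _

/-- The normalized cosine basis of `L²(-1,1)`, including the constant mode. -/
def cosBasisL2 : ℕ → ChannelL2
  | 0 => (memLp_two_of_bounded (f := fun _ => ((Real.sqrt 2)⁻¹ : ℝ)) continuous_const).toLp _
  | n + 1 => cosL2 n

@[simp] lemma conj_sinMode (n : ℕ) (y : ℝ) : (starRingEnd ℂ) (sinMode n y) = sinMode n y :=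
  Complex.conj_ofReal _

@[simp] lemma conj_cosMode (n : ℕ) (y : ℝ) : (starRingEnd ℂ) (cosMode n y) = cosMode n y :=
  Complex.conj_ofReal _

lemma integral_cos_mul_cos (m n : ℤ) :
    ∫ y in (-1 : ℝ)..1, Real.cos (m * (Real.pi / 2 * (y + 1))) *
      Real.cos (n * (Real.pi / 2 * (y + 1)))
      = 1 / 2 * ((if m - n = 0 then 2 else 0) + if m + n = 0 then 2 else 0) := by
  have e : ∀ y : ℝ, Real.cos (m * (Real.pi / 2 * (y + 1))) * Real.cos (n * (Real.pi / 2 * (y + 1)))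
      = 1 / 2 * (Real.cos ((m - n : ℤ) * (Real.pi / 2 * (y + 1)))
        + Real.cos ((m + n : ℤ) * (Real.pi / 2 * (y + 1)))) := fun y => by
    push_cast; rw [sub_mul, add_mul, Real.cos_sub, Real.cos_add]; ring
  simp_rw [e]
  rw [intervalIntegral.integral_const_mul, intervalIntegral.integral_add
    (Continuous.intervalIntegrable (by fun_prop) _ _)
    (Continuous.intervalIntegrable (by fun_prop) _ _), integral_cos_int_mul, integral_cos_int_mul]

lemma integral_sin_mul_sin (m n : ℤ) :
    ∫ y in (-1 : ℝ)..1, Real.sin (m * (Real.pi / 2 * (y + 1))) *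
      Real.sin (n * (Real.pi / 2 * (y + 1)))
      = 1 / 2 * ((if m - n = 0 then 2 else 0) - if m + n = 0 then 2 else 0) := by
  have e : ∀ y : ℝ, Real.sin (m * (Real.pi / 2 * (y + 1))) * Real.sin (n * (Real.pi / 2 * (y + 1)))
      = 1 / 2 * (Real.cos ((m - n : ℤ) * (Real.pi / 2 * (y + 1)))
        - Real.cos ((m + n : ℤ) * (Real.pi / 2 * (y + 1)))) := fun y => by
    push_cast; rw [sub_mul, add_mul, Real.cos_sub, Real.cos_add]; ring
  simp_rw [e]
  rw [intervalIntegral.integral_const_mul, intervalIntegral.integral_sub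
    (Continuous.intervalIntegrable (by fun_prop) _ _)
    (Continuous.intervalIntegrable (by fun_prop) _ _), integral_cos_int_mul, integral_cos_int_mul]

lemma inner_sinL2 (m n : ℕ) : inner ℂ (sinL2 m) (sinL2 n) = if m = n then 1 else 0 := by
  have h := integral_sin_mul_sin ((m + 1 : ℕ) : ℤ) ((n + 1 : ℕ) : ℤ)
  rw [sinL2, sinL2, ChannelL2.inner_toLp, integral_channelMeasure]
  simp only [conj_sinMode]
  simp only [sinMode, ← Complex.ofReal_mul]
  rw [intervalIntegral.integral_ofReal]
  simp only [Int.cast_natCast] at h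
  rw [h]
  have h1 : ((m + 1 : ℕ) : ℤ) + ((n + 1 : ℕ) : ℤ) ≠ 0 := by omega
  have h2 : ((m + 1 : ℕ) : ℤ) - ((n + 1 : ℕ) : ℤ) = 0 ↔ m = n := by omega
  simp only [h1, h2, if_false]
  split_ifs <;> norm_num

lemma inner_cosL2 (m n : ℕ) : inner ℂ (cosL2 m) (cosL2 n) = if m = n then 1 else 0 := by
  have h := integral_cos_mul_cos ((m + 1 : ℕ) : ℤ) ((n + 1 : ℕ) : ℤ)
  rw [cosL2, cosL2, ChannelL2.inner_toLp, integral_channelMeasure]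
  simp only [conj_cosMode]
  simp only [cosMode, ← Complex.ofReal_mul]
  rw [intervalIntegral.integral_ofReal]
  simp only [Int.cast_natCast] at h
  rw [h]
  have h1 : ((m + 1 : ℕ) : ℤ) + ((n + 1 : ℕ) : ℤ) ≠ 0 := by omega
  have h2 : ((m + 1 : ℕ) : ℤ) - ((n + 1 : ℕ) : ℤ) = 0 ↔ m = n := by omega
  simp only [h1, h2, if_false]
  split_ifs <;> norm_num

lemma inner_const_cosL2 (n : ℕ) : inner ℂ (cosBasisL2 0) (cosL2 n) = 0 := by
  have h := integral_cos_int_mul ((n + 1 : ℕ) : ℤ)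
  rw [if_neg (by omega)] at h
  simp only [Int.cast_natCast] at h
  rw [cosBasisL2, cosL2, ChannelL2.inner_toLp, integral_channelMeasure]
  simp only [Complex.conj_ofReal, cosMode, ← Complex.ofReal_mul]
  rw [intervalIntegral.integral_ofReal, intervalIntegral.integral_const_mul, h]
  simp

lemma inner_const_const : inner ℂ (cosBasisL2 0) (cosBasisL2 0) = 1 := by
  rw [cosBasisL2, ChannelL2.inner_toLp, integral_channelMeasure]
  simp only [Complex.conj_ofReal, ← Complex.ofReal_mul]
  have : (Real.sqrt 2)⁻¹ * (Real.sqrt 2)⁻¹ = 1 / 2 := by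
    rw [← mul_inv, Real.mul_self_sqrt (by norm_num)]; norm_num
  rw [this, intervalIntegral.integral_ofReal]; norm_num

lemma orthonormal_sinL2 : Orthonormal ℂ sinL2 :=
  orthonormal_iff_ite.2 inner_sinL2

lemma orthonormal_cosL2 : Orthonormal ℂ cosL2 :=
  orthonormal_iff_ite.2 inner_cosL2

lemma orthonormal_cosBasisL2 : Orthonormal ℂ cosBasisL2 := by
  rw [orthonormal_iff_ite]
  rintro (_ | m) (_ | n)
  · simpa using inner_const_const
  · simpa using! inner_const_cosL2 n
  · rw [← inner_conj_symm]; simpa using! congrArg (starRingEnd ℂ) (inner_const_cosL2 m)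
  · simpa using! inner_cosL2 m n

lemma orthogonal_span_cosBasisL2 : (Submodule.span ℂ (range cosBasisL2))ᗮ = ⊥ := by
  rw [Submodule.eq_bot_iff]
  intro g hg
  have h0 : ∀ n, inner ℂ (cosBasisL2 n) g = 0 := fun n =>
    (Submodule.mem_orthogonal _ _).1 hg _ (Submodule.subset_span ⟨n, rfl⟩)
  have hgm : MemLp g 2 channelMeasure := Lp.memLp g
  have : (g : ℝ → ℂ) =ᵐ[channelMeasure] 0 := by
    refine ae_eq_zero_of_integral_mul_cos (hgm.integrable (by norm_num)) ?_
    have hg' : g = hgm.toLp _ := (Lp.toLp_coeFn g hgm).symm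
    rintro (_ | n)
    · have := h0 0
      rw [hg', cosBasisL2, ChannelL2.inner_toLp, integral_const_mul] at this
      simpa using this
    · have := h0 (n + 1)
      rw [hg', cosBasisL2, cosL2, ChannelL2.inner_toLp] at this
      simp only [conj_cosMode] at this
      rw [← this]
      refine integral_congr_ae (Filter.Eventually.of_forall fun y => ?_)
      simp only [cosMode]; exact mul_comm _ _
  exact (Lp.eq_zero_iff_ae_eq_zero).2 this

/-- Coefficients: `⟨cos_n, f'⟩ = λ_n ⟨sin_n, f⟩`. -/
lemma IsH10.inner_cosL2 {f f' : ChannelL2} (h : IsH10 f f') (n : ℕ) :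
    inner ℂ (cosL2 n) f' = (modeFreq n : ℂ) * inner ℂ (sinL2 n) f := by
  have hf' : f' = (Lp.memLp f').toLp _ := (Lp.toLp_coeFn f' _).symm
  have hf : f = (Lp.memLp f).toLp _ := (Lp.toLp_coeFn f _).symm
  have := h.integral_deriv_mul (hasDerivAt_cosMode n)
    (continuous_const.mul (continuous_sinMode n))
  rw [hf', hf, cosL2, sinL2, ChannelL2.inner_toLp, ChannelL2.inner_toLp]
  simp only [conj_cosMode, conj_sinMode]
  simp_rw [mul_comm (cosMode n _)]
  rw [this, ← integral_neg, ← integral_const_mul]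
  refine integral_congr_ae (Filter.Eventually.of_forall fun y => ?_)
  simp only; ring

lemma isH10_sinL2 (n : ℕ) : IsH10 (sinL2 n) ((modeFreq n : ℂ) • cosL2 n : ChannelL2) := by
  refine (isH10_sinMode n).congr_ae (MemLp.coeFn_toLp _).symm ?_
  filter_upwards [Lp.coeFn_smul (modeFreq n : ℂ) (cosL2 n), (memLp_cosMode n).coeFn_toLp]
    with y h1 h2
  rw [h1, Pi.smul_apply, smul_eq_mul, cosL2, h2]

lemma IsH10.add_L2 {f f' g g' : ChannelL2} (h : IsH10 f f') (hg : IsH10 g g') :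
    IsH10 (f + g : ChannelL2) (f' + g' : ChannelL2) :=
  (h.add hg).congr_ae (Lp.coeFn_add f g).symm (Lp.coeFn_add f' g').symm

lemma IsH10.smul_L2 {f f' : ChannelL2} (h : IsH10 f f') (c : ℂ) :
    IsH10 (c • f : ChannelL2) (c • f' : ChannelL2) :=
  (h.const_mul c).congr_ae (Lp.coeFn_smul c f).symm (Lp.coeFn_smul c f').symm

lemma IsH10.zero_L2 : IsH10 (0 : ChannelL2) (0 : ChannelL2) :=
  IsH10.zero.congr_ae (Lp.coeFn_zero ..).symm (Lp.coeFn_zero ..).symm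

lemma IsH10.sum_L2 {f f' : ℕ → ChannelL2} (h : ∀ n, IsH10 (f n) (f' n)) (N : ℕ) :
    IsH10 (∑ n ∈ Finset.range N, f n : ChannelL2) (∑ n ∈ Finset.range N, f' n : ChannelL2) := by
  induction N with
  | zero => simpa using IsH10.zero_L2
  | succ N ih => rw [Finset.sum_range_succ, Finset.sum_range_succ]; exact ih.add_L2 (h N)

/-- The sine projection of an `H¹₀` function has derivative the cosine projection. -/
lemma IsH10.modeProj {f f' : ChannelL2} (h : IsH10 f f') (N : ℕ) :
    IsH10 (modeProj sinL2 N f) (modeProj cosL2 N f') := by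
  rw [modeProj_apply, modeProj_apply]
  refine IsH10.sum_L2 (f := fun n => inner ℂ (sinL2 n) f • sinL2 n)
    (f' := fun n => inner ℂ (cosL2 n) f' • cosL2 n) (fun n => ?_) N
  rw [h.inner_cosL2, mul_comm, mul_smul]
  exact (isH10_sinL2 n).smul_L2 _

/-- Poincaré's inequality: `1 - |y| ≤ 1` on an interval of length `2` gives the constant `√2`,
rounded up to `2`. -/
lemma IsH10.norm_le {f f' : ChannelL2} (h : IsH10 f f') : ‖f‖ ≤ 2 * ‖f'‖ := by
  have h1 : ‖f‖ ^ 2 ≤ 2 * ‖f'‖ ^ 2 := by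
    rw [ChannelL2.norm_sq_eq f]
    have : ∫ y, ‖f y‖ ^ 2 ∂channelMeasure ≤ ∫ y : ℝ, ‖f'‖ ^ 2 ∂channelMeasure := by
      refine integral_mono_ae ((Lp.memLp f).norm.integrable_sq) (integrable_const _) ?_
      have h2 := h.norm_apply_le
      rw [← ChannelL2.norm_sq_eq] at h2
      filter_upwards [h2] with y hy
      exact hy.trans (by nlinarith [abs_nonneg y, sq_nonneg ‖f'‖])
    refine this.trans (le_of_eq ?_)
    rw [integral_channelMeasure, intervalIntegral.integral_const]; norm_num
  nlinarith [norm_nonneg f, norm_nonneg f']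

/-- The nonconstant cosines miss only the constants, and `f'` has mean zero because `f` vanishes at
both walls. -/
lemma IsH10.tendsto_modeProj_deriv {f f' : ChannelL2} (h : IsH10 f f') :
    Filter.Tendsto (fun N => _root_.modeProj cosL2 N f') Filter.atTop (nhds f') := by
  set b := HilbertBasis.mkOfOrthogonalEqBot orthonormal_cosBasisL2 orthogonal_span_cosBasisL2
  have hb : ∀ n, b n = cosBasisL2 n := fun n =>
    congrFun (HilbertBasis.coe_mkOfOrthogonalEqBot _ _) n
  -- The shift by one accounts for the constant mode, which occupies index `0` of the basis.
  have h1 := ((b.hasSum_repr f').tendsto_sum_nat.comp (Filter.tendsto_add_atTop_nat 1))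
  have h0 : inner ℂ (cosBasisL2 0) f' = 0 := by
    have hf' : f' = (Lp.memLp f').toLp _ := (Lp.toLp_coeFn f' _).symm
    rw [hf', cosBasisL2, ChannelL2.inner_toLp, integral_const_mul, integral_channelMeasure,
      h.integral_deriv_eq_zero, mul_zero]
  refine h1.congr fun N => ?_
  simp only [Function.comp, Finset.sum_range_succ', b.repr_apply_apply, hb, h0, zero_smul, add_zero]
  rw [modeProj_apply]; rfl

/-- Poincaré applied to the error, whose derivative is the error of the cosine expansion of `f'`.
Completeness of the sines in all of `L²` is thereby not needed. -/
lemma IsH10.tendsto_modeProj {f f' : ChannelL2} (h : IsH10 f f') :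
    Filter.Tendsto (fun N => _root_.modeProj sinL2 N f) Filter.atTop (nhds f) := by
  rw [tendsto_iff_norm_sub_tendsto_zero]
  have h1 := (tendsto_iff_norm_sub_tendsto_zero.1 h.tendsto_modeProj_deriv).const_mul 2
  rw [mul_zero] at h1
  refine squeeze_zero (fun _ => norm_nonneg _) (fun N => ?_) h1
  have := ((h.modeProj N).add_L2 (h.smul_L2 (-1))).norm_le
  simpa [← sub_eq_add_neg] using this

/-! ### Integral operators dominated by a Cauchy kernel -/

lemma eLpNorm_two_sq_eq_lintegral {α ε : Type*} [MeasurableSpace α] [TopologicalSpace ε]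
    [ContinuousENorm ε] (f : α → ε) (ν : Measure α) :
    eLpNorm f 2 ν ^ 2 = ∫⁻ x, ‖f x‖ₑ ^ 2 ∂ν := by
  have := eLpNorm_nnreal_pow_eq_lintegral (f := f) (μ := ν) (p := 2) (by norm_num)
  simpa [ENNReal.rpow_two] using this

/-- The Cauchy kernel at scale `δ`. -/
def cauchyKernel (δ z : ℝ) : ℝ := δ⁻¹ * (1 + (z / δ) ^ 2)⁻¹

lemma cauchyKernel_nonneg {δ : ℝ} (hδ : 0 < δ) (z : ℝ) : 0 ≤ cauchyKernel δ z := by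
  unfold cauchyKernel; positivity

lemma continuous_cauchyKernel (δ : ℝ) : Continuous (cauchyKernel δ) := by
  unfold cauchyKernel
  refine continuous_const.mul (Continuous.inv₀ (by fun_prop) fun z => ?_)
  positivity

lemma lintegral_cauchyKernel {δ : ℝ} (hδ : 0 < δ) :
    ∫⁻ z, ENNReal.ofReal (cauchyKernel δ z) = ENNReal.ofReal Real.pi := by
  have hi : Integrable (cauchyKernel δ) := by
    unfold cauchyKernel
    exact (integrable_inv_one_add_sq.comp_div hδ.ne').const_mul _
  rw [← ofReal_integral_eq_lintegral_ofReal hi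
    (Filter.Eventually.of_forall (cauchyKernel_nonneg hδ))]
  congr 1
  unfold cauchyKernel
  rw [integral_const_mul, Measure.integral_comp_div (fun x => (1 + x ^ 2)⁻¹) δ,
    integral_univ_inv_one_add_sq, abs_of_pos hδ, smul_eq_mul, inv_mul_cancel_left₀ hδ.ne']

lemma lintegral_cauchyKernel_sub_left {δ : ℝ} (hδ : 0 < δ) (y : ℝ) :
    ∫⁻ z, ENNReal.ofReal (cauchyKernel δ (y - z)) ∂channelMeasure ≤ ENNReal.ofReal Real.pi := by
  rw [← lintegral_cauchyKernel hδ,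
    ← lintegral_sub_left_eq_self (fun z => ENNReal.ofReal (cauchyKernel δ z)) y]
  exact lintegral_mono' Measure.restrict_le_self le_rfl

lemma lintegral_cauchyKernel_sub_right {δ : ℝ} (hδ : 0 < δ) (y : ℝ) :
    ∫⁻ z, ENNReal.ofReal (cauchyKernel δ (z - y)) ∂channelMeasure ≤ ENNReal.ofReal Real.pi := by
  rw [← lintegral_cauchyKernel hδ,
    ← lintegral_sub_right_eq_self (fun z => ENNReal.ofReal (cauchyKernel δ z)) y]
  exact lintegral_mono' Measure.restrict_le_self le_rfl

/-- Schur's test for kernels dominated by a Cauchy kernel. -/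
lemma lintegral_kernel_sq_le {K : ℝ → ℝ → ℂ} {M δ : ℝ} (hδ : 0 < δ) (hM : 0 ≤ M)
    (hb : ∀ y ∈ Ioo (-1 : ℝ) 1, ∀ z ∈ Ioo (-1 : ℝ) 1, ‖K y z‖ ≤ M * cauchyKernel δ (y - z))
    {f : ℝ → ℂ} (hf : MemLp f 2 channelMeasure) :
    ∫⁻ y, ‖∫ z, K y z * f z ∂channelMeasure‖ₑ ^ 2 ∂channelMeasure
      ≤ ENNReal.ofReal (M * Real.pi) ^ 2 * ∫⁻ y, ‖f y‖ₑ ^ 2 ∂channelMeasure := by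
  set k : ℝ → ℝ → ℝ≥0∞ := fun y z => ENNReal.ofReal (cauchyKernel δ (y - z)) with hk
  have hkm : Measurable (Function.uncurry k) :=
    ((continuous_cauchyKernel δ).comp (by fun_prop : Continuous fun p : ℝ × ℝ => p.1 - p.2)).measurable.ennreal_ofReal
  have hfm : AEMeasurable (fun z => ‖f z‖ₑ) channelMeasure := hf.1.enorm
  set m := ENNReal.ofReal M
  set π' := ENNReal.ofReal Real.pi
  -- Cauchy–Schwarz with the kernel as weight costs its mass `π` in `z`; exchanging the integrals in
  -- `step2` costs its mass `π` in `y`.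
  have step1 : ∀ y ∈ Ioo (-1 : ℝ) 1, ‖∫ z, K y z * f z ∂channelMeasure‖ₑ ^ 2
      ≤ m ^ 2 * (π' * ∫⁻ z, k y z * ‖f z‖ₑ ^ 2 ∂channelMeasure) := by
    intro y hy
    have hky : AEMeasurable (k y) channelMeasure :=
      (hkm.comp measurable_prodMk_left).aemeasurable
    have h1 : ‖∫ z, K y z * f z ∂channelMeasure‖ₑ ≤ m * ∫⁻ z, k y z * ‖f z‖ₑ ∂channelMeasure := by
      refine (enorm_integral_le_lintegral_enorm _).trans ?_
      rw [← lintegral_const_mul' _ _ ENNReal.ofReal_ne_top]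
      refine lintegral_mono_ae ?_
      rw [ae_channelMeasure]
      refine Filter.Eventually.of_forall fun z hz => ?_
      rw [enorm_mul, ← mul_assoc]
      gcongr
      rw [← ENNReal.ofReal_mul hM, ← ofReal_norm]
      exact ENNReal.ofReal_le_ofReal (hb y hy z hz)
    calc _ ≤ _ := pow_le_pow_left' h1 2
      _ = m ^ 2 * (∫⁻ z, k y z * ‖f z‖ₑ ∂channelMeasure) ^ 2 := mul_pow _ _ _
      _ ≤ _ := by
        gcongr
        refine (lintegral_mul_sq_le hky hfm).trans ?_
        gcongr
        exact lintegral_cauchyKernel_sub_left hδ y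
  have step2 : ∫⁻ y, ∫⁻ z, k y z * ‖f z‖ₑ ^ 2 ∂channelMeasure ∂channelMeasure
      ≤ π' * ∫⁻ z, ‖f z‖ₑ ^ 2 ∂channelMeasure := by
    rw [lintegral_lintegral_swap]
    · rw [← lintegral_const_mul' _ _ ENNReal.ofReal_ne_top]
      refine lintegral_mono fun z => ?_
      have hkz : AEMeasurable (fun y => k y z) channelMeasure :=
        (hkm.comp measurable_prodMk_right).aemeasurable
      rw [lintegral_mul_const'' _ hkz]
      gcongr
      exact lintegral_cauchyKernel_sub_right hδ z
    · exact hkm.aemeasurable.mul ((hfm.pow_const 2).comp_snd)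
  calc _ ≤ ∫⁻ y, m ^ 2 * (π' * ∫⁻ z, k y z * ‖f z‖ₑ ^ 2 ∂channelMeasure) ∂channelMeasure := by
        refine lintegral_mono_ae ?_
        rw [ae_channelMeasure]
        exact Filter.Eventually.of_forall step1
    _ = m ^ 2 * (π' * ∫⁻ y, ∫⁻ z, k y z * ‖f z‖ₑ ^ 2 ∂channelMeasure ∂channelMeasure) := by
        rw [lintegral_const_mul' _ _ (by finiteness), lintegral_const_mul' _ _ (by finiteness)]
    _ ≤ m ^ 2 * (π' * (π' * ∫⁻ z, ‖f z‖ₑ ^ 2 ∂channelMeasure)) := by gcongr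
    _ = _ := by rw [ENNReal.ofReal_mul hM]; ring

lemma aestronglyMeasurable_kernel_integral {K : ℝ → ℝ → ℂ} (hK : Continuous (Function.uncurry K))
    {f : ℝ → ℂ} (hf : MemLp f 2 channelMeasure) :
    AEStronglyMeasurable (fun y => ∫ z, K y z * f z ∂channelMeasure) channelMeasure := by
  have h : AEStronglyMeasurable (fun p : ℝ × ℝ => K p.1 p.2 * f p.2)
      (channelMeasure.prod channelMeasure) :=
    hK.aestronglyMeasurable.mul hf.1.comp_snd
  exact h.integral_prod_right'

lemma integrable_kernel_mul {K : ℝ → ℝ → ℂ} (hK : Continuous (Function.uncurry K))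
    {f : ℝ → ℂ} (hf : MemLp f 2 channelMeasure) (y : ℝ) :
    Integrable (fun z => K y z * f z) channelMeasure := by
  have hc : Continuous (K y) := hK.comp (by fun_prop : Continuous fun z : ℝ => (y, z))
  obtain ⟨C, hC⟩ := isCompact_Icc.exists_bound_of_continuousOn (hc.continuousOn (s := Icc (-1 : ℝ) 1))
  refine (hf.integrable (by norm_num)).bdd_mul (c := C) hc.aestronglyMeasurable ?_
  rw [ae_channelMeasure]
  exact Filter.Eventually.of_forall fun z hz => hC z (Ioo_subset_Icc_self hz)

/-- Integral operators on `L²(-1,1)` with kernel dominated by a Cauchy kernel. -/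
lemma exists_kernelOperator {K : ℝ → ℝ → ℂ} (hK : Continuous (Function.uncurry K)) {M δ : ℝ}
    (hδ : 0 < δ) (hM : 0 ≤ M)
    (hb : ∀ y ∈ Ioo (-1 : ℝ) 1, ∀ z ∈ Ioo (-1 : ℝ) 1, ‖K y z‖ ≤ M * cauchyKernel δ (y - z)) :
    ∃ T : ChannelL2 →L[ℂ] ChannelL2,
      (∀ f : ChannelL2, T f =ᵐ[channelMeasure] fun y => ∫ z, K y z * f z ∂channelMeasure) ∧
      ∀ f : ChannelL2, ‖T f‖ ≤ M * Real.pi * ‖f‖ := by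
  have hMπ : 0 ≤ M * Real.pi := mul_nonneg hM Real.pi_pos.le
  have hS : ∀ f : ChannelL2, eLpNorm (fun y => ∫ z, K y z * f z ∂channelMeasure) 2 channelMeasure
      ≤ ENNReal.ofReal (M * Real.pi) * eLpNorm f 2 channelMeasure := fun f => by
    have := lintegral_kernel_sq_le hδ hM hb (Lp.memLp f)
    rw [← eLpNorm_two_sq_eq_lintegral, ← eLpNorm_two_sq_eq_lintegral, ← mul_pow] at this
    exact (ENNReal.pow_le_pow_left_iff two_ne_zero).1 this
  have hmem : ∀ f : ChannelL2, MemLp (fun y => ∫ z, K y z * f z ∂channelMeasure) 2 channelMeasure :=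
    fun f => ⟨aestronglyMeasurable_kernel_integral hK (Lp.memLp f),
      (hS f).trans_lt (ENNReal.mul_lt_top ENNReal.ofReal_lt_top (Lp.memLp f).2)⟩
  let T₀ : ChannelL2 →ₗ[ℂ] ChannelL2 :=
    { toFun := fun f => (hmem f).toLp _
      map_add' := fun f g => by
        rw [← MemLp.toLp_add]
        refine MemLp.toLp_congr _ _ (Filter.Eventually.of_forall fun y => ?_)
        simp only [Pi.add_apply]
        rw [← integral_add (integrable_kernel_mul hK (Lp.memLp f) y)
          (integrable_kernel_mul hK (Lp.memLp g) y)]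
        refine integral_congr_ae ?_
        filter_upwards [Lp.coeFn_add f g] with z hz
        rw [hz, Pi.add_apply, mul_add]
      map_smul' := fun c f => by
        rw [RingHom.id_apply, ← MemLp.toLp_const_smul]
        refine MemLp.toLp_congr _ _ (Filter.Eventually.of_forall fun y => ?_)
        simp only [Pi.smul_apply, smul_eq_mul]
        rw [← integral_const_mul]
        refine integral_congr_ae ?_
        filter_upwards [Lp.coeFn_smul c f] with z hz
        rw [hz, Pi.smul_apply, smul_eq_mul]; ring }
  have hT₀ : ∀ f, ‖T₀ f‖ ≤ M * Real.pi * ‖f‖ := fun f => by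
    change ‖(hmem f).toLp _‖ ≤ _
    rw [Lp.norm_toLp, Lp.norm_def, ← ENNReal.toReal_ofReal hMπ, ← ENNReal.toReal_mul]
    exact ENNReal.toReal_mono (ENNReal.mul_ne_top ENNReal.ofReal_ne_top (Lp.memLp f).2.ne) (hS f)
  exact ⟨T₀.mkContinuous _ hT₀, fun f => (hmem f).coeFn_toLp, hT₀⟩

lemma memLp_id_mul {f : ℝ → ℂ} (hf : MemLp f 2 channelMeasure) :
    MemLp (fun y : ℝ => (y : ℂ) * f y) 2 channelMeasure := by
  refine MemLp.of_le_mul (c := 1) hf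
    (Complex.continuous_ofReal.aestronglyMeasurable.mul hf.1) ?_
  rw [ae_channelMeasure]
  refine Filter.Eventually.of_forall fun y hy => ?_
  rw [norm_mul, Complex.norm_real]
  gcongr
  exact abs_le.2 ⟨hy.1.le, hy.2.le⟩

/-! ### Multiplication by `y`, cutoff and kernels -/

/-- Multiplication by `y` on `L²(-1,1)`. -/
def mulYL2 : ChannelL2 →L[ℂ] ChannelL2 :=
  LinearMap.mkContinuous
    { toFun := fun f => (memLp_id_mul (Lp.memLp f)).toLp _
      map_add' := fun f g => by
        rw [← MemLp.toLp_add]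
        refine MemLp.toLp_congr _ _ ?_
        filter_upwards [Lp.coeFn_add f g] with z hz
        rw [hz, Pi.add_apply, Pi.add_apply, mul_add]
      map_smul' := fun c f => by
        rw [RingHom.id_apply, ← MemLp.toLp_const_smul]
        refine MemLp.toLp_congr _ _ ?_
        filter_upwards [Lp.coeFn_smul c f] with z hz
        rw [hz, Pi.smul_apply, Pi.smul_apply, smul_eq_mul, smul_eq_mul]; ring } 1 (fun f => by
      refine Lp.norm_le_mul_norm_of_ae_le_mul ?_
      filter_upwards [(memLp_id_mul (Lp.memLp f)).coeFn_toLp,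
        ae_channelMeasure.2 (Filter.Eventually.of_forall fun y hy => hy)] with y h1 hy
      simp only [LinearMap.coe_mk, AddHom.coe_mk, h1]
      rw [norm_mul, Complex.norm_real]
      gcongr
      exact abs_le.2 ⟨hy.1.le, hy.2.le⟩)

lemma coeFn_mulYL2 (f : ChannelL2) :
    mulYL2 f =ᵐ[channelMeasure] fun y => (y : ℂ) * f y :=
  (memLp_id_mul (Lp.memLp f)).coeFn_toLp

lemma inner_mulYL2_comm (f g : ChannelL2) :
    inner ℂ (mulYL2 f) g = inner ℂ f (mulYL2 g) := by
  rw [ChannelL2.inner_eq, ChannelL2.inner_eq]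
  refine integral_congr_ae ?_
  filter_upwards [coeFn_mulYL2 f, coeFn_mulYL2 g] with y h1 h2
  rw [h1, h2, map_mul, Complex.conj_ofReal]; ring

/-- The reason why transport is invisible in the plain energy balance and a multiplier is required.
-/
lemma im_inner_mulYL2_self (f : ChannelL2) : (inner ℂ f (mulYL2 f)).im = 0 := by
  have h := inner_mulYL2_comm f f
  rw [← inner_conj_symm] at h
  exact Complex.conj_eq_iff_im.1 h

lemma norm_mulYL2_le (f : ChannelL2) : ‖mulYL2 f‖ ≤ ‖f‖ := by
  have := mulYL2.le_of_opNorm_le (LinearMap.mkContinuous_norm_le _ zero_le_one _) f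
  simpa using this

/-- A smooth cutoff vanishing at `y = ±1`, of order one at distance `δ` from the boundary. -/
def cutoff (δ y : ℝ) : ℝ := 1 - Real.exp (-(1 - y ^ 2) / δ)

lemma cutoff_mem_Icc {δ y : ℝ} (hδ : 0 < δ) (hy : y ∈ Ioo (-1 : ℝ) 1) :
    cutoff δ y ∈ Icc (0 : ℝ) 1 := by
  have h1 : -(1 - y ^ 2) / δ ≤ 0 := div_nonpos_of_nonpos_of_nonneg (by nlinarith [hy.1, hy.2]) hδ.le
  have := Real.exp_le_one_iff.2 h1
  have := Real.exp_pos (-(1 - y ^ 2) / δ)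
  constructor <;> unfold cutoff <;> linarith

/-- Here `1 - y² = (1 - |y|)(1 + |y|) ≥ δ`, and `e⁻¹ ≤ 1/2`. -/
lemma half_le_cutoff {δ y : ℝ} (hδ : 0 < δ) (hy : δ ≤ 1 - |y|) : 1 / 2 ≤ cutoff δ y := by
  have h1 : -(1 - y ^ 2) / δ ≤ -1 := by
    rw [div_le_iff₀ hδ]
    nlinarith [sq_abs y, abs_nonneg y]
  have h2 := Real.exp_le_exp.2 h1
  have h3 : Real.exp (-1) ≤ 1 / 2 := by
    rw [Real.exp_neg, one_div]
    exact inv_anti₀ (by norm_num) (by linarith [Real.add_one_le_exp (1 : ℝ)])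
  unfold cutoff; linarith

/-- The derivative of `cutoff`. -/
def cutoffDeriv (δ y : ℝ) : ℝ := -(Real.exp (-(1 - y ^ 2) / δ) * (2 * y / δ))

lemma hasDerivAt_cutoff (δ y : ℝ) : HasDerivAt (cutoff δ) (cutoffDeriv δ y) y := by
  have h : HasDerivAt (fun y : ℝ => -(1 - y ^ 2) / δ) (2 * y / δ) y := by
    have := ((((hasDerivAt_id y).pow 2).const_sub 1).neg).div_const δ
    refine this.congr_deriv ?_
    simp
  exact h.exp.const_sub 1

lemma abs_cutoffDeriv_le {δ y : ℝ} (hδ : 0 < δ) (hy : y ∈ Ioo (-1 : ℝ) 1) :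
    |cutoffDeriv δ y| ≤ 2 * δ⁻¹ := by
  have h1 : -(1 - y ^ 2) / δ ≤ 0 := div_nonpos_of_nonpos_of_nonneg (by nlinarith [hy.1, hy.2]) hδ.le
  have h2 := Real.exp_le_one_iff.2 h1
  have h3 : |y| ≤ 1 := abs_le.2 ⟨hy.1.le, hy.2.le⟩
  unfold cutoffDeriv
  rw [abs_neg, abs_mul, Real.abs_exp, abs_div, abs_mul, abs_two, abs_of_pos hδ,
    div_eq_mul_inv (2 * |y|)]
  calc _ ≤ 1 * (2 * 1 * δ⁻¹) := by gcongr
    _ = _ := by ring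

/-- An odd kernel at scale `δ`. -/
def oddKernel (δ z : ℝ) : ℝ := δ⁻¹ * ((z / δ) * ((1 + (z / δ) ^ 2)⁻¹) ^ 3)

/-- The derivative of `oddKernel`. -/
def oddKernelDeriv (δ z : ℝ) : ℝ :=
  δ⁻¹ * (δ⁻¹ * (((1 + (z / δ) ^ 2)⁻¹) ^ 3 - 6 * (z / δ) ^ 2 * ((1 + (z / δ) ^ 2)⁻¹) ^ 4))

lemma oddKernel_neg (δ z : ℝ) : oddKernel δ (-z) = -oddKernel δ z := by
  unfold oddKernel; rw [neg_div]; ring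

lemma hasDerivAt_oddKernel (δ z : ℝ) : HasDerivAt (oddKernel δ) (oddKernelDeriv δ z) z := by
  have hx : HasDerivAt (fun z : ℝ => z / δ) δ⁻¹ z := by
    simpa [div_eq_mul_inv] using (hasDerivAt_id z).mul_const δ⁻¹
  have hp : (1 + (z / δ) ^ 2) ≠ 0 := by positivity
  have h := (hx.mul ((((hx.pow 2).const_add 1).inv hp).pow 3)).const_mul δ⁻¹
  refine h.congr_deriv ?_
  unfold oddKernelDeriv
  simp only [Pi.inv_apply, Pi.pow_apply]
  rw [div_eq_mul_inv _ ((1 + (z / δ) ^ 2) ^ 2), ← inv_pow]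
  generalize hs : (1 + (z / δ) ^ 2)⁻¹ = s
  push_cast
  ring

/-- With `x = z/δ` and `s = (1 + x²)⁻¹`, both `|x|s` and `x²s` are at most `1`, and a leftover
factor `s` rebuilds the Cauchy kernel. The constant `7` is `1 + 6` from the two terms of the
derivative. -/
lemma oddKernel_bounds {δ : ℝ} (hδ : 0 < δ) (z : ℝ) :
    |oddKernel δ z| ≤ cauchyKernel δ z ∧ |oddKernelDeriv δ z| ≤ 7 * δ⁻¹ * cauchyKernel δ z := by
  unfold oddKernel oddKernelDeriv cauchyKernel
  set x := z / δ
  set s := (1 + x ^ 2)⁻¹ with hs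
  have hs0 : 0 < s := by positivity
  have hs1 : s ≤ 1 := inv_le_one_of_one_le₀ (by nlinarith [sq_nonneg x])
  have hxs : x ^ 2 * s ≤ 1 := by
    have : (1 + x ^ 2) * s = 1 := mul_inv_cancel₀ (by positivity)
    nlinarith
  have hxs' : |x| * s ≤ 1 := by
    have : (1 + x ^ 2) * s = 1 := mul_inv_cancel₀ (by positivity)
    nlinarith [sq_nonneg (|x| - 1), sq_abs x, abs_nonneg x]
  have hs2 : s ^ 2 ≤ s := by nlinarith
  have hs3 : s ^ 3 ≤ s := by nlinarith
  have hδ' : 0 < δ⁻¹ := inv_pos.2 hδ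
  constructor
  · rw [abs_mul, abs_of_pos hδ', abs_mul, abs_of_pos (pow_pos hs0 3)]
    refine mul_le_mul_of_nonneg_left ?_ hδ'.le
    have : |x| * s ^ 3 = (|x| * s) * s ^ 2 := by ring
    rw [this]
    nlinarith [mul_nonneg (abs_nonneg x) hs0.le]
  · rw [abs_mul, abs_of_pos hδ', abs_mul, abs_of_pos hδ']
    have h4 : x ^ 2 * s ^ 4 ≤ s := by
      have : x ^ 2 * s ^ 4 = (x ^ 2 * s) * s ^ 3 := by ring
      rw [this]; nlinarith [mul_nonneg (sq_nonneg x) hs0.le, pow_pos hs0 3]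
    have h5 : 0 ≤ x ^ 2 * s ^ 4 := by positivity
    have : |s ^ 3 - 6 * x ^ 2 * s ^ 4| ≤ 7 * s := by
      rw [abs_le]; constructor <;> nlinarith [pow_pos hs0 3]
    calc _ ≤ δ⁻¹ * (δ⁻¹ * (7 * s)) := by gcongr
      _ = _ := by ring

lemma continuous_cutoff (δ : ℝ) : Continuous (cutoff δ) := by unfold cutoff; fun_prop

lemma continuous_cutoffDeriv (δ : ℝ) : Continuous (cutoffDeriv δ) := by
  unfold cutoffDeriv; fun_prop

lemma continuous_oddKernel (δ : ℝ) : Continuous (oddKernel δ) :=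
  continuous_iff_continuousAt.2 fun z => (hasDerivAt_oddKernel δ z).continuousAt

lemma continuous_oddKernelDeriv (δ : ℝ) : Continuous (oddKernelDeriv δ) := by
  have h : Continuous fun z : ℝ => (1 + (z / δ) ^ 2)⁻¹ :=
    Continuous.inv₀ (by fun_prop) fun z => by positivity
  unfold oddKernelDeriv; fun_prop

/-- The real symmetric part of the multiplier kernel. -/
def realKernel (δ y z : ℝ) : ℝ := cutoff δ y * cutoff δ z * oddKernel δ (y - z)

/-- The `y`-derivative of `realKernel`. -/
def realKernelDeriv (δ y z : ℝ) : ℝ :=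
  cutoff δ z * (cutoffDeriv δ y * oddKernel δ (y - z) + cutoff δ y * oddKernelDeriv δ (y - z))

lemma continuous_realKernel (δ : ℝ) : Continuous (Function.uncurry (realKernel δ)) := by
  have h1 := continuous_cutoff δ
  have h2 := continuous_oddKernel δ
  simp only [Function.uncurry_def, realKernel]; fun_prop

lemma continuous_realKernelDeriv (δ : ℝ) : Continuous (Function.uncurry (realKernelDeriv δ)) := by
  have h1 := continuous_cutoff δ
  have h2 := continuous_oddKernel δ
  have h3 := continuous_cutoffDeriv δ
  have h4 := continuous_oddKernelDeriv δ
  simp only [Function.uncurry_def, realKernelDeriv]; fun_prop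

/-- Antisymmetry of this real kernel makes `i` times it Hermitian, hence the multiplier symmetric.
-/
lemma realKernel_swap (δ y z : ℝ) : realKernel δ z y = -realKernel δ y z := by
  unfold realKernel
  rw [← neg_sub y z, oddKernel_neg]; ring

lemma abs_realKernel_le {δ y z : ℝ} (hδ : 0 < δ) (hy : y ∈ Ioo (-1 : ℝ) 1)
    (hz : z ∈ Ioo (-1 : ℝ) 1) : |realKernel δ y z| ≤ cauchyKernel δ (y - z) := by
  have h1 := cutoff_mem_Icc hδ hy
  have h2 := cutoff_mem_Icc hδ hz
  have h3 := (oddKernel_bounds hδ (y - z)).1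
  unfold realKernel
  rw [abs_mul, abs_of_nonneg (mul_nonneg h1.1 h2.1)]
  calc _ ≤ 1 * |oddKernel δ (y - z)| := by
        gcongr; exact mul_le_one₀ h1.2 h2.1 h2.2
    _ ≤ _ := by rwa [one_mul]

/-- One derivative costs `δ⁻¹` wherever it falls: `2δ⁻¹` on the cutoff and `7δ⁻¹` on the odd kernel.
-/
lemma abs_realKernelDeriv_le {δ y z : ℝ} (hδ : 0 < δ) (hy : y ∈ Ioo (-1 : ℝ) 1)
    (hz : z ∈ Ioo (-1 : ℝ) 1) :
    |realKernelDeriv δ y z| ≤ 9 * δ⁻¹ * cauchyKernel δ (y - z) := by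
  have h1 := cutoff_mem_Icc hδ hy
  have h2 := cutoff_mem_Icc hδ hz
  have h3 := oddKernel_bounds hδ (y - z)
  have h4 := abs_cutoffDeriv_le hδ hy
  have h5 := cauchyKernel_nonneg hδ (y - z)
  unfold realKernelDeriv
  rw [abs_mul, abs_of_nonneg h2.1]
  calc _ ≤ 1 * (|cutoffDeriv δ y * oddKernel δ (y - z)|
        + |cutoff δ y * oddKernelDeriv δ (y - z)|) := by
        gcongr
        · exact h2.2
        · exact abs_add_le _ _
    _ ≤ 1 * (2 * δ⁻¹ * cauchyKernel δ (y - z) + 1 * (7 * δ⁻¹ * cauchyKernel δ (y - z))) := by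
        rw [abs_mul, abs_mul, abs_of_nonneg h1.1]
        gcongr
        · exact h3.1
        · exact h1.2
        · exact h3.2
    _ = _ := by ring

lemma hasDerivAt_realKernel (δ y z : ℝ) :
    HasDerivAt (fun y => realKernel δ y z) (realKernelDeriv δ y z) y := by
  have h1 : HasDerivAt (fun y => oddKernel δ (y - z)) (oddKernelDeriv δ (y - z)) y :=
    (hasDerivAt_oddKernel δ (y - z)).comp_sub_const y z
  have h := ((hasDerivAt_cutoff δ y).mul_const (cutoff δ z)).mul h1
  refine h.congr_deriv ?_
  unfold realKernelDeriv; ring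

/-- This is the purpose of the cutoff: the multiplier then takes values in `H¹₀`, so that `θ + Pθ`
is an admissible test function. -/
lemma realKernel_boundary (δ z : ℝ) : realKernel δ (-1) z = 0 ∧ realKernel δ 1 z = 0 := by
  constructor <;> simp [realKernel, cutoff]

lemma exists_bound_channel {K : ℝ → ℝ → ℂ} (hK : Continuous (Function.uncurry K)) :
    ∃ C, ∀ y ∈ Icc (-1 : ℝ) 1, ∀ z ∈ Icc (-1 : ℝ) 1, ‖K y z‖ ≤ C := by
  obtain ⟨C, hC⟩ := (isCompact_Icc (a := (-1 : ℝ)) (b := 1) |>.prod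
    (isCompact_Icc (a := (-1 : ℝ)) (b := 1))).exists_bound_of_continuousOn hK.continuousOn
  exact ⟨C, fun y hy z hz => hC (y, z) ⟨hy, hz⟩⟩

lemma ae_prod_channel : ∀ᵐ p ∂(channelMeasure.prod channelMeasure),
    p.1 ∈ Ioo (-1 : ℝ) 1 ∧ p.2 ∈ Ioo (-1 : ℝ) 1 := by
  rw [channelMeasure, Measure.prod_restrict]
  filter_upwards [ae_restrict_mem (measurableSet_Ioo.prod measurableSet_Ioo)] with p hp
  exact ⟨hp.1, hp.2⟩

/-- Kernel integrals of `L²` functions lie in `H¹₀` if the kernel vanishes at `y = ±1`. -/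
lemma isH10_kernel_integral {K K' : ℝ → ℝ → ℂ} (hK' : Continuous (Function.uncurry K'))
    (hd : ∀ y z, HasDerivAt (fun y => K y z) (K' y z) y) (h0 : ∀ z, K (-1) z = 0)
    (h1 : ∀ z, K 1 z = 0) {f : ℝ → ℂ} (hf : MemLp f 2 channelMeasure)
    (hm : MemLp (fun y => ∫ z, K' y z * f z ∂channelMeasure) 2 channelMeasure) :
    IsH10 (fun y => ∫ z, K y z * f z ∂channelMeasure)
      (fun y => ∫ z, K' y z * f z ∂channelMeasure) := by
  obtain ⟨C, hC⟩ := exists_bound_channel hK'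
  have key : ∀ y ∈ Icc (-1 : ℝ) 1, ∫ s in (-1 : ℝ)..y, ∫ z, K' s z * f z ∂channelMeasure
      = ∫ z, K y z * f z ∂channelMeasure := by
    intro y hy
    rw [intervalIntegral.integral_of_le hy.1, integral_integral_swap]
    · refine integral_congr_ae (Filter.Eventually.of_forall fun z => ?_)
      simp only
      rw [integral_mul_const, ← intervalIntegral.integral_of_le hy.1,
        intervalIntegral.integral_eq_sub_of_hasDerivAt (fun t _ => hd t z), h0, sub_zero]
      exact (hK'.comp (by fun_prop : Continuous fun s : ℝ => (s, z))).intervalIntegrable _ _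
    · have hfi : Integrable (fun p : ℝ × ℝ => f p.2)
          ((volume.restrict (Ioc (-1) y)).prod channelMeasure) :=
        (hf.integrable (by norm_num)).comp_snd _
      refine hfi.bdd_mul (c := C) hK'.aestronglyMeasurable ?_
      rw [channelMeasure, Measure.prod_restrict]
      filter_upwards [ae_restrict_mem (measurableSet_Ioc.prod measurableSet_Ioo)] with p hp
      exact hC p.1 ⟨hp.1.1.le, hp.1.2.trans hy.2⟩ p.2 (Ioo_subset_Icc_self hp.2)
  refine ⟨hm, ?_, ?_⟩
  · rw [ae_channelMeasure]
    exact Filter.Eventually.of_forall fun y hy => (key y (Ioo_subset_Icc_self hy)).symm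
  · rw [key 1 (by simp)]; simp [h1]

lemma integrable_kernel_mul_mul {K : ℝ → ℝ → ℂ} (hK : Continuous (Function.uncurry K))
    {f g : ℝ → ℂ} (hf : MemLp f 2 channelMeasure) (hg : MemLp g 2 channelMeasure) :
    Integrable (fun p : ℝ × ℝ => K p.1 p.2 * (g p.1 * f p.2))
      (channelMeasure.prod channelMeasure) := by
  obtain ⟨C, hC⟩ := exists_bound_channel hK
  refine ((hg.integrable (by norm_num)).mul_prod (hf.integrable (by norm_num))).bdd_mul (c := C)
    hK.aestronglyMeasurable ?_
  filter_upwards [ae_prod_channel] with p hp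
  exact hC _ (Ioo_subset_Icc_self hp.1) _ (Ioo_subset_Icc_self hp.2)

/-- `⟨Tf, g⟩` as a double integral. -/
lemma inner_kernelOperator {K : ℝ → ℝ → ℂ} (hK : Continuous (Function.uncurry K))
    {f Tf g : ChannelL2}
    (hT : Tf =ᵐ[channelMeasure] fun y => ∫ z, K y z * f z ∂channelMeasure) :
    inner ℂ Tf g = ∫ p : ℝ × ℝ, (starRingEnd ℂ) (K p.1 p.2) * (g p.1 * (starRingEnd ℂ) (f p.2))
      ∂(channelMeasure.prod channelMeasure) := by
  rw [integral_prod, ChannelL2.inner_eq]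
  · refine integral_congr_ae ?_
    filter_upwards [hT] with y hy
    rw [hy, ← integral_conj, ← integral_mul_const]
    refine integral_congr_ae (Filter.Eventually.of_forall fun z => ?_)
    simp only [map_mul]; ring
  · exact integrable_kernel_mul_mul (K := fun y z => (starRingEnd ℂ) (K y z))
      (Complex.continuous_conj.comp hK) (Lp.memLp f).star (Lp.memLp g)

/-! ### Coercivity of the commutator with `y` -/

lemma mul_oddKernel_eq {δ : ℝ} (hδ : 0 < δ) (z : ℝ) :
    z * oddKernel δ z = (z / δ) ^ 2 * ((1 + (z / δ) ^ 2)⁻¹) ^ 3 := by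
  unfold oddKernel
  have : z = z / δ * δ := by field_simp
  calc _ = (z / δ * δ) * (δ⁻¹ * ((z / δ) * ((1 + (z / δ) ^ 2)⁻¹) ^ 3)) := by rw [← this]
    _ = (δ * δ⁻¹) * ((z / δ) ^ 2 * ((1 + (z / δ) ^ 2)⁻¹) ^ 3) := by ring
    _ = _ := by rw [mul_inv_cancel₀ hδ.ne', one_mul]

/-- Oddness gives the commutator kernel a sign; this is what produces damping. -/
lemma mul_oddKernel_nonneg {δ : ℝ} (hδ : 0 < δ) (z : ℝ) : 0 ≤ z * oddKernel δ z := by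
  rw [mul_oddKernel_eq hδ]; positivity

/-- The extra factors `|z|` come from Cauchy–Schwarz on `f(y) - f(z) = ∫ f'` and from the measure of
the `y` whose segment contains a given point. The cube in `oddKernel` is what leaves one integrable
factor after both are paid for. -/
lemma mul_oddKernel_mul_sq_le {δ : ℝ} (hδ : 0 < δ) (z : ℝ) :
    z * oddKernel δ z * |z| * |z| ≤ δ ^ 3 * cauchyKernel δ z := by
  have e : |z| * |z| = (z / δ) ^ 2 * δ ^ 2 := by
    rw [abs_mul_abs_self]; field_simp
  rw [mul_assoc, e, mul_oddKernel_eq hδ, cauchyKernel]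
  set x := z / δ
  set s := (1 + x ^ 2)⁻¹ with hs
  have hs0 : 0 < s := by positivity
  have hxs : x ^ 2 * s ≤ 1 := by
    have : (1 + x ^ 2) * s = 1 := mul_inv_cancel₀ (by positivity)
    nlinarith
  have hx0 : 0 ≤ x ^ 2 * s := by positivity
  calc _ = δ ^ 2 * ((x ^ 2 * s) * (x ^ 2 * s) * s) := by ring
    _ ≤ δ ^ 2 * (1 * 1 * s) := by gcongr
    _ = δ ^ 2 * (δ * δ⁻¹) * s := by rw [mul_inv_cancel₀ hδ.ne']; ring
    _ = _ := by ring

lemma mul_oddKernel_lower {δ z : ℝ} (hδ : 0 < δ) (h1 : δ / 2 ≤ |z|) (h2 : |z| ≤ δ) :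
    1 / 32 ≤ z * oddKernel δ z := by
  rw [mul_oddKernel_eq hδ]
  have hx : (z / δ) ^ 2 = (|z| / δ) ^ 2 := by rw [div_pow, div_pow, sq_abs]
  rw [hx]
  set x := |z| / δ
  have hx1 : 1 / 2 ≤ x := by rw [le_div_iff₀ hδ]; linarith
  have hx2 : x ≤ 1 := by rw [div_le_one hδ]; exact h2
  have hs : 1 / 2 ≤ (1 + x ^ 2)⁻¹ := by
    rw [one_div]; exact inv_anti₀ (by positivity) (by nlinarith)
  calc (1 : ℝ) / 32 = (1 / 2) ^ 2 * (1 / 2) ^ 3 := by norm_num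
    _ ≤ _ := by gcongr

/-- A point `s` lies between `y - t` and `y` only if `y` lies between `s` and `s + t`. -/
lemma lintegral_indicator_uIoc_le (s t : ℝ) :
    ∫⁻ y, (uIoc (y - t) y).indicator (fun _ => (1 : ℝ≥0∞)) s ≤ ENNReal.ofReal |t| := by
  have h : ∀ y, (uIoc (y - t) y).indicator (fun _ => (1 : ℝ≥0∞)) s
      ≤ (uIcc s (s + t)).indicator (fun _ => 1) y := by
    intro y
    by_cases hs : s ∈ uIoc (y - t) y
    · have : y ∈ uIcc s (s + t) := by
        rw [mem_uIoc] at hs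
        rw [mem_uIcc]
        rcases hs with hs | hs
        · exact Or.inl ⟨hs.2, by linarith [hs.1]⟩
        · exact Or.inr ⟨by linarith [hs.2], hs.1.le⟩
      rw [indicator_of_mem hs, indicator_of_mem this]
    · rw [indicator_of_notMem hs]; exact zero_le
  refine (lintegral_mono h).trans ?_
  rw [lintegral_indicator measurableSet_uIcc]
  simp [Real.volume_interval]

set_option maxHeartbeats 1000000 in
/-- Weighted difference quotients are controlled by the derivative. -/
lemma lintegral_diff_sq_le {δ : ℝ} (hδ : 0 < δ) {f f' : ℝ → ℂ} (h : IsH10 f f') :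
    ∫⁻ y, ∫⁻ z, ENNReal.ofReal ((y - z) * oddKernel δ (y - z)) * ‖f y - f z‖ₑ ^ 2
        ∂channelMeasure ∂channelMeasure
      ≤ ENNReal.ofReal (δ ^ 3 * Real.pi) * ∫⁻ s, ‖f' s‖ₑ ^ 2 ∂channelMeasure := by
  set w : ℝ → ℝ≥0∞ := fun t => ENNReal.ofReal (t * oddKernel δ t * |t|) with hw
  have hwm : Measurable w := by
    have := continuous_oddKernel δ
    exact (by fun_prop : Continuous fun t => t * oddKernel δ t * |t|).measurable.ennreal_ofReal
  set F : ℝ → ℝ≥0∞ := fun s => ‖f' s‖ₑ ^ 2 with hF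
  have hFm : AEMeasurable F channelMeasure := h.memLp_deriv.1.enorm.pow_const 2
  set χ : ℝ → ℝ → ℝ → ℝ≥0∞ := fun y z s => (uIoc z y).indicator (fun _ => 1) s with hχ
  have hχm : Measurable fun p : (ℝ × ℝ) × ℝ => χ p.1.1 p.1.2 p.2 := by
    have hS : MeasurableSet {p : (ℝ × ℝ) × ℝ | min p.1.2 p.1.1 < p.2 ∧ p.2 ≤ max p.1.2 p.1.1} := by
      have h1 : Measurable fun p : (ℝ × ℝ) × ℝ => min p.1.2 p.1.1 := by fun_prop
      have h2 : Measurable fun p : (ℝ × ℝ) × ℝ => max p.1.2 p.1.1 := by fun_prop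
      exact (measurableSet_lt h1 measurable_snd).inter (measurableSet_le measurable_snd h2)
    have e : (fun p : (ℝ × ℝ) × ℝ => χ p.1.1 p.1.2 p.2)
        = {p : (ℝ × ℝ) × ℝ | min p.1.2 p.1.1 < p.2 ∧ p.2 ≤ max p.1.2 p.1.1}.indicator
          (fun _ => (1 : ℝ≥0∞)) := by
      ext p; simp only [hχ, uIoc, indicator, mem_Ioc, mem_ofPred_eq]
    rw [e]
    exact measurable_const.indicator hS
  have hWm : Measurable fun p : (ℝ × ℝ) × ℝ => w (p.1.1 - p.1.2) * χ p.1.1 p.1.2 p.2 :=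
    (hwm.comp (by fun_prop)).mul hχm
  have hp := ae_channelMeasure.1 h.ae_eq_primitive
  have step1 : ∀ᵐ y ∂channelMeasure, ∀ᵐ z ∂channelMeasure,
      ENNReal.ofReal ((y - z) * oddKernel δ (y - z)) * ‖f y - f z‖ₑ ^ 2
        ≤ ∫⁻ s, w (y - z) * χ y z s * F s ∂channelMeasure := by
    rw [ae_channelMeasure]
    filter_upwards [hp] with y hy hyc
    rw [ae_channelMeasure]
    filter_upwards [hp] with z hz hzc
    have hsub : uIoc z y ⊆ Ioo (-1 : ℝ) 1 := uIoc_subset_uIcc.trans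
      ((convex_Ioo (-1 : ℝ) 1).ordConnected.uIcc_subset hzc hyc)
    have e1 : f y - f z = ∫ s in z..y, f' s := by
      rw [hy hyc, hz hzc]
      rw [intervalIntegral.integral_interval_sub_left
        (h.intervalIntegrable_deriv_left (Ioo_subset_Icc_self hyc))
        (h.intervalIntegrable_deriv_left (Ioo_subset_Icc_self hzc))]
    have hres : volume.restrict (uIoc z y) = channelMeasure.restrict (uIoc z y) := by
      rw [channelMeasure, Measure.restrict_restrict measurableSet_uIoc,
        inter_eq_left.2 hsub]
    have h2 := enorm_intervalIntegral_sq_le (f := f') (a := z) (b := y)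
      (by rw [hres]; exact h.memLp_deriv.1.mono_measure Measure.restrict_le_self)
    rw [← e1, hres] at h2
    calc _ ≤ ENNReal.ofReal ((y - z) * oddKernel δ (y - z)) *
          (ENNReal.ofReal |y - z| * ∫⁻ s in uIoc z y, ‖f' s‖ₑ ^ 2 ∂channelMeasure) := by gcongr
      _ = w (y - z) * ∫⁻ s in uIoc z y, ‖f' s‖ₑ ^ 2 ∂channelMeasure := by
        rw [← mul_assoc, ← ENNReal.ofReal_mul (mul_oddKernel_nonneg hδ _)]
      _ = _ := by
        rw [← lintegral_indicator measurableSet_uIoc, ← lintegral_const_mul' _ _ (by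
          simp only [hw]; exact ENNReal.ofReal_ne_top)]
        refine lintegral_congr fun s => ?_
        rw [mul_assoc]
        congr 1
        simp only [hχ, hF, indicator]
        split_ifs <;> simp
  -- For a fixed point `s`, integrate over all segments through `s`, parametrized by the endpoint
  -- `y` and the signed length `t = y - z`; the result is uniform in `s`.
  have inner_bound : ∀ s, ∫⁻ y, ∫⁻ z, w (y - z) * χ y z s ∂channelMeasure ∂channelMeasure
      ≤ ENNReal.ofReal (δ ^ 3 * Real.pi) := by
    intro s
    calc _ ≤ ∫⁻ y, ∫⁻ z, w (y - z) * χ y z s := by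
          refine lintegral_mono' Measure.restrict_le_self fun y => ?_
          exact lintegral_mono' Measure.restrict_le_self le_rfl
      _ = ∫⁻ y, ∫⁻ t, w t * χ y (y - t) s := by
          refine lintegral_congr fun y => ?_
          rw [← lintegral_sub_left_eq_self (fun t => w t * χ y (y - t) s) y]
          simp
      _ = ∫⁻ t, ∫⁻ y, w t * χ y (y - t) s := by
          refine lintegral_lintegral_swap (Measurable.aemeasurable ?_)
          exact (hwm.comp measurable_snd).mul (hχm.comp
            (by fun_prop : Measurable fun p : ℝ × ℝ => ((p.1, p.1 - p.2), s)))
      _ ≤ ∫⁻ t, ENNReal.ofReal (δ ^ 3) * ENNReal.ofReal (cauchyKernel δ t) := by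
          refine lintegral_mono fun t => ?_
          rw [lintegral_const_mul' _ _ (by simp only [hw]; exact ENNReal.ofReal_ne_top)]
          calc _ ≤ w t * ENNReal.ofReal |t| := by
                gcongr; exact lintegral_indicator_uIoc_le s t
            _ ≤ _ := by
                simp only [hw]
                rw [← ENNReal.ofReal_mul (mul_nonneg (mul_oddKernel_nonneg hδ t) (abs_nonneg t)),
                  ← ENNReal.ofReal_mul (by positivity)]
                exact ENNReal.ofReal_le_ofReal (mul_oddKernel_mul_sq_le hδ t)
      _ = _ := by
          rw [lintegral_const_mul' _ _ ENNReal.ofReal_ne_top, lintegral_cauchyKernel hδ,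
            ENNReal.ofReal_mul (by positivity)]
  calc _ ≤ ∫⁻ y, ∫⁻ z, ∫⁻ s, w (y - z) * χ y z s * F s
        ∂channelMeasure ∂channelMeasure ∂channelMeasure :=
        lintegral_mono_ae (step1.mono fun y hy => lintegral_mono_ae hy)
    _ = ∫⁻ y, ∫⁻ s, (∫⁻ z, w (y - z) * χ y z s ∂channelMeasure) * F s
        ∂channelMeasure ∂channelMeasure := by
        refine lintegral_congr fun y => ?_
        have hm : Measurable fun q : ℝ × ℝ => w (y - q.1) * χ y q.1 q.2 :=
          hWm.comp (by fun_prop : Measurable fun q : ℝ × ℝ => ((y, q.1), q.2))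
        rw [lintegral_lintegral_swap]
        · refine lintegral_congr fun s => ?_
          rw [lintegral_mul_const]
          exact hm.comp (by fun_prop : Measurable fun z : ℝ => (z, s))
        · exact hm.aemeasurable.mul hFm.comp_snd
    _ = ∫⁻ s, (∫⁻ y, ∫⁻ z, w (y - z) * χ y z s ∂channelMeasure ∂channelMeasure) * F s
        ∂channelMeasure := by
        have hm : Measurable fun q : ℝ × ℝ => ∫⁻ z, w (q.1 - z) * χ q.1 z q.2 ∂channelMeasure := by
          have : Measurable fun r : (ℝ × ℝ) × ℝ => w (r.1.1 - r.2) * χ r.1.1 r.2 r.1.2 :=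
            hWm.comp (by fun_prop : Measurable fun r : (ℝ × ℝ) × ℝ => ((r.1.1, r.2), r.1.2))
          exact this.lintegral_prod_right'
        rw [lintegral_lintegral_swap]
        · refine lintegral_congr fun s => ?_
          rw [lintegral_mul_const]
          exact hm.comp (by fun_prop : Measurable fun y : ℝ => (y, s))
        · exact hm.aemeasurable.mul hFm.comp_snd
    _ ≤ ∫⁻ s, ENNReal.ofReal (δ ^ 3 * Real.pi) * F s ∂channelMeasure := by
        refine lintegral_mono fun s => ?_
        simp only; gcongr; exact inner_bound s
    _ = _ := by rw [lintegral_const_mul' _ _ ENNReal.ofReal_ne_top]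

/-- The nonnegative symmetric kernel of the commutator with `y`. -/
def commKernel (δ : ℝ) (p : ℝ × ℝ) : ℝ := (p.1 - p.2) * realKernel δ p.1 p.2

lemma continuous_commKernel (δ : ℝ) : Continuous (commKernel δ) := by
  have := continuous_realKernel δ
  unfold commKernel
  exact (by fun_prop : Continuous fun p : ℝ × ℝ => p.1 - p.2).mul this

lemma commKernel_eq (δ : ℝ) (p : ℝ × ℝ) : commKernel δ p =
    cutoff δ p.1 * cutoff δ p.2 * ((p.1 - p.2) * oddKernel δ (p.1 - p.2)) := by
  unfold commKernel realKernel; ring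

lemma commKernel_nonneg {δ : ℝ} (hδ : 0 < δ) {p : ℝ × ℝ} (h1 : p.1 ∈ Ioo (-1 : ℝ) 1)
    (h2 : p.2 ∈ Ioo (-1 : ℝ) 1) : 0 ≤ commKernel δ p := by
  rw [commKernel_eq]
  exact mul_nonneg (mul_nonneg (cutoff_mem_Icc hδ h1).1 (cutoff_mem_Icc hδ h2).1)
    (mul_oddKernel_nonneg hδ _)

lemma commKernel_le {δ : ℝ} (hδ : 0 < δ) {p : ℝ × ℝ} (h1 : p.1 ∈ Ioo (-1 : ℝ) 1)
    (h2 : p.2 ∈ Ioo (-1 : ℝ) 1) : commKernel δ p ≤ (p.1 - p.2) * oddKernel δ (p.1 - p.2) := by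
  rw [commKernel_eq]
  have h := mul_oddKernel_nonneg hδ (p.1 - p.2)
  calc _ ≤ 1 * ((p.1 - p.2) * oddKernel δ (p.1 - p.2)) := by
        gcongr
        exact mul_le_one₀ (cutoff_mem_Icc hδ h1).2 (cutoff_mem_Icc hδ h2).1 (cutoff_mem_Icc hδ h2).2
    _ = _ := one_mul _

lemma commKernel_swap (δ : ℝ) (p : ℝ × ℝ) : commKernel δ p.swap = commKernel δ p := by
  unfold commKernel
  simp only [Prod.fst_swap, Prod.snd_swap]
  rw [realKernel_swap]; ring

/-- Take `z` at distance between `δ/2` and `δ` from `y`, on the side of the centre; `δ ≤ 1/2` keeps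
such `z` at distance `δ` from both walls. On this set of length `δ/2` the kernel is at least
`(1/2)(1/2)(1/32) = 1/128`. -/
lemma integral_commKernel_lower {δ y : ℝ} (hδ : 0 < δ) (hδ2 : δ ≤ 1 / 2) (hy : δ ≤ 1 - |y|) :
    δ / 256 ≤ ∫ z, commKernel δ (y, z) ∂channelMeasure := by
  have hyc : y ∈ Ioo (-1 : ℝ) 1 := abs_lt.1 (by linarith)
  obtain ⟨S, hSm, hSsub, hSvol, hS⟩ : ∃ S : Set ℝ, MeasurableSet S ∧ S ⊆ Ioo (-1 : ℝ) 1 ∧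
      volume S = ENNReal.ofReal (δ / 2) ∧
      ∀ z ∈ S, δ ≤ 1 - |z| ∧ δ / 2 ≤ |y - z| ∧ |y - z| ≤ δ := by
    rcases le_total 0 y with h0 | h0
    · rw [abs_of_nonneg h0] at hy
      have key : ∀ z ∈ Icc (y - δ) (y - δ / 2),
          δ ≤ 1 - |z| ∧ δ / 2 ≤ |y - z| ∧ |y - z| ≤ δ := fun z hz => by
        have h1 : |z| ≤ 1 - δ := abs_le.2 ⟨by linarith [hz.1], by linarith [hz.2]⟩
        rw [abs_of_nonneg (by linarith [hz.2] : (0 : ℝ) ≤ y - z)]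
        exact ⟨by linarith, by linarith [hz.2], by linarith [hz.1]⟩
      refine ⟨Icc (y - δ) (y - δ / 2), measurableSet_Icc, fun z hz => ?_, ?_, key⟩
      · exact abs_lt.1 (by linarith [(key z hz).1])
      · rw [Real.volume_Icc]; congr 1; ring
    · rw [abs_of_nonpos h0] at hy
      have key : ∀ z ∈ Icc (y + δ / 2) (y + δ),
          δ ≤ 1 - |z| ∧ δ / 2 ≤ |y - z| ∧ |y - z| ≤ δ := fun z hz => by
        have h1 : |z| ≤ 1 - δ := abs_le.2 ⟨by linarith [hz.1], by linarith [hz.2]⟩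
        rw [abs_of_nonpos (by linarith [hz.1] : y - z ≤ 0)]
        exact ⟨by linarith, by linarith [hz.1], by linarith [hz.2]⟩
      refine ⟨Icc (y + δ / 2) (y + δ), measurableSet_Icc, fun z hz => ?_, ?_, key⟩
      · exact abs_lt.1 (by linarith [(key z hz).1])
      · rw [Real.volume_Icc]; congr 1; ring
  have e : ∫ z, S.indicator (fun _ => (1 / 128 : ℝ)) z ∂channelMeasure = δ / 256 := by
    rw [integral_indicator_const _ hSm, channelMeasure, measureReal_restrict_apply hSm,
      inter_eq_left.2 hSsub, measureReal_def, hSvol, ENNReal.toReal_ofReal (by positivity),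
      smul_eq_mul]
    ring
  rw [← e]
  refine integral_mono_ae ((integrable_const _).indicator hSm) ?_ ?_
  · have hc : Continuous fun z => commKernel δ (y, z) :=
      (continuous_commKernel δ).comp (by fun_prop)
    exact integrable_channelMeasure.2 (hc.intervalIntegrable _ _)
  · refine ae_channelMeasure.2 (Filter.Eventually.of_forall fun z hz => ?_)
    by_cases hzS : z ∈ S
    · simp only [indicator_of_mem hzS]
      obtain ⟨h1, h2, h3⟩ := hS z hzS
      rw [commKernel_eq]
      have a1 := half_le_cutoff hδ hy
      have a2 := half_le_cutoff hδ h1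
      have a3 := mul_oddKernel_lower hδ h2 h3
      calc (1 : ℝ) / 128 = 1 / 2 * (1 / 2) * (1 / 32) := by norm_num
        _ ≤ _ := by gcongr
    · simp only [indicator_of_notMem hzS]
      exact commKernel_nonneg hδ (p := (y, z)) hyc hz

lemma exists_commKernel_bound (δ : ℝ) :
    ∃ C, ∀ᵐ p ∂(channelMeasure.prod channelMeasure), ‖commKernel δ p‖ ≤ C := by
  obtain ⟨C, hC⟩ := (isCompact_Icc (a := (-1 : ℝ)) (b := 1) |>.prod
    (isCompact_Icc (a := (-1 : ℝ)) (b := 1))).exists_bound_of_continuousOn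
    (continuous_commKernel δ).continuousOn
  refine ⟨C, ?_⟩
  filter_upwards [ae_prod_channel] with p hp
  exact hC p ⟨Ioo_subset_Icc_self hp.1, Ioo_subset_Icc_self hp.2⟩

lemma integrable_commKernel_mul (δ : ℝ) {g : ℝ × ℝ → ℝ}
    (hg : Integrable g (channelMeasure.prod channelMeasure)) :
    Integrable (fun p => commKernel δ p * g p) (channelMeasure.prod channelMeasure) := by
  obtain ⟨C, hC⟩ := exists_commKernel_bound δ
  exact hg.bdd_mul (c := C) (continuous_commKernel δ).aestronglyMeasurable hC

/-- The cutoffs only decrease the kernel, so `lintegral_diff_sq_le` applies. -/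
lemma integral_commKernel_diff_le {δ : ℝ} (hδ : 0 < δ) {f f' : ChannelL2} (h : IsH10 f f')
    (hi : Integrable (fun p : ℝ × ℝ => ‖f p.1 - f p.2‖ ^ 2) (channelMeasure.prod channelMeasure)) :
    ∫ p, commKernel δ p * ‖f p.1 - f p.2‖ ^ 2 ∂(channelMeasure.prod channelMeasure)
      ≤ δ ^ 3 * Real.pi * ‖f'‖ ^ 2 := by
  have hi' := integrable_commKernel_mul δ hi
  have h0 : 0 ≤ δ ^ 3 * Real.pi * ‖f'‖ ^ 2 := by positivity
  rw [← ENNReal.ofReal_le_ofReal_iff h0, ofReal_integral_eq_lintegral_ofReal hi', lintegral_prod]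
  · have h1 := lintegral_diff_sq_le hδ h
    rw [lintegral_enorm_sq_eq (Lp.memLp f'), ← ChannelL2.norm_sq_eq,
      ← ENNReal.ofReal_mul (by positivity)] at h1
    refine le_trans (lintegral_mono_ae ?_) h1
    rw [ae_channelMeasure]
    refine Filter.Eventually.of_forall fun y hy => lintegral_mono_ae ?_
    rw [ae_channelMeasure]
    refine Filter.Eventually.of_forall fun z hz => ?_
    simp only
    rw [← ofReal_norm, ← ENNReal.ofReal_pow (norm_nonneg _),
      ← ENNReal.ofReal_mul (mul_oddKernel_nonneg hδ _)]
    refine ENNReal.ofReal_le_ofReal (mul_le_mul_of_nonneg_right ?_ (sq_nonneg _))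
    exact commKernel_le hδ (p := (y, z)) hy hz
  · exact hi'.1.aemeasurable.ennreal_ofReal
  · filter_upwards [ae_prod_channel] with p hp
    exact mul_nonneg (commKernel_nonneg hδ hp.1 hp.2) (sq_nonneg _)

/-- Away from the walls the kernel has mass at least `δ/256`. In the layers `1 - |y| < δ` that bound
is unavailable, but there `‖f(y)‖² ≤ δ‖f'‖²`, and the layers have total measure at most `2δ`. -/
lemma integral_commKernel_diag_ge {δ : ℝ} (hδ : 0 < δ) (hδ2 : δ ≤ 1 / 2) {f f' : ChannelL2}
    (h : IsH10 f f') :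
    δ / 256 * (‖f‖ ^ 2 - 2 * δ * (δ * ‖f'‖ ^ 2))
      ≤ ∫ p, commKernel δ p * ‖f p.1‖ ^ 2 ∂(channelMeasure.prod channelMeasure) := by
  have hfi : Integrable (fun y => ‖f y‖ ^ 2) channelMeasure := (Lp.memLp f).norm.integrable_sq
  have hi := integrable_commKernel_mul δ (hfi.comp_fst channelMeasure)
  rw [integral_prod _ hi]
  have hL : Integrable (fun y => (if 1 - |y| < δ then δ * ‖f'‖ ^ 2 else 0 : ℝ)) channelMeasure := by
    refine Integrable.of_bound (C := δ * ‖f'‖ ^ 2) ?_ (Filter.Eventually.of_forall fun y => ?_)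
    · refine (Measurable.ite ?_ measurable_const measurable_const).aestronglyMeasurable
      exact measurableSet_lt (by fun_prop) (by fun_prop)
    · split_ifs
      · rw [Real.norm_of_nonneg (by positivity)]
      · rw [norm_zero]; positivity
  have hLv : ∫ y, (if 1 - |y| < δ then δ * ‖f'‖ ^ 2 else 0 : ℝ) ∂channelMeasure
      ≤ 2 * δ * (δ * ‖f'‖ ^ 2) := by
    set c := δ * ‖f'‖ ^ 2
    have hc : 0 ≤ c := by positivity
    set S := Ioc (-1 : ℝ) (-1 + δ) ∪ Ioc (1 - δ) 1
    have hS : MeasurableSet S := measurableSet_Ioc.union measurableSet_Ioc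
    have hSfin : volume S ≤ ENNReal.ofReal (2 * δ) := by
      refine (measure_union_le _ _).trans ?_
      rw [Real.volume_Ioc, Real.volume_Ioc, ← ENNReal.ofReal_add (by linarith) (by linarith)]
      apply ENNReal.ofReal_le_ofReal; linarith
    calc _ ≤ ∫ y, S.indicator (fun _ => c) y ∂channelMeasure := by
          refine integral_mono_ae hL ((integrable_const _).indicator hS) ?_
          refine ae_channelMeasure.2 (Filter.Eventually.of_forall fun y hy => ?_)
          simp only
          split_ifs with hyd
          · rw [indicator_of_mem]
            rcases le_total 0 y with h0 | h0
            · rw [abs_of_nonneg h0] at hyd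
              exact Or.inr ⟨by linarith, hy.2.le⟩
            · rw [abs_of_nonpos h0] at hyd
              exact Or.inl ⟨hy.1, by linarith⟩
          · exact indicator_nonneg (fun _ _ => hc) _
      _ = channelMeasure.real S * c := by rw [integral_indicator_const _ hS, smul_eq_mul]
      _ ≤ 2 * δ * c := by
          gcongr
          rw [measureReal_def]
          refine ENNReal.toReal_le_of_le_ofReal (by positivity) (le_trans ?_ hSfin)
          exact Measure.restrict_apply_le _ _
  have hkey : ∀ᵐ y ∂channelMeasure, δ / 256 * (‖f y‖ ^ 2
        - (if 1 - |y| < δ then δ * ‖f'‖ ^ 2 else 0))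
      ≤ ∫ z, commKernel δ (y, z) * ‖f y‖ ^ 2 ∂channelMeasure := by
    have h2 := h.norm_apply_le
    rw [← ChannelL2.norm_sq_eq] at h2
    filter_upwards [h2, ae_channelMeasure.2 (Filter.Eventually.of_forall fun y hy => hy)]
      with y hy hyc
    rw [integral_mul_const]
    -- Inside a layer the left side is nonpositive and the right side nonnegative.
    split_ifs with hyd
    · have h3 : 0 ≤ ∫ z, commKernel δ (y, z) ∂channelMeasure := by
        refine integral_nonneg_of_ae (ae_channelMeasure.2 (Filter.Eventually.of_forall fun z hz => ?_))
        exact commKernel_nonneg hδ (p := (y, z)) hyc hz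
      have h4 : ‖f y‖ ^ 2 ≤ δ * ‖f'‖ ^ 2 := hy.trans (by gcongr)
      have h5 : 0 ≤ (∫ z, commKernel δ (y, z) ∂channelMeasure) * ‖f y‖ ^ 2 := by positivity
      nlinarith
    · have h3 := integral_commKernel_lower hδ hδ2 (not_lt.1 hyd)
      rw [sub_zero]
      gcongr
  calc _ ≤ ∫ y, δ / 256 * (‖f y‖ ^ 2 - (if 1 - |y| < δ then δ * ‖f'‖ ^ 2 else 0))
        ∂channelMeasure := by
        rw [integral_const_mul, integral_sub hfi hL, ← ChannelL2.norm_sq_eq]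
        gcongr
    _ ≤ _ := integral_mono_ae ((hfi.sub hL).const_mul _) hi.integral_prod_left hkey

/-- The commutator of the multiplier with `y` is coercive up to a gradient term. -/
lemma im_inner_kernel_mulY_le {δ : ℝ} (hδ : 0 < δ) (hδ2 : δ ≤ 1 / 2) {f f' Pf : ChannelL2}
    (h : IsH10 f f') (hP : Pf =ᵐ[channelMeasure]
      fun y => ∫ z, Complex.I * (realKernel δ y z : ℂ) * f z ∂channelMeasure) :
    (inner ℂ Pf (mulYL2 f)).im ≤ -(δ / 512) * ‖f‖ ^ 2 + δ ^ 3 * ‖f'‖ ^ 2 := by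
  set ν := channelMeasure.prod channelMeasure with hν
  have hK : Continuous (Function.uncurry fun y z => Complex.I * (realKernel δ y z : ℂ)) := by
    have := continuous_realKernel δ
    exact continuous_const.mul (Complex.continuous_ofReal.comp this)
  set G : ℝ × ℝ → ℝ := fun p => (f p.1 * (starRingEnd ℂ) (f p.2)).re with hG
  have hGi : Integrable G ν := by
    have := (((Lp.memLp f).integrable (by norm_num)).mul_prod
      (((Lp.memLp f).star).integrable (by norm_num : (1 : ℝ≥0∞) ≤ 2)))
    exact this.re
  have hfi : Integrable (fun y => ‖f y‖ ^ 2) channelMeasure := (Lp.memLp f).norm.integrable_sq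
  have hf1 : Integrable (fun p : ℝ × ℝ => ‖f p.1‖ ^ 2) ν := hfi.comp_fst channelMeasure
  have hf2 : Integrable (fun p : ℝ × ℝ => ‖f p.2‖ ^ 2) ν := hfi.comp_snd channelMeasure
  have hpolar : ∀ a b : ℂ, ‖a - b‖ ^ 2 = ‖a‖ ^ 2 + ‖b‖ ^ 2 - 2 * (a * (starRingEnd ℂ) b).re := by
    intro a b
    rw [← Complex.normSq_eq_norm_sq, ← Complex.normSq_eq_norm_sq, ← Complex.normSq_eq_norm_sq,
      Complex.normSq_sub]
  have hdi : Integrable (fun p : ℝ × ℝ => ‖f p.1 - f p.2‖ ^ 2) ν := by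
    refine ((hf1.add hf2).sub (hGi.const_mul 2)).congr (Filter.Eventually.of_forall fun p => ?_)
    simp only [Pi.add_apply, Pi.sub_apply, hpolar, hG]
  set X := ∫ p, realKernel δ p.1 p.2 * (p.1 * G p) ∂ν with hX
  have hai : ∀ {g : ℝ × ℝ → ℝ}, Integrable g ν →
      Integrable (fun p => realKernel δ p.1 p.2 * g p) ν := by
    intro g hg
    obtain ⟨C, hC⟩ := exists_bound_channel hK
    refine hg.bdd_mul (c := C) (continuous_realKernel δ).aestronglyMeasurable ?_
    filter_upwards [ae_prod_channel] with p hp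
    simpa using hC p.1 (Ioo_subset_Icc_self hp.1) p.2 (Ioo_subset_Icc_self hp.2)
  have hbd : ∀ {g φ : ℝ × ℝ → ℝ}, Continuous φ → (∀ p : ℝ × ℝ, p.1 ∈ Ioo (-1 : ℝ) 1 →
      p.2 ∈ Ioo (-1 : ℝ) 1 → |φ p| ≤ 1) → Integrable g ν → Integrable (fun p => φ p * g p) ν := by
    intro g φ hφ hb hg
    refine hg.bdd_mul (c := 1) hφ.aestronglyMeasurable ?_
    filter_upwards [ae_prod_channel] with p hp
    exact hb p hp.1 hp.2
  have hi1 := hai (hbd continuous_fst (fun p h _ => abs_le.2 ⟨h.1.le, h.2.le⟩) hGi)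
  have hi2 := hai (hbd continuous_snd (fun p _ h => abs_le.2 ⟨h.1.le, h.2.le⟩) hGi)
  have him : (inner ℂ Pf (mulYL2 f)).im = -X := by
    rw [inner_kernelOperator hK hP, hX, ← integral_neg]
    have hint : Integrable (fun p : ℝ × ℝ => (starRingEnd ℂ) (Complex.I * (realKernel δ p.1 p.2 : ℂ)) *
        (mulYL2 f p.1 * (starRingEnd ℂ) (f p.2))) ν :=
      integrable_kernel_mul_mul (K := fun y z => (starRingEnd ℂ) (Complex.I * (realKernel δ y z : ℂ)))
        (Complex.continuous_conj.comp hK) (Lp.memLp f).star (Lp.memLp _)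
    have : ∀ {φ : ℝ × ℝ → ℂ}, Integrable φ ν → (∫ p, φ p ∂ν).im = ∫ p, (φ p).im ∂ν := fun hφ =>
      (Complex.imCLM.integral_comp_comm hφ).symm
    rw [this hint]
    refine integral_congr_ae ?_
    have hY : ∀ᵐ p ∂ν, mulYL2 f p.1 = (p.1 : ℂ) * f p.1 :=
      Measure.quasiMeasurePreserving_fst.ae (coeFn_mulYL2 f)
    filter_upwards [hY] with p hp
    rw [hp, map_mul, Complex.conj_I, Complex.conj_ofReal, hG]
    have : -Complex.I * (realKernel δ p.1 p.2 : ℂ) * ((p.1 : ℂ) * f p.1 * (starRingEnd ℂ) (f p.2))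
        = -Complex.I * (((realKernel δ p.1 p.2 * p.1 : ℝ) : ℂ) * (f p.1 * (starRingEnd ℂ) (f p.2))) := by
      push_cast; ring
    rw [this, neg_mul, Complex.neg_im, Complex.I_mul_im, Complex.re_ofReal_mul]
    ring
  -- Exchanging `y` and `z` reverses the kernel and preserves `G`; averaging the two expressions
  -- produces the factor `y - z` of the commutator.
  have hswap : X = - ∫ p, realKernel δ p.1 p.2 * (p.2 * G p) ∂ν := by
    rw [hX, ← integral_neg, ← integral_prod_swap]
    refine integral_congr_ae (Filter.Eventually.of_forall fun p => ?_)
    simp only [Prod.fst_swap, Prod.snd_swap, hG]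
    rw [realKernel_swap, ← Complex.conj_re]
    simp only [map_mul, Complex.conj_conj]
    rw [mul_comm (f p.1)]
    ring
  have h2X : 2 * X = ∫ p, commKernel δ p * G p ∂ν := by
    have : ∫ p, commKernel δ p * G p ∂ν = X - ∫ p, realKernel δ p.1 p.2 * (p.2 * G p) ∂ν := by
      rw [hX, ← integral_sub hi1 hi2]
      refine integral_congr_ae (Filter.Eventually.of_forall fun p => ?_)
      simp only [commKernel]; ring
    rw [this]; linarith
  have hsym : ∫ p, commKernel δ p * ‖f p.2‖ ^ 2 ∂ν = ∫ p, commKernel δ p * ‖f p.1‖ ^ 2 ∂ν := by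
    rw [← integral_prod_swap]
    refine integral_congr_ae (Filter.Eventually.of_forall fun p => ?_)
    simp only [Prod.snd_swap, commKernel_swap]
  -- Polarization: the real part of `f(y)` times the conjugate of `f(z)` is the symmetrized diagonal
  -- term minus half of `‖f(y) - f(z)‖²`.
  have hdecomp : ∫ p, commKernel δ p * G p ∂ν = ∫ p, commKernel δ p * ‖f p.1‖ ^ 2 ∂ν
      - 1 / 2 * ∫ p, commKernel δ p * ‖f p.1 - f p.2‖ ^ 2 ∂ν := by
    have e : ∀ p : ℝ × ℝ, commKernel δ p * G p = 1 / 2 * (commKernel δ p * ‖f p.1‖ ^ 2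
        + commKernel δ p * ‖f p.2‖ ^ 2 - commKernel δ p * ‖f p.1 - f p.2‖ ^ 2) := fun p => by
      rw [hpolar]; simp only [hG]; ring
    simp_rw [e]
    have j1 := integrable_commKernel_mul δ hf1
    have j2 := integrable_commKernel_mul δ hf2
    have j3 := integrable_commKernel_mul δ hdi
    have s1 := integral_sub (j1.add j2) j3
    have s2 := integral_add j1 j2
    simp only [Pi.add_apply] at s1
    rw [integral_const_mul, s1, s2, hsym]
    ring
  have hA := integral_commKernel_diff_le hδ h hdi
  have hB := integral_commKernel_diag_ge hδ hδ2 h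
  -- The gradient coefficient is at most `1/256 + 3.15/4 < 1`.
  have hpi := Real.pi_lt_d2
  have hN : 0 ≤ δ ^ 3 * ‖f'‖ ^ 2 := by positivity
  have hA' : δ ^ 3 * Real.pi * ‖f'‖ ^ 2 ≤ 3.15 * (δ ^ 3 * ‖f'‖ ^ 2) := by nlinarith
  rw [him]
  rw [hdecomp] at h2X
  have hB' : δ / 256 * (‖f‖ ^ 2 - 2 * δ * (δ * ‖f'‖ ^ 2))
    = δ / 256 * ‖f‖ ^ 2 - 1 / 128 * (δ ^ 3 * ‖f'‖ ^ 2) := by ring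
  rw [hB'] at hB
  linarith

/-- A bounded symmetric multiplier with coercive commutator with `y`. -/
lemma exists_shear_multiplier {δ : ℝ} (hδ : 0 < δ) (hδ2 : δ ≤ 1 / 2) :
    ∃ P D : ChannelL2 →L[ℂ] ChannelL2, (∀ f g, inner ℂ (P f) g = inner ℂ f (P g)) ∧
      (∀ f, ‖P f‖ ≤ 4 * ‖f‖) ∧ (∀ f, ‖D f‖ ≤ 36 * δ⁻¹ * ‖f‖) ∧ (∀ f, IsH10 (P f) (D f)) ∧
      ∀ f f' : ChannelL2, IsH10 f f' →
        (inner ℂ (P f) (mulYL2 f)).im ≤ -(δ / 512) * ‖f‖ ^ 2 + δ ^ 3 * ‖f'‖ ^ 2 := by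
  set K : ℝ → ℝ → ℂ := fun y z => Complex.I * (realKernel δ y z : ℂ) with hKdef
  set K' : ℝ → ℝ → ℂ := fun y z => Complex.I * (realKernelDeriv δ y z : ℂ) with hK'def
  have hK : Continuous (Function.uncurry K) :=
    continuous_const.mul (Complex.continuous_ofReal.comp (continuous_realKernel δ))
  have hK' : Continuous (Function.uncurry K') :=
    continuous_const.mul (Complex.continuous_ofReal.comp (continuous_realKernelDeriv δ))
  obtain ⟨P, hP, hPn⟩ := exists_kernelOperator hK hδ zero_le_one (fun y hy z hz => by
    simpa [K] using abs_realKernel_le hδ hy hz)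
  obtain ⟨D, hD, hDn⟩ := exists_kernelOperator hK' (M := 9 * δ⁻¹) hδ (by positivity)
    (fun y hy z hz => by simpa [K'] using abs_realKernelDeriv_le hδ hy hz)
  -- The Schur bounds `π` and `9π/δ` are rounded up to `4` and `36/δ`.
  have hpi := Real.pi_le_four
  refine ⟨P, D, fun f g => ?_, fun f => ?_, fun f => ?_, fun f => ?_, fun f f' h => ?_⟩
  · rw [inner_kernelOperator hK (hP f), ← inner_conj_symm, inner_kernelOperator hK (hP g),
      ← integral_conj, ← integral_prod_swap]
    refine integral_congr_ae (Filter.Eventually.of_forall fun p => ?_)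
    simp only [Prod.fst_swap, Prod.snd_swap, hKdef, map_mul, Complex.conj_conj, Complex.conj_I,
      Complex.conj_ofReal, realKernel_swap δ p.1 p.2]
    push_cast; simp only [map_neg, Complex.conj_I]; ring
  · refine (hPn f).trans ?_
    rw [one_mul]; gcongr
  · refine (hDn f).trans ?_
    have h0 : 0 < δ⁻¹ := inv_pos.2 hδ
    calc _ ≤ 9 * δ⁻¹ * 4 * ‖f‖ := by gcongr
      _ = _ := by ring
  · refine (isH10_kernel_integral (K := K) hK' (fun y z => ?_) (fun z => ?_) (fun z => ?_)
      (Lp.memLp f) ((memLp_congr_ae (hD f)).1 (Lp.memLp _))).congr_ae (hP f).symm (hD f).symm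
    · exact (hasDerivAt_realKernel δ y z).ofReal_comp.const_mul Complex.I
    · simp [K, (realKernel_boundary δ z).1]
    · simp [K, (realKernel_boundary δ z).2]
  · exact im_inner_kernel_mulY_le hδ hδ2 h (hP f)

/-! ### The energy form and the choice of multiplier -/

/-- The right-hand side of the weak formulation at a fixed time, for the solution `(f, f')`, the
forcing `(g₁, g₂)` and the conjugate of the test function `(w, w')`. -/
def temperatureForm (μ : ℝ) (k : ℤ) (f f' g₁ g₂ w w' : ChannelL2) : ℂ :=
  -(μ : ℂ) * (inner ℂ w' f' + (k : ℂ) ^ 2 * inner ℂ w f) - Complex.I * (k : ℂ) * inner ℂ w (mulYL2 f)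
    - Complex.I * (k : ℂ) * inner ℂ w g₁ + inner ℂ w' g₂

lemma re_temperatureForm (μ : ℝ) (k : ℤ) (f f' g₁ g₂ w w' : ChannelL2) :
    (temperatureForm μ k f f' g₁ g₂ w w').re =
      -μ * ((inner ℂ w' f').re + (k : ℝ) ^ 2 * (inner ℂ w f).re)
        + k * (inner ℂ w (mulYL2 f)).im + k * (inner ℂ w g₁).im + (inner ℂ w' g₂).re := by
  have hk : (k : ℂ) = ((k : ℝ) : ℂ) := by simp
  unfold temperatureForm
  rw [hk, ← Complex.ofReal_pow]
  simp only [Complex.add_re, Complex.sub_re, Complex.mul_re, Complex.mul_im, Complex.neg_re,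
    Complex.neg_im, Complex.ofReal_re, Complex.ofReal_im, Complex.I_re, Complex.I_im,
    Complex.add_im]
  ring

lemma re_temperatureForm_self_le (μ : ℝ) (k : ℤ) (f f' g₁ g₂ : ChannelL2) :
    (temperatureForm μ k f f' g₁ g₂ f f').re ≤ -μ * ‖f'‖ ^ 2 - μ * (k : ℝ) ^ 2 * ‖f‖ ^ 2
      + |(k : ℝ)| * ‖f‖ * ‖g₁‖ + ‖f'‖ * ‖g₂‖ := by
  rw [re_temperatureForm, im_inner_mulYL2_self]
  have h1 : (inner ℂ f' f').re = ‖f'‖ ^ 2 := inner_self_eq_norm_sq (𝕜 := ℂ) f'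
  have h2 : (inner ℂ f f).re = ‖f‖ ^ 2 := inner_self_eq_norm_sq (𝕜 := ℂ) f
  have h3 : (k : ℝ) * (inner ℂ f g₁).im ≤ |(k : ℝ)| * ‖f‖ * ‖g₁‖ := by
    refine (le_abs_self _).trans ?_
    rw [abs_mul, mul_assoc]
    gcongr
    exact (Complex.abs_im_le_norm _).trans (norm_inner_le_norm _ _)
  have h4 : (inner ℂ f' g₂).re ≤ ‖f'‖ * ‖g₂‖ :=
    (Complex.re_le_norm _).trans (norm_inner_le_norm _ _)
  rw [h1, h2]
  linarith

/-- In terms of `κ = |k|` and `δ`, with `μ = κδ³`, the fractional powers become rational: `κδ` is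
the decay rate and `κ/δ` the weight of `g¹`. -/
lemma shear_scales {κ δ : ℝ} (hκ : 0 < κ) (hδ : 0 < δ) :
    (κ * δ ^ 3 * κ ^ 2) ^ (1 / 3 : ℝ) = κ * δ ∧
      (κ * δ ^ 3) ^ (-(1 / 3) : ℝ) * κ ^ (4 / 3 : ℝ) = κ / δ := by
  have h3 : ∀ x : ℝ, 0 < x → (x ^ 3) ^ (1 / 3 : ℝ) = x := fun x hx => by
    rw [← Real.rpow_natCast, ← Real.rpow_mul hx.le]; norm_num
  constructor
  · have : κ * δ ^ 3 * κ ^ 2 = (κ * δ) ^ 3 := by ring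
    rw [this, h3 _ (by positivity)]
  · rw [Real.rpow_neg (by positivity), Real.mul_rpow hκ.le (by positivity), h3 δ hδ, mul_inv,
      ← Real.rpow_neg hκ.le]
    have : κ ^ (-(1 / 3) : ℝ) * κ ^ (4 / 3 : ℝ) = κ := by
      rw [← Real.rpow_add hκ]; norm_num
    calc _ = (κ ^ (-(1 / 3) : ℝ) * κ ^ (4 / 3 : ℝ)) * δ⁻¹ := by ring
      _ = _ := by rw [this]; rfl

/-- The scalar inequality closing the energy estimate with the shear multiplier. -/
lemma quadratic_estimate_shear (a b G H : ℝ) :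
    2 * (-b ^ 2 + 36 * 10⁻¹ ^ 7 * a * b - 10⁻¹ ^ 7 / 512 * a ^ 2 + 10⁻¹ ^ 7 * b ^ 2
      + 2 * a * G + (b + 36 * 10⁻¹ ^ 7 * a) * H) + 10⁻¹ ^ 7 / 1024 * a ^ 2
      ≤ 10 ^ 12 * (G ^ 2 + H ^ 2) := by
  norm_num
  -- With weight `10⁻⁷/1024` the first square absorbs the `ab` term at a cost of `36²·1024·10⁻⁷ <
  -- 0.14` of `b²`, which is why `10⁻⁷` is small enough. The `aG` term costs `2¹³·10⁷ G²`, well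
  -- below `10¹² G²`.
  nlinarith [sq_nonneg (a - 36 * 1024 * b), sq_nonneg (a - 2 ^ 12 * 10 ^ 7 * G),
    sq_nonneg (a - 36 * 2 ^ 12 * H), sq_nonneg (b - 2 * H), sq_nonneg a, sq_nonneg b,
    sq_nonneg G, sq_nonneg H]

/-- The counterpart without multiplier; the term `a²/4` comes from `μk²‖f‖²` when `δ > 1/2`. The
constants match those of the shear case so that both share one `η` and one `C`. -/
lemma quadratic_estimate_energy (a b G H : ℝ) :
    2 * (-b ^ 2 - 1 / 4 * a ^ 2 + a * G + b * H) + 10⁻¹ ^ 7 / 1024 * a ^ 2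
      ≤ 10 ^ 12 * (G ^ 2 + H ^ 2) := by
  norm_num
  nlinarith [sq_nonneg (a - 8 * G), sq_nonneg (b - H), sq_nonneg a, sq_nonneg b,
    sq_nonneg G, sq_nonneg H]

set_option maxHeartbeats 1000000 in
/-- Bounded symmetric perturbation of the identity whose energy identity gives enhanced
dissipation, with constants independent of `μ` and `k`. -/
lemma exists_multiplier : ∃ η C : ℝ, 0 < η ∧ 0 < C ∧ ∀ (μ : ℝ), 0 < μ → ∀ k : ℤ,
    ∃ P D : ChannelL2 →L[ℂ] ChannelL2, (∀ f g, inner ℂ (P f) g = inner ℂ f (P g)) ∧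
      (∀ f, ‖P f‖ ≤ 1 / 2 * ‖f‖) ∧ (∀ f, IsH10 (P f) (D f)) ∧
      ∀ f f' : ChannelL2, IsH10 f f' → ∀ g₁ g₂ : ChannelL2,
        2 * (temperatureForm μ k f f' g₁ g₂ (f + P f) (f' + D f)).re
            + η * (μ * (k : ℝ) ^ 2) ^ (1 / 3 : ℝ) * ‖f‖ ^ 2 ≤
          C * (μ ^ (-(1 / 3) : ℝ) * |(k : ℝ)| ^ (4 / 3 : ℝ) * ‖g₁‖ ^ 2 + μ⁻¹ * ‖g₂‖ ^ 2) := by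
  refine ⟨10⁻¹ ^ 7 / 1024, 10 ^ 12, by norm_num, by norm_num, fun μ hμ k => ?_⟩
  by_cases hk : k = 0
  -- Without shear the claimed rate and the weight of `g₁` both vanish, and viscosity alone handles
  -- `g₂`.
  · subst hk
    refine ⟨0, 0, by simp, by simp, fun f => by simpa using IsH10.zero_L2, fun f f' _ g₁ g₂ => ?_⟩
    have h := re_temperatureForm_self_le μ 0 f f' g₁ g₂
    simp only [zero_apply, add_zero, Int.cast_zero]
    simp only [Int.cast_zero] at h
    rw [abs_zero] at h ⊢
    rw [Real.zero_rpow (by norm_num), zero_pow two_ne_zero, mul_zero, Real.zero_rpow (by norm_num)]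
    have h2 : 2 * (‖f'‖ * ‖g₂‖) ≤ μ * ‖f'‖ ^ 2 + μ⁻¹ * ‖g₂‖ ^ 2 := by
      have : 0 ≤ μ⁻¹ * (μ * ‖f'‖ - ‖g₂‖) ^ 2 := by positivity
      have e : μ⁻¹ * (μ * ‖f'‖ - ‖g₂‖) ^ 2 =
          (μ⁻¹ * μ) * (μ * ‖f'‖ ^ 2 - 2 * (‖f'‖ * ‖g₂‖)) + μ⁻¹ * ‖g₂‖ ^ 2 := by ring
      rw [e, inv_mul_cancel₀ hμ.ne'] at this
      linarith
    have h3 : 0 ≤ μ⁻¹ * ‖g₂‖ ^ 2 := by positivity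
    have h4 : 0 ≤ μ * ‖f'‖ ^ 2 := by positivity
    nlinarith
  · have hκ1 : (1 : ℝ) ≤ |(k : ℝ)| := by exact_mod_cast Int.one_le_abs hk
    obtain ⟨κ, hκ⟩ : ∃ κ : ℝ, κ = |(k : ℝ)| := ⟨_, rfl⟩
    rw [← hκ] at hκ1
    have hκ0 : 0 < κ := by linarith
    have hksq : (k : ℝ) ^ 2 = κ ^ 2 := by rw [hκ, sq_abs]
    -- The scale at which the diffusion rate `μ/δ²` equals the shear rate `κδ`.
    obtain ⟨δ, hδ, hμδ⟩ : ∃ δ : ℝ, 0 < δ ∧ μ = κ * δ ^ 3 := by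
      refine ⟨(μ / κ) ^ (1 / 3 : ℝ), by positivity, ?_⟩
      rw [← Real.rpow_natCast, ← Real.rpow_mul (by positivity)]
      norm_num
      field_simp
    obtain ⟨hr, hK⟩ := shear_scales hκ0 hδ
    rw [← hμδ] at hr hK
    -- With `a = ‖f‖`, `b = δ‖f'‖`, `G = ‖g₁‖/δ` and `H = ‖g₂‖/(κδ²)`, the whole estimate is `κδ`
    -- times a scale-free quadratic inequality.
    have hconv : ∀ G H : ℝ, κ / δ * G ^ 2 + μ⁻¹ * H ^ 2
        = κ * δ * ((G / δ) ^ 2 + (H / (κ * δ ^ 2)) ^ 2) := fun G H => by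
      rw [hμδ]; field_simp
    by_cases hδ2 : δ ≤ 1 / 2
    · obtain ⟨P, D, hsym, hP, hD, hH, hcomm⟩ := exists_shear_multiplier hδ hδ2
      -- The sign of `k`, chosen so that `k` times the commutator term is always damping.
      obtain ⟨σ, hσ, hσk⟩ : ∃ σ : ℝ, |σ| = 1 ∧ σ * k = κ := by
        rcases le_total 0 (k : ℝ) with h | h
        · exact ⟨1, by simp, by rw [hκ, abs_of_nonneg h, one_mul]⟩
        · exact ⟨-1, by simp, by rw [hκ, abs_of_nonpos h]; ring⟩
      set γ : ℝ := 10⁻¹ ^ 7 * σ with hγ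
      have hγa : |γ| = 10⁻¹ ^ 7 := by rw [hγ, abs_mul, hσ, mul_one, abs_of_pos (by positivity)]
      have hγn : ‖(γ : ℂ)‖ = 10⁻¹ ^ 7 := by rw [Complex.norm_real, Real.norm_eq_abs, hγa]
      refine ⟨(γ : ℂ) • P, (γ : ℂ) • D, fun f g => ?_, fun f => ?_, fun f => (hH f).smul_L2 _,
        fun f f' hf g₁ g₂ => ?_⟩
      · simp only [smul_apply, inner_smul_left, inner_smul_right,
          Complex.conj_ofReal, hsym]
      · simp only [smul_apply, norm_smul, hγn]
        have := hP f
        nlinarith [norm_nonneg f]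
      · simp only [smul_apply]
        have hself := re_temperatureForm_self_le μ k f f' g₁ g₂
        have e : (temperatureForm μ k f f' g₁ g₂ (f + (γ : ℂ) • P f) (f' + (γ : ℂ) • D f)).re
            = (temperatureForm μ k f f' g₁ g₂ f f').re
              + γ * (-μ * ((inner ℂ (D f) f').re + (k : ℝ) ^ 2 * (inner ℂ (P f) f).re)
                + k * (inner ℂ (P f) (mulYL2 f)).im + k * (inner ℂ (P f) g₁).im
                + (inner ℂ (D f) g₂).re) := by
          simp only [re_temperatureForm, inner_add_left, inner_smul_left, Complex.conj_ofReal,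
            Complex.add_re, Complex.add_im, Complex.re_ofReal_mul, Complex.im_ofReal_mul]
          ring
        have absb : ∀ x B : ℝ, |x| ≤ B → γ * x ≤ 10⁻¹ ^ 7 * B := fun x B hx => by
          refine (le_abs_self _).trans ?_
          rw [abs_mul, hγa]; gcongr
        have nre : ∀ u v : ChannelL2, |(inner ℂ u v).re| ≤ ‖u‖ * ‖v‖ := fun u v =>
          (Complex.abs_re_le_norm _).trans (norm_inner_le_norm _ _)
        have nim : ∀ u v : ChannelL2, |(inner ℂ u v).im| ≤ ‖u‖ * ‖v‖ := fun u v =>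
          (Complex.abs_im_le_norm _).trans (norm_inner_le_norm _ _)
        have t1 : γ * (-μ * (inner ℂ (D f) f').re) ≤ 10⁻¹ ^ 7 * (μ * (36 * δ⁻¹ * ‖f‖ * ‖f'‖)) := by
          refine absb _ _ ?_
          rw [abs_mul, abs_neg, abs_of_pos hμ]
          gcongr
          exact (nre _ _).trans (by gcongr; exact hD f)
        have t2 : γ * (-μ * ((k : ℝ) ^ 2 * (inner ℂ (P f) f).re))
            ≤ 10⁻¹ ^ 7 * (μ * (κ ^ 2 * (4 * ‖f‖ * ‖f‖))) := by
          refine absb _ _ ?_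
          rw [abs_mul, abs_neg, abs_of_pos hμ, abs_mul, abs_of_nonneg (sq_nonneg _), hksq]
          gcongr
          exact (nre _ _).trans (by gcongr; exact hP f)
        -- The only multiplier term whose sign is exploited; all others are bounded in absolute
        -- value.
        have t3 : γ * (k * (inner ℂ (P f) (mulYL2 f)).im)
            ≤ 10⁻¹ ^ 7 * κ * (-(δ / 512) * ‖f‖ ^ 2 + δ ^ 3 * ‖f'‖ ^ 2) := by
          have : γ * (k * (inner ℂ (P f) (mulYL2 f)).im)
              = 10⁻¹ ^ 7 * κ * (inner ℂ (P f) (mulYL2 f)).im := by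
            rw [hγ, ← hσk]; ring
          rw [this]
          exact mul_le_mul_of_nonneg_left (hcomm f f' hf) (by positivity)
        have t4 : γ * (k * (inner ℂ (P f) g₁).im) ≤ 10⁻¹ ^ 7 * (κ * (4 * ‖f‖ * ‖g₁‖)) := by
          refine absb _ _ ?_
          rw [abs_mul, ← hκ]
          gcongr
          exact (nim _ _).trans (by gcongr; exact hP f)
        have t5 : γ * (inner ℂ (D f) g₂).re ≤ 10⁻¹ ^ 7 * (36 * δ⁻¹ * ‖f‖ * ‖g₂‖) := by
          refine absb _ _ ((nre _ _).trans (by gcongr; exact hD f))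
        have hq := quadratic_estimate_shear ‖f‖ (δ * ‖f'‖) (‖g₁‖ / δ) (‖g₂‖ / (κ * δ ^ 2))
        have hq' := mul_le_mul_of_nonneg_left hq (mul_pos hκ0 hδ).le
        rw [e, hksq, hr, ← hκ, hK, hconv]
        rw [← hκ, hksq] at hself
        have s1 : 10⁻¹ ^ 7 * (μ * (36 * δ⁻¹ * ‖f‖ * ‖f'‖))
            = κ * δ * (36 * 10⁻¹ ^ 7 * ‖f‖ * (δ * ‖f'‖)) := by
          rw [hμδ]; field_simp
        have s2 : -μ * ‖f'‖ ^ 2 = κ * δ * (-(δ * ‖f'‖) ^ 2) := by rw [hμδ]; ring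
        have s3 : 10⁻¹ ^ 7 * κ * (-(δ / 512) * ‖f‖ ^ 2 + δ ^ 3 * ‖f'‖ ^ 2)
            = κ * δ * (-(10⁻¹ ^ 7 / 512 * ‖f‖ ^ 2) + 10⁻¹ ^ 7 * (δ * ‖f'‖) ^ 2) := by ring
        have s4 : κ * ‖f‖ * ‖g₁‖ = κ * δ * (‖f‖ * (‖g₁‖ / δ)) := by field_simp
        have s5 : ‖f'‖ * ‖g₂‖ = κ * δ * ((δ * ‖f'‖) * (‖g₂‖ / (κ * δ ^ 2))) := by field_simp
        have s6 : 10⁻¹ ^ 7 * (36 * δ⁻¹ * ‖f‖ * ‖g₂‖)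
            = κ * δ * (36 * 10⁻¹ ^ 7 * ‖f‖ * (‖g₂‖ / (κ * δ ^ 2))) := by field_simp
        -- Since `4·10⁻⁷ ≤ 1`, the multiplier at most doubles the `g₁` term, whence `2aG` in the
        -- scalar inequality.
        have s7 : 10⁻¹ ^ 7 * (κ * (4 * ‖f‖ * ‖g₁‖)) ≤ κ * δ * (‖f‖ * (‖g₁‖ / δ)) := by
          rw [← s4]
          have : 0 ≤ κ * ‖f‖ * ‖g₁‖ := by positivity
          have e : 10⁻¹ ^ 7 * (κ * (4 * ‖f‖ * ‖g₁‖)) = 4 * 10⁻¹ ^ 7 * (κ * ‖f‖ * ‖g₁‖) := by ring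
          rw [e]
          exact mul_le_of_le_one_left this (by norm_num)
        -- The zeroth-order viscous error is absorbed by the available term `-μκ²‖f‖²`.
        have s8 : 10⁻¹ ^ 7 * (μ * (κ ^ 2 * (4 * ‖f‖ * ‖f‖))) ≤ μ * κ ^ 2 * ‖f‖ ^ 2 := by
          have : 0 ≤ μ * κ ^ 2 * ‖f‖ ^ 2 := by positivity
          have e : 10⁻¹ ^ 7 * (μ * (κ ^ 2 * (4 * ‖f‖ * ‖f‖)))
            = 4 * 10⁻¹ ^ 7 * (μ * κ ^ 2 * ‖f‖ ^ 2) := by ring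
          rw [e]
          exact mul_le_of_le_one_left this (by norm_num)
        rw [s1] at t1; rw [s3] at t3; rw [s6] at t5
        rw [s2, s4, s5] at hself
        rw [hksq] at t2
        linarith
    · refine ⟨0, 0, by simp, by simp, fun f => by simpa using IsH10.zero_L2,
        fun f f' _ g₁ g₂ => ?_⟩
      simp only [zero_apply, add_zero]
      have hself := re_temperatureForm_self_le μ k f f' g₁ g₂
      have hq := quadratic_estimate_energy ‖f‖ (δ * ‖f'‖) (‖g₁‖ / δ) (‖g₂‖ / (κ * δ ^ 2))
      have hq' := mul_le_mul_of_nonneg_left hq (mul_pos hκ0 hδ).le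
      rw [hksq, hr, ← hκ, hK, hconv]
      rw [← hκ, hksq] at hself
      have s2 : -μ * ‖f'‖ ^ 2 = κ * δ * (-(δ * ‖f'‖) ^ 2) := by rw [hμδ]; ring
      have s4 : κ * ‖f‖ * ‖g₁‖ = κ * δ * (‖f‖ * (‖g₁‖ / δ)) := by field_simp
      have s5 : ‖f'‖ * ‖g₂‖ = κ * δ * ((δ * ‖f'‖) * (‖g₂‖ / (κ * δ ^ 2))) := by field_simp
      -- Here `κ ≥ 1` and `δ > 1/2` give `κδ ≥ 1/2`, so `μκ² = κδ(κδ)² ≥ κδ/4`: ordinary viscous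
      -- damping is already as strong as the enhanced rate.
      have s8 : κ * δ * (1 / 4 * ‖f‖ ^ 2) ≤ μ * κ ^ 2 * ‖f‖ ^ 2 := by
        have h1 : 1 / 2 ≤ κ * δ := by nlinarith
        have h2 : κ * δ * (1 / 4) ≤ μ * κ ^ 2 := by
          rw [hμδ]
          have : κ * δ ^ 3 * κ ^ 2 = κ * δ * (κ * δ) ^ 2 := by ring
          rw [this]
          gcongr
          nlinarith
        nlinarith [sq_nonneg ‖f‖]
      rw [s2, s4, s5] at hself
      linarith

/-! ### Differentiating quadratic forms of coefficients -/

lemma intervalIntegrable_conj {f : ℝ → ℂ} {a b : ℝ} (hf : IntervalIntegrable f volume a b) :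
    IntervalIntegrable (fun s => (starRingEnd ℂ) (f s)) volume a b :=
  ⟨(Complex.conjCLE : ℂ →L[ℝ] ℂ).integrable_comp hf.1,
    (Complex.conjCLE : ℂ →L[ℝ] ℂ).integrable_comp hf.2⟩

/-- Quadratic forms of primitives: the derivative of `∑ q_{nm} \bar a_n a_m`. -/
lemma quadratic_form_primitive {T : ℝ} {a F : ℕ → ℝ → ℂ} {α : ℕ → ℂ} {q : ℕ → ℕ → ℂ}
    (hq : ∀ n m, (starRingEnd ℂ) (q n m) = q m n)
    (hF : ∀ n, Integrable (F n) (volume.restrict (Ioo 0 T)))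
    (ha : ∀ n, ∀ᵐ t ∂(volume.restrict (Ioo 0 T)), a n t = α n + ∫ s in (0 : ℝ)..t, F n s) (N : ℕ) :
    ∀ᵐ t ∂(volume.restrict (Ioo 0 T)),
      (∑ n ∈ Finset.range N, ∑ m ∈ Finset.range N,
        q n m * ((starRingEnd ℂ) (a n t) * a m t)).re =
      (∑ n ∈ Finset.range N, ∑ m ∈ Finset.range N,
        q n m * ((starRingEnd ℂ) (α n) * α m)).re +
      ∫ s in (0 : ℝ)..t, 2 * (∑ n ∈ Finset.range N, ∑ m ∈ Finset.range N,
        q n m * ((starRingEnd ℂ) (F n s) * a m s)).re := by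
  have hFi : ∀ n, ∀ t ∈ Ioo 0 T, IntervalIntegrable (F n) volume 0 t := fun n t ht => by
    rw [intervalIntegrable_iff_integrableOn_Ioo_of_le ht.1.le]
    exact IntegrableOn.mono_set (hF n) (Ioo_subset_Ioo_right ht.2.le)
  have hFc : ∀ n, ∀ t ∈ Ioo 0 T,
      IntervalIntegrable (fun s => (starRingEnd ℂ) (F n s)) volume 0 t := fun n t ht =>
    intervalIntegrable_conj (hFi n t ht)
  have hconj : ∀ n t, (starRingEnd ℂ) (∫ s in (0 : ℝ)..t, F n s)
      = ∫ s in (0 : ℝ)..t, (starRingEnd ℂ) (F n s) := fun n t => by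
    rw [intervalIntegral.intervalIntegral_eq_integral_uIoc,
      intervalIntegral.intervalIntegral_eq_integral_uIoc, integral_conj]
    split_ifs <;> simp
  have haall := ae_all_iff.2 ha
  have haI : ∀ᵐ s, s ∈ Ioo 0 T → ∀ n, a n s = α n + ∫ r in (0 : ℝ)..s, F n r :=
    (ae_restrict_iff' measurableSet_Ioo).1 haall
  have hae : ∀ t ∈ Ioo 0 T, ∀ᵐ s, s ∈ uIoc 0 t → ∀ n, a n s = α n + ∫ r in (0 : ℝ)..s, F n r := by
    intro t ht
    filter_upwards [haI] with s hs hmem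
    rw [uIoc_of_le ht.1.le] at hmem
    exact hs ⟨hmem.1, hmem.2.trans_lt ht.2⟩
  have hFa : ∀ n m, ∀ t ∈ Ioo 0 T,
      IntervalIntegrable (fun s => (starRingEnd ℂ) (F n s) * a m s) volume 0 t := by
    intro n m t ht
    have h1 : IntervalIntegrable (fun s => (starRingEnd ℂ) (F n s) *
        (α m + ∫ r in (0 : ℝ)..s, F m r)) volume 0 t := by
      refine (hFc n t ht).mul_continuousOn (continuousOn_const.add ?_)
      exact intervalIntegral.continuousOn_primitive_interval' (hFi m t ht) left_mem_uIcc
    refine h1.congr_ae ?_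
    rw [Filter.EventuallyEq, ae_restrict_iff' measurableSet_uIoc]
    filter_upwards [hae t ht] with s hs hmem
    rw [hs hmem m]
  -- The product rule is applied to the primitives, and the `a n` are substituted back almost
  -- everywhere. The second integral is written as the conjugate of the first with `n` and `m`
  -- exchanged.
  have hprod : ∀ n m, ∀ t ∈ Ioo 0 T, (∀ n, a n t = α n + ∫ s in (0 : ℝ)..t, F n s) →
      (starRingEnd ℂ) (a n t) * a m t = (starRingEnd ℂ) (α n) * α m +
        ((∫ s in (0 : ℝ)..t, (starRingEnd ℂ) (F n s) * a m s)
          + (starRingEnd ℂ) (∫ s in (0 : ℝ)..t, (starRingEnd ℂ) (F m s) * a n s)) := by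
    intro n m t ht hat
    have h := intervalIntegral_mul_primitive (hFc n t ht) (hFi m t ht)
      ((starRingEnd ℂ) (α n)) (α m)
    have e2 : (starRingEnd ℂ) (∫ s in (0 : ℝ)..t, (starRingEnd ℂ) (F m s) * a n s)
        = ∫ s in (0 : ℝ)..t, (starRingEnd ℂ) (a n s) * F m s := by
      rw [intervalIntegral.integral_of_le ht.1.le, intervalIntegral.integral_of_le ht.1.le,
        ← integral_conj]
      refine integral_congr_ae (Filter.Eventually.of_forall fun s => ?_)
      simp only [map_mul, Complex.conj_conj]; ring
    have hi2 : IntervalIntegrable (fun s => (starRingEnd ℂ) (a n s) * F m s) volume 0 t := by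
      have := hFa m n t ht
      refine IntervalIntegrable.congr (f := fun s => (starRingEnd ℂ) ((starRingEnd ℂ) (F m s) * a n s))
        (fun s _ => ?_) (intervalIntegrable_conj this)
      simp only [map_mul, Complex.conj_conj]; ring
    rw [e2, ← intervalIntegral.integral_add (hFa n m t ht) hi2, hat n, hat m, map_add, hconj, h]
    congr 1
    refine intervalIntegral.integral_congr_ae ?_
    filter_upwards [hae t ht] with s hs hmem
    rw [hs hmem n, hs hmem m, map_add, hconj]
  filter_upwards [haall, ae_restrict_mem measurableSet_Ioo] with t hat ht
  have hsumi : IntervalIntegrable (fun s => ∑ n ∈ Finset.range N, ∑ m ∈ Finset.range N,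
      q n m * ((starRingEnd ℂ) (F n s) * a m s)) volume 0 t := by
    have := IntervalIntegrable.sum (μ := volume) (a := 0) (b := t) (Finset.range N)
      (f := fun n s => ∑ m ∈ Finset.range N, q n m * ((starRingEnd ℂ) (F n s) * a m s))
      (fun n _ => by
        have := IntervalIntegrable.sum (μ := volume) (a := 0) (b := t) (Finset.range N)
          (f := fun m s => q n m * ((starRingEnd ℂ) (F n s) * a m s))
          (fun m _ => (hFa n m t ht).const_mul _)
        simpa [Finset.sum_fn] using this)
    simpa [Finset.sum_fn] using this
  set X : ℂ := ∑ n ∈ Finset.range N, ∑ m ∈ Finset.range N,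
      q n m * ∫ s in (0 : ℝ)..t, (starRingEnd ℂ) (F n s) * a m s with hX
  have hXint : ∫ s in (0 : ℝ)..t, ∑ n ∈ Finset.range N, ∑ m ∈ Finset.range N,
      q n m * ((starRingEnd ℂ) (F n s) * a m s) = X := by
    rw [intervalIntegral.integral_finsetSum]
    · refine Finset.sum_congr rfl fun n _ => ?_
      rw [intervalIntegral.integral_finsetSum]
      · exact Finset.sum_congr rfl fun m _ => intervalIntegral.integral_const_mul _ _
      · exact fun m _ => (hFa n m t ht).const_mul _
    · intro n _
      have := IntervalIntegrable.sum (μ := volume) (a := 0) (b := t) (Finset.range N)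
          (f := fun m s => q n m * ((starRingEnd ℂ) (F n s) * a m s))
          (fun m _ => (hFa n m t ht).const_mul _)
      simpa [Finset.sum_fn] using this
  have hre : ∫ s in (0 : ℝ)..t, 2 * (∑ n ∈ Finset.range N, ∑ m ∈ Finset.range N,
        q n m * ((starRingEnd ℂ) (F n s) * a m s)).re = 2 * X.re := by
    rw [intervalIntegral.integral_const_mul, ← hXint]
    congr 1
    exact Complex.reCLM.intervalIntegral_comp_comm hsumi
  -- Hermitian symmetry of `q` makes this half the conjugate of the other, so the real part is
  -- doubled.
  have hY : ∑ n ∈ Finset.range N, ∑ m ∈ Finset.range N, q n m *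
      (starRingEnd ℂ) (∫ s in (0 : ℝ)..t, (starRingEnd ℂ) (F m s) * a n s)
      = (starRingEnd ℂ) X := by
    rw [hX, Finset.sum_comm, map_sum]
    refine Finset.sum_congr rfl fun n _ => ?_
    rw [map_sum]
    refine Finset.sum_congr rfl fun m _ => ?_
    rw [map_mul, hq]
  have hfin : ∑ n ∈ Finset.range N, ∑ m ∈ Finset.range N,
        q n m * ((starRingEnd ℂ) (a n t) * a m t) =
      (∑ n ∈ Finset.range N, ∑ m ∈ Finset.range N,
        q n m * ((starRingEnd ℂ) (α n) * α m)) + (X + (starRingEnd ℂ) X) := by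
    rw [← hY, hX, ← Finset.sum_add_distrib, ← Finset.sum_add_distrib]
    refine Finset.sum_congr rfl fun n _ => ?_
    rw [← Finset.sum_add_distrib, ← Finset.sum_add_distrib]
    refine Finset.sum_congr rfl fun m _ => ?_
    rw [hprod n m t ht hat]; ring
  rw [hre, hfin, Complex.add_re, Complex.add_re, Complex.conj_re]; ring

/-! ### Time slices of space-time functions -/

open Classical in
/-- The time slice `h(t) ∈ L²(-1,1)` (zero where `h(t)` is not square integrable). -/
def timeSlice (h : ℝ → ℝ → ℂ) (t : ℝ) : ChannelL2 :=
  if hm : MemLp (h t) 2 channelMeasure then hm.toLp _ else 0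

lemma coeFn_timeSlice {h : ℝ → ℝ → ℂ} {t : ℝ} (hm : MemLp (h t) 2 channelMeasure) :
    timeSlice h t =ᵐ[channelMeasure] h t := by
  rw [timeSlice, dif_pos hm]; exact hm.coeFn_toLp

section TimeSlice

variable {τ : Measure ℝ} {h : ℝ → ℝ → ℂ}

lemma integrable_norm_sq_uncurry (hh : MemLp (Function.uncurry h) 2 (τ.prod channelMeasure)) :
    Integrable (fun p : ℝ × ℝ => ‖h p.1 p.2‖ ^ 2) (τ.prod channelMeasure) :=
  hh.norm.integrable_sq

lemma ae_memLp_slice [SFinite τ] (hh : MemLp (Function.uncurry h) 2 (τ.prod channelMeasure)) :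
    ∀ᵐ t ∂τ, MemLp (h t) 2 channelMeasure := by
  filter_upwards [hh.1.prodMk_left, (integrable_norm_sq_uncurry hh).prod_right_ae] with t h1 h2
  exact (memLp_two_iff_integrable_sq_norm h1).2 h2

lemma norm_timeSlice_sq {t : ℝ} (hm : MemLp (h t) 2 channelMeasure) :
    ‖timeSlice h t‖ ^ 2 = ∫ y, ‖h t y‖ ^ 2 ∂channelMeasure := by
  rw [ChannelL2.norm_sq_eq]
  refine integral_congr_ae ?_
  filter_upwards [coeFn_timeSlice hm] with y hy
  rw [hy]

/-- Only scalar functions of time are needed: the norm is measurable as the square root of a fibre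
integral, so no measurability of the `L²`-valued map is required. -/
lemma memLp_norm_timeSlice [SFinite τ] (hh : MemLp (Function.uncurry h) 2 (τ.prod channelMeasure)) :
    MemLp (fun t => ‖timeSlice h t‖) 2 τ := by
  have hi := (integrable_norm_sq_uncurry hh).integral_prod_left
  have hc : (fun t => ∫ y, ‖h t y‖ ^ 2 ∂channelMeasure) =ᵐ[τ] fun t => ‖timeSlice h t‖ ^ 2 := by
    filter_upwards [ae_memLp_slice hh] with t ht
    rw [norm_timeSlice_sq ht]
  have hi' := hi.congr hc
  have hm : AEStronglyMeasurable (fun t => ‖timeSlice h t‖) τ := by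
    have := Real.continuous_sqrt.comp_aestronglyMeasurable hi'.1
    simpa [Real.sqrt_sq (norm_nonneg _)] using this
  exact (memLp_two_iff_integrable_sq hm).2 hi'

lemma inner_timeSlice {e : ℝ → ℂ} (he : MemLp e 2 channelMeasure) {t : ℝ}
    (hm : MemLp (h t) 2 channelMeasure) :
    inner ℂ (he.toLp e) (timeSlice h t) = ∫ y, (starRingEnd ℂ) (e y) * h t y ∂channelMeasure := by
  rw [timeSlice, dif_pos hm, ChannelL2.inner_toLp]

lemma memLp_inner_timeSlice [SFinite τ] (hh : MemLp (Function.uncurry h) 2 (τ.prod channelMeasure))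
    (e : ChannelL2) : MemLp (fun t => inner ℂ e (timeSlice h t)) 2 τ := by
  have hm : AEStronglyMeasurable (fun t => inner ℂ e (timeSlice h t)) τ := by
    have h1 : AEStronglyMeasurable (fun p : ℝ × ℝ => (starRingEnd ℂ) (e p.2) * h p.1 p.2)
        (τ.prod channelMeasure) :=
      (Complex.continuous_conj.comp_aestronglyMeasurable (Lp.memLp e).1.comp_snd).mul hh.1
    refine h1.integral_prod_right'.congr ?_
    filter_upwards [ae_memLp_slice hh] with t ht
    rw [← inner_timeSlice (Lp.memLp e) ht, Lp.toLp_coeFn]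
  refine MemLp.of_le_mul (c := ‖e‖) (memLp_norm_timeSlice hh) hm
    (Filter.Eventually.of_forall fun t => ?_)
  rw [norm_norm]
  exact norm_inner_le_norm _ _

end TimeSlice

/-! ### The Galerkin argument -/

lemma temperatureForm_add (μ : ℝ) (k : ℤ) (f f' g₁ g₂ w w' v v' : ChannelL2) :
    temperatureForm μ k f f' g₁ g₂ (w + v) (w' + v') =
      temperatureForm μ k f f' g₁ g₂ w w' + temperatureForm μ k f f' g₁ g₂ v v' := by
  simp only [temperatureForm, inner_add_left]; ring

lemma temperatureForm_smul (μ : ℝ) (k : ℤ) (f f' g₁ g₂ w w' : ChannelL2) (c : ℂ) :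
    temperatureForm μ k f f' g₁ g₂ (c • w) (c • w') =
      (starRingEnd ℂ) c * temperatureForm μ k f f' g₁ g₂ w w' := by
  simp only [temperatureForm, inner_smul_left]; ring

lemma temperatureForm_sum (μ : ℝ) (k : ℤ) (f f' g₁ g₂ : ChannelL2) (w w' : ℕ → ChannelL2)
    (c : ℕ → ℂ) (N : ℕ) :
    temperatureForm μ k f f' g₁ g₂ (∑ n ∈ Finset.range N, c n • w n)
        (∑ n ∈ Finset.range N, c n • w' n) =
      ∑ n ∈ Finset.range N, (starRingEnd ℂ) (c n) * temperatureForm μ k f f' g₁ g₂ (w n) (w' n) := by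
  induction N with
  | zero => simp [temperatureForm]
  | succ N ih =>
    rw [Finset.sum_range_succ, Finset.sum_range_succ, Finset.sum_range_succ, temperatureForm_add,
      temperatureForm_smul, ih]

/-- A deliberately crude bound; with projected test functions it yields a dominating function
quadratic in the slice norms, independent of `N`. -/
lemma norm_temperatureForm_le (μ : ℝ) (k : ℤ) (f f' g₁ g₂ w w' : ChannelL2) :
    ‖temperatureForm μ k f f' g₁ g₂ w w'‖ ≤
      (|μ| * (1 + (k : ℝ) ^ 2) + |(k : ℝ)| + 1) * (‖f‖ + ‖f'‖ + ‖g₁‖ + ‖g₂‖) * (‖w‖ + ‖w'‖) := by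
  have hk : ‖(k : ℂ)‖ = |(k : ℝ)| := by
    rw [← Complex.ofReal_intCast, Complex.norm_real, Real.norm_eq_abs]
  have h1 : ‖temperatureForm μ k f f' g₁ g₂ w w'‖ ≤ |μ| * (‖w'‖ * ‖f'‖ + (k : ℝ) ^ 2 * (‖w‖ * ‖f‖))
      + |(k : ℝ)| * (‖w‖ * ‖f‖) + |(k : ℝ)| * (‖w‖ * ‖g₁‖) + ‖w'‖ * ‖g₂‖ := by
    unfold temperatureForm
    refine (norm_add_le _ _).trans (add_le_add ((norm_sub_le _ _).trans (add_le_add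
      ((norm_sub_le _ _).trans (add_le_add ?_ ?_)) ?_)) (norm_inner_le_norm _ _))
    · rw [norm_mul, norm_neg, Complex.norm_real, Real.norm_eq_abs]
      gcongr
      refine (norm_add_le _ _).trans (add_le_add (norm_inner_le_norm _ _) ?_)
      rw [norm_mul, norm_pow, hk, sq_abs]
      gcongr
      exact norm_inner_le_norm _ _
    · rw [norm_mul, norm_mul, Complex.norm_I, one_mul, hk]
      gcongr
      exact (norm_inner_le_norm _ _).trans (by gcongr; exact norm_mulYL2_le f)
    · rw [norm_mul, norm_mul, Complex.norm_I, one_mul, hk]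
      gcongr
      exact norm_inner_le_norm _ _
  refine h1.trans ?_
  have e : (|μ| * (1 + (k : ℝ) ^ 2) + |(k : ℝ)| + 1) * (‖f‖ + ‖f'‖ + ‖g₁‖ + ‖g₂‖) * (‖w‖ + ‖w'‖)
      - (|μ| * (‖w'‖ * ‖f'‖ + (k : ℝ) ^ 2 * (‖w‖ * ‖f‖))
      + |(k : ℝ)| * (‖w‖ * ‖f‖) + |(k : ℝ)| * (‖w‖ * ‖g₁‖) + ‖w'‖ * ‖g₂‖)
      = |μ| * ((‖f‖ + ‖g₁‖ + ‖g₂‖) * (‖w‖ + ‖w'‖) + ‖f'‖ * ‖w‖)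
        + |μ| * (k : ℝ) ^ 2 * ((‖f'‖ + ‖g₁‖ + ‖g₂‖) * (‖w‖ + ‖w'‖) + ‖f‖ * ‖w'‖)
        + |(k : ℝ)| * ((‖f'‖ + ‖g₂‖) * (‖w‖ + ‖w'‖) + (‖f‖ + ‖g₁‖) * ‖w'‖)
        + ((‖f‖ + ‖f'‖ + ‖g₁‖) * (‖w‖ + ‖w'‖) + ‖g₂‖ * ‖w‖) := by ring
  rw [← sub_nonneg, e]
  positivity

lemma continuous_temperatureForm (μ : ℝ) (k : ℤ) (f f' g₁ g₂ : ChannelL2) :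
    Continuous fun w : ChannelL2 × ChannelL2 => temperatureForm μ k f f' g₁ g₂ w.1 w.2 := by
  unfold temperatureForm
  fun_prop

/-- The spatial integral in the weak formulation, in terms of `L²` inner products. -/
lemma integral_weak_eq_temperatureForm (μ : ℝ) (k : ℤ) {f f' g₁ g₂ v v' : ℝ → ℂ}
    {F F' G₁ G₂ : ChannelL2} (hf : F =ᵐ[channelMeasure] f) (hf' : F' =ᵐ[channelMeasure] f')
    (hg₁ : G₁ =ᵐ[channelMeasure] g₁) (hg₂ : G₂ =ᵐ[channelMeasure] g₂)
    (hv : MemLp v 2 channelMeasure) (hv' : MemLp v' 2 channelMeasure)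
    (hvr : ∀ y, (starRingEnd ℂ) (v y) = v y) (hvr' : ∀ y, (starRingEnd ℂ) (v' y) = v' y) :
    ∫ y, (-(μ : ℂ) * (f' y * v' y + (k : ℂ) ^ 2 * (f y * v y))
              - Complex.I * (k : ℂ) * (y : ℂ) * (f y * v y)
              - Complex.I * (k : ℂ) * (g₁ y * v y)
              + g₂ y * v' y) ∂channelMeasure
      = temperatureForm μ k F F' G₁ G₂ (hv.toLp v) (hv'.toLp v') := by
  have hin : ∀ {u : ℝ → ℂ} (hu : MemLp u 2 channelMeasure), (∀ y, (starRingEnd ℂ) (u y) = u y) →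
      ∀ {H : ChannelL2} {h : ℝ → ℂ}, H =ᵐ[channelMeasure] h →
        inner ℂ (hu.toLp u) H = ∫ y, h y * u y ∂channelMeasure ∧
        Integrable (fun y => h y * u y) channelMeasure := by
    intro u hu hur H h hH
    constructor
    · rw [ChannelL2.inner_eq]
      refine integral_congr_ae ?_
      filter_upwards [hH, hu.coeFn_toLp] with y h1 h2
      rw [h1, h2, hur, mul_comm]
    · exact ((memLp_congr_ae hH).1 (Lp.memLp H)).integrable_mul hu
  have hY : mulYL2 F =ᵐ[channelMeasure] fun y : ℝ => (y : ℂ) * f y := by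
    filter_upwards [coeFn_mulYL2 F, hf] with y h1 h2
    rw [h1, h2]
  obtain ⟨e1, i1⟩ := hin hv' hvr' hf'
  obtain ⟨e2, i2⟩ := hin hv hvr hf
  obtain ⟨e3, i3⟩ := hin hv hvr hY
  obtain ⟨e4, i4⟩ := hin hv hvr hg₁
  obtain ⟨e5, i5⟩ := hin hv' hvr' hg₂
  rw [temperatureForm, e1, e2, e3, e4, e5, ← integral_const_mul, ← integral_add i1 (i2.const_mul _),
    ← integral_const_mul, ← integral_const_mul, ← integral_const_mul,
    ← integral_sub, ← integral_sub, ← integral_add]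
  · refine integral_congr_ae (Filter.Eventually.of_forall fun y => ?_)
    simp only; ring
  · exact (((i1.add (i2.const_mul _)).const_mul _).sub (i3.const_mul _)).sub (i4.const_mul _)
  · exact i5
  · exact ((i1.add (i2.const_mul _)).const_mul _).sub (i3.const_mul _)
  · exact i4.const_mul _
  · exact (i1.add (i2.const_mul _)).const_mul _
  · exact i3.const_mul _

lemma sum_quadratic_modes (P : ChannelL2 →L[ℂ] ChannelL2) (f : ChannelL2) (N : ℕ) :
    ∑ n ∈ Finset.range N, ∑ m ∈ Finset.range N, inner ℂ (sinL2 n) (sinL2 m + P (sinL2 m)) *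
        ((starRingEnd ℂ) (inner ℂ (sinL2 n) f) * inner ℂ (sinL2 m) f)
      = inner ℂ (modeProj sinL2 N f) (modeProj sinL2 N f + P (modeProj sinL2 N f)) := by
  simp only [modeProj_apply, map_sum, map_smul, ← Finset.sum_add_distrib, ← smul_add]
  rw [sum_inner]
  refine Finset.sum_congr rfl fun n _ => ?_
  rw [inner_sum]
  refine Finset.sum_congr rfl fun m _ => ?_
  rw [inner_smul_left, inner_smul_right]; ring

/-- The derivative of the Galerkin energy is the weak form tested with a projection of `S_N f + P
S_N f`; the outer projection is present because the equation has only been tested with sine modes.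
By `IsH10.inner_cosL2`, the derivative of this test function is the corresponding cosine projection.
The coefficient sum is the conjugate of the form, so only real parts are compared. -/
lemma sum_form_modes {μ : ℝ} {k : ℤ} {f f' g₁ g₂ : ChannelL2} (hf : IsH10 f f')
    {P D : ChannelL2 →L[ℂ] ChannelL2} (hPD : ∀ f, IsH10 (P f) (D f)) (N : ℕ) :
    (∑ n ∈ Finset.range N, ∑ m ∈ Finset.range N, inner ℂ (sinL2 n) (sinL2 m + P (sinL2 m)) *
        ((starRingEnd ℂ) (temperatureForm μ k f f' g₁ g₂ (sinL2 n) ((modeFreq n : ℂ) • cosL2 n))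
          * inner ℂ (sinL2 m) f)).re
      = (temperatureForm μ k f f' g₁ g₂
          (modeProj sinL2 N (modeProj sinL2 N f + P (modeProj sinL2 N f)))
          (modeProj cosL2 N (modeProj cosL2 N f' + D (modeProj sinL2 N f)))).re := by
  have hw := (hf.modeProj N).add_L2 (hPD (modeProj sinL2 N f))
  set w := modeProj sinL2 N f + P (modeProj sinL2 N f) with hwdef
  set w' := modeProj cosL2 N f' + D (modeProj sinL2 N f)
  have hb : ∀ n, ∑ m ∈ Finset.range N, inner ℂ (sinL2 n) (sinL2 m + P (sinL2 m))
      * inner ℂ (sinL2 m) f = inner ℂ (sinL2 n) w := by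
    intro n
    rw [hwdef]
    simp only [modeProj_apply, map_sum, map_smul, ← Finset.sum_add_distrib, ← smul_add]
    rw [inner_sum]
    refine Finset.sum_congr rfl fun m _ => ?_
    rw [inner_smul_right]; ring
  rw [modeProj_apply, modeProj_apply]
  have hc : ∀ n, inner ℂ (cosL2 n) w' • cosL2 n
      = inner ℂ (sinL2 n) w • ((modeFreq n : ℂ) • cosL2 n) := fun n => by
    rw [hw.inner_cosL2, mul_comm, mul_smul]
  simp_rw [hc]
  rw [temperatureForm_sum, ← Complex.conj_re, map_sum]
  congr 1
  refine Finset.sum_congr rfl fun n _ => ?_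
  rw [← hb n]
  simp only [map_sum, map_mul, Complex.conj_conj, Finset.sum_mul]
  exact Finset.sum_congr rfl fun m _ => by ring

lemma IsH10.timeSlice {θ θy : ℝ → ℝ → ℂ} {t : ℝ} (h : IsH10 (θ t) (θy t)) :
    IsH10 (timeSlice θ t) (timeSlice θy t) :=
  h.congr_ae (coeFn_timeSlice h.memLp).symm (coeFn_timeSlice h.memLp_deriv).symm

section Galerkin

variable {τ : Measure ℝ} [SFinite τ] {θ θy g₁ g₂ : ℝ → ℝ → ℂ}

/-- The weak-formulation functional at time `s`. -/
def timeForm (μ : ℝ) (k : ℤ) (θ θy g₁ g₂ : ℝ → ℝ → ℂ) (w w' : ChannelL2) (s : ℝ) : ℂ :=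
  temperatureForm μ k (timeSlice θ s) (timeSlice θy s) (timeSlice g₁ s) (timeSlice g₂ s) w w'

lemma memLp_timeForm (μ : ℝ) (k : ℤ)
    (hθ : MemLp (Function.uncurry θ) 2 (τ.prod channelMeasure))
    (hθy : MemLp (Function.uncurry θy) 2 (τ.prod channelMeasure))
    (hg₁ : MemLp (Function.uncurry g₁) 2 (τ.prod channelMeasure))
    (hg₂ : MemLp (Function.uncurry g₂) 2 (τ.prod channelMeasure)) (w w' : ChannelL2) :
    MemLp (timeForm μ k θ θy g₁ g₂ w w') 2 τ := by
  unfold timeForm temperatureForm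
  -- Moving `y` onto the fixed test function reduces every term to the pairing of a slice with a
  -- constant vector.
  simp only [← inner_mulYL2_comm]
  exact ((((memLp_inner_timeSlice hθy w').add ((memLp_inner_timeSlice hθ w).const_mul _)).const_mul
    _).sub ((memLp_inner_timeSlice hθ _).const_mul _)).sub
    ((memLp_inner_timeSlice hg₁ w).const_mul _) |>.add (memLp_inner_timeSlice hg₂ w')

/-- The equation for the sine coefficients of a solution. -/
lemma sine_coefficient_eq {μ : ℝ} {k : ℤ} {θin : ℝ → ℂ} {T : ℝ}
    (hθ : MemLp (Function.uncurry θ) 2 ((volume.restrict (Ioo 0 T)).prod channelMeasure))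
    (hθy : MemLp (Function.uncurry θy) 2 ((volume.restrict (Ioo 0 T)).prod channelMeasure))
    (hg₁ : MemLp (Function.uncurry g₁) 2 ((volume.restrict (Ioo 0 T)).prod channelMeasure))
    (hg₂ : MemLp (Function.uncurry g₂) 2 ((volume.restrict (Ioo 0 T)).prod channelMeasure))
    (hin : MemLp θin 2 channelMeasure) {v v' : ℝ → ℂ}
    (hv : MemLp v 2 channelMeasure) (hv' : MemLp v' 2 channelMeasure)
    (hvr : ∀ y, (starRingEnd ℂ) (v y) = v y) (hvr' : ∀ y, (starRingEnd ℂ) (v' y) = v' y)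
    (hweak : ∀ᵐ t ∂timeMeasure, ∫ y, θ t y * v y ∂channelMeasure =
        (∫ y, θin y * v y ∂channelMeasure) +
          ∫ s in (0 : ℝ)..t, ∫ y,
            (-(μ : ℂ) * (θy s y * v' y + (k : ℂ) ^ 2 * (θ s y * v y))
              - Complex.I * (k : ℂ) * (y : ℂ) * (θ s y * v y)
              - Complex.I * (k : ℂ) * (g₁ s y * v y)
              + g₂ s y * v' y) ∂channelMeasure) :
    ∀ᵐ t ∂(volume.restrict (Ioo 0 T)), inner ℂ (hv.toLp v) (timeSlice θ t) =
      inner ℂ (hv.toLp v) (hin.toLp θin)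
        + ∫ s in (0 : ℝ)..t, timeForm μ k θ θy g₁ g₂ (hv.toLp v) (hv'.toLp v') s := by
  have hsub : volume.restrict (Ioo 0 T) ≤ timeMeasure :=
    Measure.restrict_mono Ioo_subset_Ioi_self le_rfl
  have hform : ∀ᵐ s ∂(volume.restrict (Ioo 0 T)), ∫ y,
            (-(μ : ℂ) * (θy s y * v' y + (k : ℂ) ^ 2 * (θ s y * v y))
              - Complex.I * (k : ℂ) * (y : ℂ) * (θ s y * v y)
              - Complex.I * (k : ℂ) * (g₁ s y * v y)
              + g₂ s y * v' y) ∂channelMeasure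
      = timeForm μ k θ θy g₁ g₂ (hv.toLp v) (hv'.toLp v') s := by
    filter_upwards [ae_memLp_slice hθ, ae_memLp_slice hθy, ae_memLp_slice hg₁, ae_memLp_slice hg₂]
      with s h1 h2 h3 h4
    exact integral_weak_eq_temperatureForm μ k (coeFn_timeSlice h1) (coeFn_timeSlice h2)
      (coeFn_timeSlice h3) (coeFn_timeSlice h4) hv hv' hvr hvr'
  rw [ae_restrict_iff' measurableSet_Ioo] at hform
  filter_upwards [ae_mono hsub hweak, ae_memLp_slice hθ, ae_restrict_mem measurableSet_Ioo]
    with t ht h1 htT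
  have e1 : inner ℂ (hv.toLp v) (timeSlice θ t) = ∫ y, θ t y * v y ∂channelMeasure := by
    rw [inner_timeSlice hv h1]
    simp_rw [hvr, mul_comm]
  have e2 : inner ℂ (hv.toLp v) (hin.toLp θin) = ∫ y, θin y * v y ∂channelMeasure := by
    rw [ChannelL2.inner_toLp]
    simp_rw [hvr, mul_comm]
  rw [e1, e2, ht]
  congr 1
  refine intervalIntegral.integral_congr_ae ?_
  filter_upwards [hform] with s hs hmem
  rw [uIoc_of_le htT.1.le] at hmem
  exact hs ⟨hmem.1, hmem.2.trans_lt htT.2⟩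

end Galerkin

lemma smul_cosL2_eq_toLp (n : ℕ) : ((modeFreq n : ℂ) • cosL2 n : ChannelL2) =
    ((memLp_cosMode n).const_mul (modeFreq n : ℂ)).toLp _ := by
  rw [cosL2, ← MemLp.toLp_const_smul]
  exact MemLp.toLp_congr _ _ (Filter.Eventually.of_forall fun y => rfl)

/-- The modified energy is equivalent to the `L²` energy with constants independent of `μ` and `k`.
-/
lemma re_inner_add_bounds {P : ChannelL2 →L[ℂ] ChannelL2} (hP : ∀ f, ‖P f‖ ≤ 1 / 2 * ‖f‖)
    (f : ChannelL2) : 1 / 2 * ‖f‖ ^ 2 ≤ (inner ℂ f (f + P f)).re ∧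
      (inner ℂ f (f + P f)).re ≤ 3 / 2 * ‖f‖ ^ 2 := by
  have h1 : (inner ℂ f f).re = ‖f‖ ^ 2 := inner_self_eq_norm_sq (𝕜 := ℂ) f
  have h2 : |(inner ℂ f (P f)).re| ≤ 1 / 2 * ‖f‖ ^ 2 := by
    refine (Complex.abs_re_le_norm _).trans ((norm_inner_le_norm _ _).trans ?_)
    nlinarith [hP f, norm_nonneg f]
  rw [inner_add_right, Complex.add_re, h1]
  constructor <;> linarith [abs_le.1 h2]

variable {θ θy g₁ g₂ : ℝ → ℝ → ℂ}

/-- Energy inequality for `⟨θ, (1 + P)θ⟩`. -/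
lemma multiplier_energy_inequality {μ : ℝ} {k : ℤ} {θin : ℝ → ℂ} {T : ℝ}
    (hθ : MemLp (Function.uncurry θ) 2 ((volume.restrict (Ioo 0 T)).prod channelMeasure))
    (hθy : MemLp (Function.uncurry θy) 2 ((volume.restrict (Ioo 0 T)).prod channelMeasure))
    (hg₁ : MemLp (Function.uncurry g₁) 2 ((volume.restrict (Ioo 0 T)).prod channelMeasure))
    (hg₂ : MemLp (Function.uncurry g₂) 2 ((volume.restrict (Ioo 0 T)).prod channelMeasure))
    (hin : MemLp θin 2 channelMeasure)
    (hH : ∀ᵐ t ∂timeMeasure, IsH10 (θ t) (θy t))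
    (hweak : ∀ v v' : ℝ → ℂ, IsH10 v v' →
      ∀ᵐ t ∂timeMeasure, ∫ y, θ t y * v y ∂channelMeasure =
        (∫ y, θin y * v y ∂channelMeasure) +
          ∫ s in (0 : ℝ)..t, ∫ y,
            (-(μ : ℂ) * (θy s y * v' y + (k : ℂ) ^ 2 * (θ s y * v y))
              - Complex.I * (k : ℂ) * (y : ℂ) * (θ s y * v y)
              - Complex.I * (k : ℂ) * (g₁ s y * v y)
              + g₂ s y * v' y) ∂channelMeasure)
    {P D : ChannelL2 →L[ℂ] ChannelL2} (hsym : ∀ f g, inner ℂ (P f) g = inner ℂ f (P g))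
    (hP : ∀ f, ‖P f‖ ≤ 1 / 2 * ‖f‖) (hPD : ∀ f, IsH10 (P f) (D f)) :
    IntegrableOn (fun s => 2 * (timeForm μ k θ θy g₁ g₂ (timeSlice θ s + P (timeSlice θ s))
        (timeSlice θy s + D (timeSlice θ s)) s).re) (Ioo 0 T) ∧
    ∀ᵐ t ∂(volume.restrict (Ioo 0 T)), 1 / 2 * ‖timeSlice θ t‖ ^ 2 ≤
      3 / 2 * ‖hin.toLp θin‖ ^ 2 + ∫ s in (0 : ℝ)..t,
        2 * (timeForm μ k θ θy g₁ g₂ (timeSlice θ s + P (timeSlice θ s))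
          (timeSlice θy s + D (timeSlice θ s)) s).re := by
  set τ := volume.restrict (Ioo 0 T) with hτ
  have hsub : τ ≤ timeMeasure := Measure.restrict_mono Ioo_subset_Ioi_self le_rfl
  have hHτ : ∀ᵐ t ∂τ, IsH10 (timeSlice θ t) (timeSlice θy t) :=
    (hH.filter_mono (ae_mono hsub)).mono fun t ht => ht.timeSlice
  -- the Galerkin identity
  set S := modeProj sinL2 with hS
  set Cc := modeProj cosL2 with hCc
  set R := fun s => 2 * (timeForm μ k θ θy g₁ g₂ (timeSlice θ s + P (timeSlice θ s))
          (timeSlice θy s + D (timeSlice θ s)) s).re with hR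
  set W : ℕ → ℝ → ChannelL2 := fun N s => S N (S N (timeSlice θ s) + P (S N (timeSlice θ s)))
  set W' : ℕ → ℝ → ChannelL2 := fun N s => Cc N (Cc N (timeSlice θy s) + D (S N (timeSlice θ s)))
  set RN : ℕ → ℝ → ℝ := fun N s => 2 * (∑ n ∈ Finset.range N, ∑ m ∈ Finset.range N,
    inner ℂ (sinL2 n) (sinL2 m + P (sinL2 m)) *
        ((starRingEnd ℂ) (timeForm μ k θ θy g₁ g₂ (sinL2 n) ((modeFreq n : ℂ) • cosL2 n) s)
          * inner ℂ (sinL2 m) (timeSlice θ s))).re with hRN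
  have hFm : ∀ n, MemLp (timeForm μ k θ θy g₁ g₂ (sinL2 n) ((modeFreq n : ℂ) • cosL2 n)) 2 τ :=
    fun n => memLp_timeForm μ k hθ hθy hg₁ hg₂ _ _
  have hgal : ∀ᵐ t ∂τ, ∀ N, (inner ℂ (S N (timeSlice θ t))
      (S N (timeSlice θ t) + P (S N (timeSlice θ t)))).re =
      (inner ℂ (S N (hin.toLp θin)) (S N (hin.toLp θin) + P (S N (hin.toLp θin)))).re
        + ∫ s in (0 : ℝ)..t, RN N s := by
    rw [ae_all_iff]
    intro N
    have hq : ∀ n m, (starRingEnd ℂ) (inner ℂ (sinL2 n) (sinL2 m + P (sinL2 m)))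
        = inner ℂ (sinL2 m) (sinL2 n + P (sinL2 n)) := fun n m => by
      rw [inner_conj_symm, inner_add_left, inner_add_right, hsym]
    have := quadratic_form_primitive (T := T) (a := fun n t => inner ℂ (sinL2 n) (timeSlice θ t))
      (α := fun n => inner ℂ (sinL2 n) (hin.toLp θin)) hq
      (fun n => (hFm n).integrable (by norm_num)) (fun n => by
        have hw := hweak _ _ (isH10_sinMode n)
        rw [smul_cosL2_eq_toLp]
        exact sine_coefficient_eq hθ hθy hg₁ hg₂ hin (memLp_sinMode n)
          ((memLp_cosMode n).const_mul (modeFreq n : ℂ)) (conj_sinMode n)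
          (fun y => by rw [map_mul, conj_cosMode, Complex.conj_ofReal]) hw) N
    filter_upwards [this] with t ht
    rw [sum_quadratic_modes, sum_quadratic_modes] at ht
    exact ht
  have hRNeq : ∀ᵐ s ∂τ, ∀ N, RN N s = 2 * (timeForm μ k θ θy g₁ g₂ (W N s) (W' N s) s).re := by
    filter_upwards [hHτ] with s hs N
    simp only [hRN, timeForm]
    rw [sum_form_modes hs hPD N]
  -- convergence
  have hWlim : ∀ᵐ s ∂τ, Filter.Tendsto (fun N => RN N s) Filter.atTop (nhds (R s)) := by
    filter_upwards [hHτ, hRNeq] with s hs hEq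
    have hSt := hs.tendsto_modeProj
    have hCt := hs.tendsto_modeProj_deriv
    -- Projecting an approximating sequence is harmless, because the projections are contractions.
    have approx : ∀ {e : ℕ → ChannelL2} (_ : Orthonormal ℂ e) {x : ℕ → ChannelL2} {y : ChannelL2},
        Filter.Tendsto x Filter.atTop (nhds y) →
        Filter.Tendsto (fun N => modeProj e N y) Filter.atTop (nhds y) →
        Filter.Tendsto (fun N => modeProj e N (x N)) Filter.atTop (nhds y) := by
      intro e he x y hx hy
      have h0 : Filter.Tendsto (fun N => modeProj e N (x N - y)) Filter.atTop (nhds 0) := by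
        refine squeeze_zero_norm (fun N => norm_modeProj_le he N _) ?_
        have := (hx.sub_const y).norm
        simpa using this
      have := h0.add hy
      simpa [map_sub] using this
    -- Membership of `θ + Pθ` in `H¹₀` is what makes the outer projections converge, also for the
    -- derivative.
    have hpair := hs.add_L2 (hPD (timeSlice θ s))
    have hW : Filter.Tendsto (fun N => W N s) Filter.atTop
        (nhds (timeSlice θ s + P (timeSlice θ s))) :=
      approx orthonormal_sinL2 (hSt.add ((P.continuous.tendsto _).comp hSt)) hpair.tendsto_modeProj
    have hW' : Filter.Tendsto (fun N => W' N s) Filter.atTop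
        (nhds (timeSlice θy s + D (timeSlice θ s))) :=
      approx orthonormal_cosL2 (hCt.add ((D.continuous.tendsto _).comp hSt))
        hpair.tendsto_modeProj_deriv
    have hlim := ((continuous_temperatureForm μ k (timeSlice θ s) (timeSlice θy s)
      (timeSlice g₁ s) (timeSlice g₂ s)).tendsto _).comp (hW.prodMk_nhds hW')
    have := (((Complex.continuous_re.tendsto _).comp hlim).const_mul 2)
    refine this.congr fun N => ?_
    rw [hEq N]; rfl
  -- domination
  set M := |μ| * (1 + (k : ℝ) ^ 2) + |(k : ℝ)| + 1
  have hM : 0 ≤ M := by positivity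
  set Z : ℝ → ℝ := fun s => ‖timeSlice θ s‖ + ‖timeSlice θy s‖ + ‖timeSlice g₁ s‖ + ‖timeSlice g₂ s‖
  have hZ : MemLp Z 2 τ := (((memLp_norm_timeSlice hθ).add (memLp_norm_timeSlice hθy)).add
    (memLp_norm_timeSlice hg₁)).add (memLp_norm_timeSlice hg₂)
  -- The two test components are bounded by `(3/2)Z` and `(1 + ‖D‖)Z`.
  set L := 2 * (M * (5 / 2 + ‖D‖))
  have hbi : Integrable (fun s => L * Z s ^ 2) τ := hZ.integrable_sq.const_mul _
  have hbound : ∀ᵐ s ∂τ, ∀ N, ‖RN N s‖ ≤ L * Z s ^ 2 := by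
    filter_upwards [hRNeq] with s hEq N
    rw [hEq N, norm_mul, Real.norm_two]
    have h1 : ‖W N s‖ ≤ 3 / 2 * ‖timeSlice θ s‖ := by
      refine (norm_modeProj_le orthonormal_sinL2 N _).trans ((norm_add_le _ _).trans ?_)
      have := hP (S N (timeSlice θ s))
      have h2 : ‖S N (timeSlice θ s)‖ ≤ ‖timeSlice θ s‖ := norm_modeProj_le orthonormal_sinL2 N _
      linarith
    have h2 : ‖W' N s‖ ≤ ‖timeSlice θy s‖ + ‖D‖ * ‖timeSlice θ s‖ := by
      refine (norm_modeProj_le orthonormal_cosL2 N _).trans ((norm_add_le _ _).trans ?_)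
      refine add_le_add (norm_modeProj_le orthonormal_cosL2 N _) ((D.le_opNorm _).trans ?_)
      gcongr
      exact norm_modeProj_le orthonormal_sinL2 N _
    have hZ0 : 0 ≤ Z s := by positivity
    have h3 : ‖timeSlice θ s‖ ≤ Z s := by
      have := norm_nonneg (timeSlice θy s)
      have := norm_nonneg (timeSlice g₁ s)
      have := norm_nonneg (timeSlice g₂ s)
      simp only [Z]; linarith
    have h4 : ‖timeSlice θy s‖ ≤ Z s := by
      have := norm_nonneg (timeSlice θ s)
      have := norm_nonneg (timeSlice g₁ s)
      have := norm_nonneg (timeSlice g₂ s)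
      simp only [Z]; linarith
    have h5 : ‖W N s‖ + ‖W' N s‖ ≤ (5 / 2 + ‖D‖) * Z s := by
      have : ‖D‖ * ‖timeSlice θ s‖ ≤ ‖D‖ * Z s := by gcongr
      linarith
    calc 2 * ‖(timeForm μ k θ θy g₁ g₂ (W N s) (W' N s) s).re‖
        ≤ 2 * (M * Z s * (‖W N s‖ + ‖W' N s‖)) := by
          gcongr
          exact (Complex.abs_re_le_norm _).trans (norm_temperatureForm_le μ k _ _ _ _ _ _)
      _ ≤ 2 * (M * Z s * ((5 / 2 + ‖D‖) * Z s)) := by gcongr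
      _ = L * Z s ^ 2 := by simp only [L]; ring
  have hRNm : ∀ N, AEStronglyMeasurable (RN N) τ := by
    intro N
    have : AEStronglyMeasurable (fun s => ∑ n ∈ Finset.range N, ∑ m ∈ Finset.range N,
      inner ℂ (sinL2 n) (sinL2 m + P (sinL2 m)) *
        ((starRingEnd ℂ) (timeForm μ k θ θy g₁ g₂ (sinL2 n) ((modeFreq n : ℂ) • cosL2 n) s)
          * inner ℂ (sinL2 m) (timeSlice θ s))) τ := by
      refine Finset.aestronglyMeasurable_fun_sum _ fun n _ =>
        Finset.aestronglyMeasurable_fun_sum _ fun m _ => AEStronglyMeasurable.const_mul ?_ _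
      exact (Complex.continuous_conj.comp_aestronglyMeasurable (hFm n).1).mul
        (memLp_inner_timeSlice hθ _).1
    exact (Complex.continuous_re.comp_aestronglyMeasurable this).const_mul 2
  -- Measurability of the limit is inherited from the finite sums.
  have hRm : AEStronglyMeasurable R τ :=
    aestronglyMeasurable_of_tendsto_ae Filter.atTop hRNm hWlim
  have hRi : Integrable R τ := by
    refine hbi.mono' hRm ?_
    filter_upwards [hWlim, hbound] with s h1 h2
    exact le_of_tendsto h1.norm (Filter.Eventually.of_forall h2)
  refine ⟨hRi, ?_⟩
  filter_upwards [hgal, hHτ, ae_restrict_mem measurableSet_Ioo] with t ht hs htT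
  have hle : volume.restrict (Ioc 0 t) ≤ τ :=
    Measure.restrict_mono (fun s (hs : s ∈ Ioc 0 t) => (⟨hs.1, hs.2.trans_lt htT.2⟩ : s ∈ Ioo 0 T))
      le_rfl
  have hint : Filter.Tendsto (fun N => ∫ s in (0 : ℝ)..t, RN N s) Filter.atTop
      (nhds (∫ s in (0 : ℝ)..t, R s)) := by
    simp_rw [intervalIntegral.integral_of_le htT.1.le]
    refine tendsto_integral_of_dominated_convergence (fun s => L * Z s ^ 2)
      (fun N => (hRNm N).mono_measure hle) (hbi.mono_measure hle)
      (fun N => (hbound.filter_mono (ae_mono hle)).mono fun s h => h N) (hWlim.filter_mono (ae_mono hle))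
  have hE : Filter.Tendsto (fun N => (inner ℂ (S N (timeSlice θ t))
      (S N (timeSlice θ t) + P (S N (timeSlice θ t)))).re) Filter.atTop
      (nhds (inner ℂ (timeSlice θ t) (timeSlice θ t + P (timeSlice θ t))).re) := by
    have hc : Continuous fun f : ChannelL2 => (inner ℂ f (f + P f)).re :=
      Complex.continuous_re.comp (continuous_id.inner (continuous_id.add P.continuous))
    exact (hc.tendsto _).comp hs.tendsto_modeProj
  refine (re_inner_add_bounds hP _).1.trans ?_
  -- The initial datum lies only in `L²`, so its sine projections are bounded by Bessel's inequality
  -- before the limit rather than shown to converge. This is why the result is an inequality.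
  refine le_of_tendsto_of_tendsto' hE (hint.const_add (3 / 2 * ‖hin.toLp θin‖ ^ 2)) fun N => ?_
  rw [ht N]
  gcongr
  refine (re_inner_add_bounds hP _).2.trans ?_
  gcongr
  exact norm_modeProj_le orthonormal_sinL2 N _

/-! ### From estimates at almost every time to space-time norms -/

lemma eLpNorm_slice_eq {h : ℝ → ℝ → ℂ} {t : ℝ} (hm : MemLp (h t) 2 channelMeasure) :
    eLpNorm (h t) 2 channelMeasure = ‖timeSlice h t‖ₑ := by
  rw [Lp.enorm_def, eLpNorm_congr_ae (coeFn_timeSlice hm)]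

lemma normLpLq_two_two_sq {h : ℝ → ℝ → ℂ} (hm : ∀ᵐ t ∂timeMeasure, MemLp (h t) 2 channelMeasure) :
    normLpLq 2 2 h ^ 2 = ∫⁻ t, ‖timeSlice h t‖ₑ ^ 2 ∂timeMeasure := by
  rw [normLpLq, eLpNorm_two_sq_eq_lintegral]
  refine lintegral_congr_ae ?_
  filter_upwards [hm] with t ht
  rw [eLpNorm_slice_eq ht, enorm_eq_self]

lemma ofReal_intervalIntegral_norm_sq {h : ℝ → ℝ → ℂ} {t : ℝ} (ht : 0 ≤ t)
    (hi : IntegrableOn (fun s => ‖timeSlice h s‖ ^ 2) (Ioo 0 t)) :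
    ENNReal.ofReal (∫ s in (0 : ℝ)..t, ‖timeSlice h s‖ ^ 2)
      = ∫⁻ s in Ioo 0 t, ‖timeSlice h s‖ₑ ^ 2 := by
  rw [intervalIntegral.integral_of_le ht, integral_Ioc_eq_integral_Ioo,
    ofReal_integral_eq_lintegral_ofReal hi (Filter.Eventually.of_forall fun _ => sq_nonneg _)]
  refine lintegral_congr fun s => ?_
  rw [ENNReal.ofReal_pow (norm_nonneg _), ofReal_norm]

/-- Beyond every integer `n` there is a time at which the bound holds; monotone convergence in `n`
finishes. -/
lemma lintegral_timeMeasure_le {f : ℝ → ℝ≥0∞} {B : ℝ≥0∞}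
    (h : ∀ᵐ t ∂timeMeasure, ∫⁻ s in Ioo 0 t, f s ≤ B) : ∫⁻ s, f s ∂timeMeasure ≤ B := by
  have key : ∀ n : ℕ, ∫⁻ s in Ioo (0 : ℝ) n, f s ≤ B := by
    intro n
    have hle : volume.restrict (Ioi (n : ℝ)) ≤ timeMeasure :=
      Measure.restrict_mono (Ioi_subset_Ioi n.cast_nonneg) le_rfl
    have h1 := h.filter_mono (ae_mono hle)
    have : (ae (volume.restrict (Ioi (n : ℝ)))).NeBot := by
      rw [ae_neBot, Ne, Measure.restrict_eq_zero]
      simp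
    obtain ⟨t, ht, htn⟩ := (h1.and (ae_restrict_mem measurableSet_Ioi)).exists
    exact (lintegral_mono_set (Ioo_subset_Ioo_right (le_of_lt htn))).trans ht
  have hU : Ioi (0 : ℝ) = ⋃ n : ℕ, Ioo (0 : ℝ) n := by
    ext x
    simp only [mem_Ioi, mem_iUnion, mem_Ioo]
    exact ⟨fun hx => (exists_nat_gt x).imp fun n hn => ⟨hx, hn⟩, fun ⟨_, hx, _⟩ => hx⟩
  rw [timeMeasure, hU, setLIntegral_iUnion_of_directed]
  · exact iSup_le key
  · exact directed_of_isDirected_le fun m n hmn =>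
      Ioo_subset_Ioo_right (Nat.cast_le.2 hmn)

lemma ae_timeMeasure_of_forall_Ioo {p : ℝ → Prop}
    (h : ∀ T : ℝ, 0 < T → ∀ᵐ t ∂(volume.restrict (Ioo 0 T)), p t) : ∀ᵐ t ∂timeMeasure, p t := by
  have h' : ∀ n : ℕ, ∀ᵐ t, t ∈ Ioo (0 : ℝ) (n + 1) → p t := fun n =>
    (ae_restrict_iff' measurableSet_Ioo).1 (h _ (by positivity))
  rw [timeMeasure, ae_restrict_iff' measurableSet_Ioi]
  filter_upwards [ae_all_iff.2 h'] with t ht ht0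
  obtain ⟨n, hn⟩ := exists_nat_gt t
  exact ht n ⟨ht0, by linarith⟩

lemma MemL2L2.memL2LocL2 {g : ℝ → ℝ → ℂ} (hg : MemL2L2 g) : MemL2LocL2 g := fun _ _ =>
  MemLp.mono_measure (Measure.prod_mono
    (Measure.restrict_mono Ioo_subset_Ioi_self le_rfl) le_rfl) hg

lemma MemL2LocL2.ae_memLp {h : ℝ → ℝ → ℂ} (hh : MemL2LocL2 h) :
    ∀ᵐ t ∂timeMeasure, MemLp (h t) 2 channelMeasure :=
  ae_timeMeasure_of_forall_Ioo fun T hT => ae_memLp_slice (hh T hT)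

/-- The enhanced dissipation estimate at almost every time. -/
lemma ae_enhanced_dissipation : ∃ η C : ℝ, 0 < η ∧ 0 < C ∧
    ∀ (μ : ℝ), 0 < μ → ∀ (k : ℤ) (θin : ℝ → ℂ) (g₁ g₂ θ : ℝ → ℝ → ℂ)
      (hin : MemLp θin 2 channelMeasure), MemL2L2 g₁ → MemL2L2 g₂ →
      IsTemperatureSolution μ k θin g₁ g₂ θ → ∀ T : ℝ, 0 < T →
      ∀ᵐ t ∂(volume.restrict (Ioo 0 T)),
        ‖timeSlice θ t‖ ^ 2 + 2 * η * (μ * (k : ℝ) ^ 2) ^ (1 / 3 : ℝ)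
            * ∫ s in (0 : ℝ)..t, ‖timeSlice θ s‖ ^ 2 ≤
          3 * ‖hin.toLp θin‖ ^ 2 + 2 * C * (μ ^ (-(1 / 3) : ℝ) * |(k : ℝ)| ^ (4 / 3 : ℝ)
            * (∫ s in (0 : ℝ)..t, ‖timeSlice g₁ s‖ ^ 2)
            + μ⁻¹ * ∫ s in (0 : ℝ)..t, ‖timeSlice g₂ s‖ ^ 2) := by
  obtain ⟨η, C, hη, hC, hmul⟩ := exists_multiplier
  refine ⟨η, C, hη, hC, fun μ hμ k θin g₁ g₂ θ hin hg₁ hg₂ hsol T hT => ?_⟩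
  obtain ⟨P, D, hsym, hP, hPD, hest⟩ := hmul μ hμ k
  obtain ⟨hθ, θy, hθy, hH, hweak⟩ := hsol
  have a1 := hθ T hT
  have a2 := hθy T hT
  have a3 := hg₁.memL2LocL2 T hT
  have a4 := hg₂.memL2LocL2 T hT
  obtain ⟨hRi, hE⟩ := multiplier_energy_inequality a1 a2 a3 a4 hin hH hweak hsym hP hPD
  set r := (μ * (k : ℝ) ^ 2) ^ (1 / 3 : ℝ)
  set K := μ ^ (-(1 / 3) : ℝ) * |(k : ℝ)| ^ (4 / 3 : ℝ)
  have hint : ∀ {h : ℝ → ℝ → ℂ},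
      MemLp (Function.uncurry h) 2 ((volume.restrict (Ioo 0 T)).prod channelMeasure) →
      ∀ t ∈ Ioo 0 T, IntervalIntegrable (fun s => ‖timeSlice h s‖ ^ 2) volume 0 t := by
    intro h hh t ht
    rw [intervalIntegrable_iff_integrableOn_Ioo_of_le ht.1.le]
    exact IntegrableOn.mono_set (memLp_norm_timeSlice hh).integrable_sq
      (Ioo_subset_Ioo_right ht.2.le)
  filter_upwards [hE, ae_restrict_mem measurableSet_Ioo] with t hEt ht
  have i1 := hint a1 t ht
  have i3 := hint a3 t ht
  have i4 := hint a4 t ht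
  have hRt : IntervalIntegrable (fun s => 2 * (timeForm μ k θ θy g₁ g₂ (timeSlice θ s
      + P (timeSlice θ s)) (timeSlice θy s + D (timeSlice θ s)) s).re) volume 0 t := by
    rw [intervalIntegrable_iff_integrableOn_Ioo_of_le ht.1.le]
    exact IntegrableOn.mono_set hRi (Ioo_subset_Ioo_right ht.2.le)
  have hmono : ∫ s in (0 : ℝ)..t, 2 * (timeForm μ k θ θy g₁ g₂ (timeSlice θ s
      + P (timeSlice θ s)) (timeSlice θy s + D (timeSlice θ s)) s).re ≤
      ∫ s in (0 : ℝ)..t, (C * (K * ‖timeSlice g₁ s‖ ^ 2 + μ⁻¹ * ‖timeSlice g₂ s‖ ^ 2)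
        - η * r * ‖timeSlice θ s‖ ^ 2) := by
    refine intervalIntegral.integral_mono_ae_restrict ht.1.le hRt
      ((((i3.const_mul K).add (i4.const_mul μ⁻¹)).const_mul C).sub (i1.const_mul (η * r))) ?_
    -- The comparison of integrals takes place on the closed interval `[0, t]`, whose left endpoint
    -- is null.
    have hH' := hH.filter_mono (ae_mono (Measure.restrict_mono
      (Icc_subset_Ici_self : Icc 0 t ⊆ Ici 0) le_rfl |>.trans_eq
      (restrict_Ioi_eq_restrict_Ici).symm))
    filter_upwards [hH'] with s hs
    have := hest _ _ hs.timeSlice (timeSlice g₁ s) (timeSlice g₂ s)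
    simp only [timeForm]
    linarith
  rw [intervalIntegral.integral_sub (((i3.const_mul K).add (i4.const_mul μ⁻¹)).const_mul C)
    (i1.const_mul (η * r)), intervalIntegral.integral_const_mul C,
    intervalIntegral.integral_add (i3.const_mul K) (i4.const_mul μ⁻¹),
    intervalIntegral.integral_const_mul K, intervalIntegral.integral_const_mul μ⁻¹,
    intervalIntegral.integral_const_mul (η * r)] at hmono
  -- Doubling turns the factors `1/2` and `3/2` of the energy equivalence into `1` and `3`, and
  -- produces `2η` and `2C`.
  linarith

theorem mainTheorem4 :
    ∃ C : ℝ, 0 < C ∧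
      ∀ (μ : ℝ), 0 < μ → ∀ (k : ℤ) (θin : ℝ → ℂ) (g₁ g₂ θ : ℝ → ℝ → ℂ),
        MemLp θin 2 channelMeasure → MemL2L2 g₁ → MemL2L2 g₂ →
        IsTemperatureSolution μ k θin g₁ g₂ θ →
        normLpLq ∞ 2 θ ^ 2
            + ENNReal.ofReal ((μ * (k : ℝ) ^ 2) ^ (1 / 3 : ℝ)) * normLpLq 2 2 θ ^ 2 ≤
          ENNReal.ofReal C *
            (normL2 θin ^ 2
              + (ENNReal.ofReal (μ ^ (-(1 / 3) : ℝ) * |(k : ℝ)| ^ (4 / 3 : ℝ))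
                    * normLpLq 2 2 g₁ ^ 2
                + ENNReal.ofReal (μ⁻¹) * normLpLq 2 2 g₂ ^ 2)) := by
  obtain ⟨η, C, hη, hC, hmain⟩ := ae_enhanced_dissipation
  -- The supremum and the dissipation are each bounded by `3 + 2C` times the data, the latter after
  -- division by `2η`, and then added.
  refine ⟨(1 + (2 * η)⁻¹) * (3 + 2 * C), by positivity,
    fun μ hμ k θin g₁ g₂ θ hin hg₁ hg₂ hsol => ?_⟩
  have hθ := hsol.1
  rw [normLpLq_two_two_sq hθ.ae_memLp, normLpLq_two_two_sq hg₁.memL2LocL2.ae_memLp,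
    normLpLq_two_two_sq hg₂.memL2LocL2.ae_memLp]
  set r := (μ * (k : ℝ) ^ 2) ^ (1 / 3 : ℝ)
  have hr : 0 ≤ r := by positivity
  set K := μ ^ (-(1 / 3) : ℝ) * |(k : ℝ)| ^ (4 / 3 : ℝ)
  have hK : 0 ≤ K := by positivity
  have hμ' : 0 < μ⁻¹ := inv_pos.2 hμ
  set B := normL2 θin ^ 2 + (ENNReal.ofReal K * ∫⁻ t, ‖timeSlice g₁ t‖ₑ ^ 2 ∂timeMeasure
    + ENNReal.ofReal μ⁻¹ * ∫⁻ t, ‖timeSlice g₂ t‖ₑ ^ 2 ∂timeMeasure) with hB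
  set C' := ENNReal.ofReal (3 + 2 * C) with hC'
  have hinn : normL2 θin ^ 2 = ENNReal.ofReal (‖hin.toLp θin‖ ^ 2) := by
    rw [ENNReal.ofReal_pow (norm_nonneg _), Lp.norm_toLp, ENNReal.ofReal_toReal hin.2.ne, normL2]
  -- The data are enlarged to the whole half-line, so the right side no longer depends on `t`.
  -- Dropping either term on the left then gives one of the two bounds.
  have key : ∀ᵐ t ∂timeMeasure, ‖timeSlice θ t‖ₑ ^ 2
      + ENNReal.ofReal (2 * η * r) * ∫⁻ s in Ioo 0 t, ‖timeSlice θ s‖ₑ ^ 2 ≤ C' * B := by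
    refine ae_timeMeasure_of_forall_Ioo fun T hT => ?_
    filter_upwards [hmain μ hμ k θin g₁ g₂ θ hin hg₁ hg₂ hsol T hT,
      ae_restrict_mem measurableSet_Ioo] with t ht htT
    have hint : ∀ {h : ℝ → ℝ → ℂ}, MemL2LocL2 h →
        ENNReal.ofReal (∫ s in (0 : ℝ)..t, ‖timeSlice h s‖ ^ 2)
          = ∫⁻ s in Ioo 0 t, ‖timeSlice h s‖ₑ ^ 2 := fun hh =>
      ofReal_intervalIntegral_norm_sq htT.1.le (IntegrableOn.mono_set
        (memLp_norm_timeSlice (hh T hT)).integrable_sq (Ioo_subset_Ioo_right htT.2.le))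
    have hle : volume.restrict (Ioo 0 t) ≤ timeMeasure :=
      Measure.restrict_mono Ioo_subset_Ioi_self le_rfl
    have hnn : ∀ h : ℝ → ℝ → ℂ, 0 ≤ ∫ s in (0 : ℝ)..t, ‖timeSlice h s‖ ^ 2 := fun h =>
      intervalIntegral.integral_nonneg htT.1.le fun _ _ => sq_nonneg _
    have h1 := hnn g₁
    have h2 := hnn g₂
    have ht' : ‖timeSlice θ t‖ ^ 2 + 2 * η * r * ∫ s in (0 : ℝ)..t, ‖timeSlice θ s‖ ^ 2 ≤
        (3 + 2 * C) * (‖hin.toLp θin‖ ^ 2 + (K * (∫ s in (0 : ℝ)..t, ‖timeSlice g₁ s‖ ^ 2)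
            + μ⁻¹ * ∫ s in (0 : ℝ)..t, ‖timeSlice g₂ s‖ ^ 2)) := by
      refine ht.trans ?_
      have e1 : 0 ≤ ‖hin.toLp θin‖ ^ 2 := sq_nonneg _
      have e2 : 0 ≤ K * (∫ s in (0 : ℝ)..t, ‖timeSlice g₁ s‖ ^ 2)
            + μ⁻¹ * ∫ s in (0 : ℝ)..t, ‖timeSlice g₂ s‖ ^ 2 := by positivity
      nlinarith [mul_nonneg hC.le e1]
    have ht'' := ENNReal.ofReal_le_ofReal ht'
    rw [ENNReal.ofReal_add (sq_nonneg _) (mul_nonneg (by positivity) (hnn θ)),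
      ENNReal.ofReal_mul (by positivity : 0 ≤ 2 * η * r), hint hθ,
      ENNReal.ofReal_pow (norm_nonneg _), ofReal_norm,
      ENNReal.ofReal_mul (by positivity : 0 ≤ 3 + 2 * C),
      ENNReal.ofReal_add (sq_nonneg _) (by positivity), ← hinn,
      ENNReal.ofReal_add (mul_nonneg hK h1) (mul_nonneg hμ'.le h2), ENNReal.ofReal_mul hK,
      ENNReal.ofReal_mul hμ'.le, hint hg₁.memL2LocL2, hint hg₂.memL2LocL2] at ht''
    refine ht''.trans ?_
    rw [hB]
    gcongr
  have hsup : normLpLq ∞ 2 θ ^ 2 ≤ C' * B := by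
    have hroot : normLpLq ∞ 2 θ ≤ (C' * B) ^ (1 / 2 : ℝ) := by
      rw [normLpLq, eLpNorm_exponent_top]
      refine essSup_le_of_ae_le _ ?_
      filter_upwards [key, hθ.ae_memLp] with t ht hm
      rw [enorm_eq_self, eLpNorm_slice_eq hm]
      have h1 : ‖timeSlice θ t‖ₑ ^ 2 ≤ C' * B := le_self_add.trans ht
      calc ‖timeSlice θ t‖ₑ = (‖timeSlice θ t‖ₑ ^ (2 : ℝ)) ^ (1 / 2 : ℝ) := by
            rw [← ENNReal.rpow_mul]; norm_num
        _ ≤ _ := by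
            rw [ENNReal.rpow_two]
            exact ENNReal.rpow_le_rpow h1 (by norm_num)
    calc _ ≤ ((C' * B) ^ (1 / 2 : ℝ)) ^ 2 := pow_le_pow_left' hroot 2
      _ = C' * B := by rw [← ENNReal.rpow_two, ← ENNReal.rpow_mul]; norm_num
  have hdiss : ENNReal.ofReal (2 * η * r) * ∫⁻ s, ‖timeSlice θ s‖ₑ ^ 2 ∂timeMeasure ≤ C' * B := by
    rw [← lintegral_const_mul' _ _ ENNReal.ofReal_ne_top]
    refine lintegral_timeMeasure_le ?_
    filter_upwards [key] with t ht
    rw [lintegral_const_mul' _ _ ENNReal.ofReal_ne_top]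
    exact le_add_self.trans ht
  have hdiss' : ENNReal.ofReal r * ∫⁻ s, ‖timeSlice θ s‖ₑ ^ 2 ∂timeMeasure
      ≤ ENNReal.ofReal (2 * η)⁻¹ * (C' * B) := by
    have e : ENNReal.ofReal r = ENNReal.ofReal (2 * η)⁻¹ * ENNReal.ofReal (2 * η * r) := by
      rw [← ENNReal.ofReal_mul (by positivity), inv_mul_cancel_left₀ (by positivity)]
    rw [e, mul_assoc]
    gcongr
  calc _ ≤ C' * B + ENNReal.ofReal (2 * η)⁻¹ * (C' * B) := add_le_add hsup hdiss'
    _ = _ := by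
      rw [ENNReal.ofReal_mul (by positivity), ENNReal.ofReal_add zero_le_one (by positivity),
        ENNReal.ofReal_one]
      ring

end
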